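/- Let $F$ be a germ of a holomorphic diffeomorphism of $(\mathbb C^2,0)$, and let $\Gamma\subset\mathbb C[[x,y]]$ be an irreducible formal invariant curve of $F$: an ideal generated by an irreducible series such that $h\circ F\in\Gamma$ for every $h\in\Gamma$. Let $\lambda(\Gamma)$ be the tangent eigenvalue of $\Gamma$, i.e. the eigenvalue of $DF(0)$ on the tangent line of $\Gamma$ at $0$, and assume $|\lambda(\Gamma)|<1$. A (non-trivial) stable orbit of $F$ is a sequence $a_{n+1}=F(a_n)$ of points of $\mathbb C^2\setminus\{0\}$ that converges to $0$. It is asymptotic to $\Gamma$ if, for $S_0=\{a_n\}_{n\ge 0}$, $q_0=0$, and successively for $k\ge 0$: when $\pi_{k+1}$ is the blow-up at $q_k$ and $S_{k+1}=\pi_{k+1}^{-1}(S_k)$, the set $\overline{S_{k+1}}\cap\pi_{k+1}^{-1}(q_k)$ consists of a single point $q_{k+1}$, and this point is the $(k+1)$-st infinitely near point of $\Gamma$, i.e. the point of $\pi_{k+1}^{-1}(q_k)$ given by the tangent line at $q_k$ of the $k$-th strict transform of $\Gamma$. Then every stable orbit of $F$ asymptotic to $\Gamma$ is contained in $\Gamma$,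 in the following sense. The curve $\Gamma$ is analytic, and there are an open neighbourhood $U$ of $0$, on which $F$ is (represented by) an injective holomorphic map, and a holomorphic function $f$ on $U$ whose Taylor series at $0$ generates $\Gamma$ such that, with $Z=\{z\in U: f(z)=0\}$, every stable orbit $(a_n)$ of $F$ asymptotic to $\Gamma$ satisfies $a_n\in Z$ for all sufficiently large $n$, and $a_n\in Z$ for all $n\ge 0$ if $a_n\in U$ for all $n\ge 0$. -/

import Mathlib

open Filter Topology

namespace FormalCurves

/-- The plane `ℂ²`, as a topological vector space. -/
abbrev Plane : Type := Fin 2 → ℂ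

/-- The ring `ℂ[[x, y]]`, with `x = X 0` and `y = X 1`. -/
abbrev Series : Type := MvPowerSeries (Fin 2) ℂ

/-- Near the origin the function `g` is the sum of the (convergent) power series `φ`;
that is, `g` is holomorphic at `0` and `φ` is its Taylor series. -/
def HasExpansion (g : Plane → ℂ) (φ : Series) : Prop :=
  ∀ᶠ z in 𝓝 (0 : Plane),
    HasSum (fun e : Fin 2 →₀ ℕ => MvPowerSeries.coeff e φ * ∏ i, z i ^ e i) (g z)

/-- `F` represents a germ of holomorphic diffeomorphism of `(ℂ², 0)`. -/
structure IsDiffGerm (F : Plane → Plane) : Prop where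
  analyticAt : AnalyticAt ℂ F 0
  map_zero : F 0 = 0
  bijective_fderiv : Function.Bijective (fderiv ℂ F 0)

/-- Irreducible formal curves at `0 ∈ ℂ²`: ideals of `ℂ[[x, y]]` generated by an
irreducible series. -/
def IsFormalCurve (Γ : Ideal Series) : Prop :=
  ∃ f : Series, Irreducible f ∧ Γ = Ideal.span {f}

/-- `Γ` is an (irreducible) formal invariant curve of `F`: `h ∘ F ∈ Γ` for every `h ∈ Γ`,
where the composition is substitution of the Taylor series `Φ` of `F`. -/
def IsInvariantCurve (F : Plane → Plane) (Γ : Ideal Series) : Prop :=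
  IsFormalCurve Γ ∧
    ∃ Φ : Fin 2 → Series, (∀ i, HasExpansion (fun z => F z i) (Φ i)) ∧
      ∀ h ∈ Γ, MvPowerSeries.subst Φ h ∈ Γ

/-- The value at `v` of the initial form `f_ν` of `f = f_ν + f_{ν+1} + ⋯`, where `ν` is the
order of `f` and `f_k` is the homogeneous part of degree `k`. -/
noncomputable def initialForm (f : Series) (v : Plane) : ℂ :=
  ∑ k ∈ Finset.range ((MvPowerSeries.order f).toNat + 1),
    MvPowerSeries.coeff
      (Finsupp.single 0 k + Finsupp.single 1 ((MvPowerSeries.order f).toNat - k)) f *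
      v 0 ^ k * v 1 ^ ((MvPowerSeries.order f).toNat - k)

/-- `v` is a non-zero vector on the tangent line of the formal curve `Γ`, which is the zero
set of the initial form of a generator. -/
def IsTangentVector (Γ : Ideal Series) (v : Plane) : Prop :=
  v ≠ 0 ∧ ∃ f : Series, Γ = Ideal.span {f} ∧ initialForm f v = 0

/-- `c` is the eigenvalue of `DF(0)` on the tangent line of `Γ`. -/
def IsTangentEigenvalue (F : Plane → Plane) (Γ : Ideal Series) (c : ℂ) : Prop :=
  ∃ v : Plane, IsTangentVector Γ v ∧ fderiv ℂ F 0 v = c • v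

/-! ### Blowing up the origin

The blow-up of `ℂ²` at `0` is the closed subset `{(z, ℓ) | z ∈ ℓ}` of `ℂ² × ℙ¹`, with the
projection `(z, ℓ) ↦ z` and the exceptional divisor `{0} × ℙ¹`. The projective line is the Riemann
sphere `OnePoint ℂ`: the slope `c` stands for the line `[1 : c]`, and `∞` for `[0 : 1]`. -/

/-- A vector that spans the line `ℓ`. -/
def lineVector : OnePoint ℂ → Plane
  | .some c => ![1, c]
  | .infty => ![0, 1]

/-- The line through `0` and the point `z ≠ 0`. -/
noncomputable def lineThrough (z : Plane) : OnePoint ℂ :=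
  if z 0 = 0 then .infty else .some (z 1 / z 0)

/-- The blow-up map in the standard coordinates `(x', y')` of the blow-up centred at the point
`ℓ` of the exceptional divisor: `(x', y') ↦ (x', x' (c + y'))` at slope `c`, and
`(x', y') ↦ (x' y', y')` at `∞`. -/
def blowUp : OnePoint ℂ → Plane → Plane
  | .some c => fun z => ![z 0, z 0 * (c + z 1)]
  | .infty => fun z => ![z 0 * z 1, z 1]

/-- The components of `blowUp ℓ` as power series. -/
noncomputable def blowUpSeries : OnePoint ℂ → Fin 2 → Series
  | .some c => ![MvPowerSeries.X 0, MvPowerSeries.X 0 * (MvPowerSeries.C c + MvPowerSeries.X 1)]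
  | .infty => ![MvPowerSeries.X 0 * MvPowerSeries.X 1, MvPowerSeries.X 1]

/-- The exceptional divisor as a formal curve at its point `ℓ`, in the coordinates of
`blowUp ℓ`. -/
noncomputable def exceptionalDivisor : OnePoint ℂ → Ideal Series
  | .some _ => Ideal.span {MvPowerSeries.X 0}
  | .infty => Ideal.span {MvPowerSeries.X 1}

/-- `Γ'` is the strict transform of the formal curve `Γ` at the point `ℓ` of the exceptional
divisor: an irreducible formal curve other than the divisor that contains `h ∘ π` for `h ∈ Γ`. -/
def IsStrictTransform (ℓ : OnePoint ℂ) (Γ Γ' : Ideal Series) : Prop :=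
  IsFormalCurve Γ' ∧ Γ' ≠ exceptionalDivisor ℓ ∧
    ∀ h ∈ Γ, MvPowerSeries.subst (blowUpSeries ℓ) h ∈ Γ'

/-- `ℓ` is the sequence of infinitely near points of `Γ`: `ℓ n` is the point of the `(n+1)`-st
exceptional divisor given by the tangent line of the `n`-th strict transform `G n`, in the
coordinates centred at the previous point. -/
def IsInfinitelyNearSeq (Γ : Ideal Series) (ℓ : ℕ → OnePoint ℂ) : Prop :=
  ∃ G : ℕ → Ideal Series, G 0 = Γ ∧
    ∀ n, IsTangentVector (G n) (lineVector (ℓ n)) ∧ IsStrictTransform (ℓ n) (G n) (G (n + 1))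

/-- For a set `S` not containing `0`: the points of the exceptional divisor that lie in the
closure, in the blow-up, of the inverse image of `S`. -/
def tangentSet (S : Set Plane) : Set (OnePoint ℂ) :=
  {ℓ | ((0 : Plane), ℓ) ∈ closure ((fun z : Plane => (z, lineThrough z)) '' S)}

/-- The successive inverse images of `S` under the blow-ups at the points `ℓ 0, ℓ 1, …`, in the
coordinates centred at these points. -/
def transform (ℓ : ℕ → OnePoint ℂ) (S : Set Plane) : ℕ → Set Plane
  | 0 => S
  | n + 1 => blowUp (ℓ n) ⁻¹' transform ℓ S n

/-- `S` has the property of iterated tangents, with sequence of iterated tangents `ℓ`. -/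
def HasIteratedTangents (S : Set Plane) (ℓ : ℕ → OnePoint ℂ) : Prop :=
  (0 : Plane) ∉ S ∧ ∀ n, tangentSet (transform ℓ S n) = {ℓ n}

/-- `S` is asymptotic to `Γ`: it has iterated tangents, and they are the infinitely near points
of `Γ`. -/
def IsAsymptoticTo (S : Set Plane) (Γ : Ideal Series) : Prop :=
  ∃ ℓ : ℕ → OnePoint ℂ, HasIteratedTangents S ℓ ∧ IsInfinitelyNearSeq Γ ℓ

/-- A non-trivial stable orbit of `F`: an orbit in `ℂ² ∖ {0}` that converges to `0`. -/
structure IsStableOrbit (F : Plane → Plane) (a : ℕ → Plane) : Prop where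
  step : ∀ n, a (n + 1) = F (a n)
  ne_zero : ∀ n, a n ≠ 0
  tendsto_zero : Tendsto a atTop (𝓝 0)

/-- `Z` is an analytic representative of `Γ` in the open neighbourhood `U` of `0`: it is the zero
set in `U` of a holomorphic function whose Taylor series at `0` generates `Γ`. -/
def IsAnalyticRepresentative (Γ : Ideal Series) (U Z : Set Plane) : Prop :=
  IsOpen U ∧ (0 : Plane) ∈ U ∧
    ∃ (f : Plane → ℂ) (φ : Series), AnalyticOnNhd ℂ f U ∧ HasExpansion f φ ∧
      Γ = Ideal.span {φ} ∧ Z = {z ∈ U | f z = 0}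

end FormalCurves

open FormalCurves

/-! The argument has three parts: the curve, the contact of the orbit with it, and the dynamics.

Curve. Let `f` generate `Γ`, so that `f ∘ F = u f`. In linear coordinates whose first axis is the
tangent of `Γ`, `DF(0)` is upper triangular with diagonal `(c, μ)`. If `|μ| < 1`, then `F` is a
contraction. Solving a cohomological equation (`exists_eq_mul_subst`) gives an associate `g` of `f`
with `g ∘ F = u(0) g`, and such a formal eigenvector converges (`majorant_ne_top_of_subst_eq_smul`).
If `|μ| ≥ 1`, then `μ ≠ c ^ k` for all `k ≥ 2`, so there is a formal invariant graph `y = s(x)`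
(`exists_graphDefect_eq_zero`). It converges (`convergent_of_graphDefect_eq_zero`), and a comparison
of multipliers shows that `f` vanishes on it (`subst_graphArc_eq_zero`); by irreducibility its
equation generates `Γ`. In both cases `Γ` is generated by a convergent `g` with `g ∘ F = w g`, `w(0)
≠ 0`, and in a suitable norm `|F(z)| ≤ κ |z| + C |g(z)|` with `κ < 1`
(`exists_analytic_invariant_curve`).

Contact. Each blow-up at an infinitely near point of `Γ` splits off one exceptional coordinate from
`g`, so `|g(a_n)|` is at most a constant times a product of the norms of arbitrarily many successive
lifts of `a_n`. The multiplicities of the strict transforms are eventually constant, say from level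
`K` on. From there on each strict transform is transversal to the preceding divisor, so every later
lift is bounded by a multiple of the `K`-th one, and a fixed power of the `K`-th lift is bounded by
a multiple of `|a_n|`. Hence `g(a_n) = O(|a_n| ^ k)` for every `k` (`norm_ev_le_of_isAsymptoticTo`).

Dynamics. Contact of order two makes `C |g(a_n)|` negligible against `|a_n|`, so `|a_n|` decays
geometrically in the adapted norm. On the other hand `|g(a_(n+1))| ≥ δ |g(a_n)|` with `δ = |w(0)| /
2`. A non-zero `g(a_n)` would thus decay at most geometrically, against contact of an order `k` for
which the `k`-th power of the contraction rate is below `δ` (`forall_eq_zero_of_decay`). -/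

namespace FormalCurves

open MvPowerSeries
open scoped ENNReal

/-! ### Weighted `ℓ¹`-norms of power series and convergence -/

section Majorant

variable {σ τ : Type*}

/-- The weighted `ℓ¹`-norm `∑ |φ_e| r^|e|` of a power series. -/
noncomputable def majorant (r : ℝ≥0∞) (φ : MvPowerSeries σ ℂ) : ℝ≥0∞ :=
  ∑' e : σ →₀ ℕ, ‖coeff e φ‖ₑ * r ^ e.degree

lemma majorant_mono_coeff {r : ℝ≥0∞} {φ ψ : MvPowerSeries σ ℂ}
    (h : ∀ e, ‖coeff e φ‖ₑ ≤ ‖coeff e ψ‖ₑ) : majorant r φ ≤ majorant r ψ :=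
  ENNReal.tsum_le_tsum fun e => by gcongr; exact h e

lemma majorant_mono {r s : ℝ≥0∞} (h : r ≤ s) (φ : MvPowerSeries σ ℂ) :
    majorant r φ ≤ majorant s φ :=
  ENNReal.tsum_le_tsum fun e => by gcongr

lemma majorant_add_le (r : ℝ≥0∞) (φ ψ : MvPowerSeries σ ℂ) :
    majorant r (φ + ψ) ≤ majorant r φ + majorant r ψ := by
  rw [majorant, majorant, majorant, ← ENNReal.tsum_add]
  refine ENNReal.tsum_le_tsum fun e => ?_
  rw [← add_mul, map_add]
  gcongr
  exact enorm_add_le _ _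

lemma majorant_smul (r : ℝ≥0∞) (c : ℂ) (φ : MvPowerSeries σ ℂ) :
    majorant r (c • φ) = ‖c‖ₑ * majorant r φ := by
  rw [majorant, majorant, ← ENNReal.tsum_mul_left]
  refine tsum_congr fun e => ?_
  rw [map_smul, smul_eq_mul, enorm_mul, mul_assoc]

lemma majorant_neg (r : ℝ≥0∞) (φ : MvPowerSeries σ ℂ) : majorant r (-φ) = majorant r φ := by
  simpa using majorant_smul r (-1) φ

lemma majorant_sub_le (r : ℝ≥0∞) (φ ψ : MvPowerSeries σ ℂ) :
    majorant r (φ - ψ) ≤ majorant r φ + majorant r ψ := by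
  rw [sub_eq_add_neg, ← majorant_neg r ψ]
  exact majorant_add_le _ _ _

lemma majorant_sum_le {ι : Type*} (r : ℝ≥0∞) (s : Finset ι) (φ : ι → MvPowerSeries σ ℂ) :
    majorant r (∑ i ∈ s, φ i) ≤ ∑ i ∈ s, majorant r (φ i) := by
  classical
  induction s using Finset.induction_on with
  | empty => simp [majorant]
  | insert i s hi ih =>
    rw [Finset.sum_insert hi, Finset.sum_insert hi]
    exact (majorant_add_le _ _ _).trans (by gcongr)

lemma majorant_monomial (r : ℝ≥0∞) (e : σ →₀ ℕ) (c : ℂ) :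
    majorant r (monomial e c) = ‖c‖ₑ * r ^ e.degree := by
  classical
  rw [majorant, tsum_eq_single e]
  · simp
  · intro d hd
    simp [coeff_monomial, hd]

lemma majorant_C (r : ℝ≥0∞) (c : ℂ) : majorant r (C c : MvPowerSeries σ ℂ) = ‖c‖ₑ := by
  simpa [monomial_zero_eq_C_apply] using majorant_monomial r (0 : σ →₀ ℕ) c

lemma majorant_X (r : ℝ≥0∞) (i : σ) : majorant r (X i : MvPowerSeries σ ℂ) = r := by
  rw [X, majorant_monomial]
  simp

lemma tsum_antidiagonal_eq [DecidableEq σ] (f g : (σ →₀ ℕ) → ℝ≥0∞) :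
    ∑' e : σ →₀ ℕ, ∑ p ∈ Finset.HasAntidiagonal.antidiagonal e, f p.1 * g p.2 =
      (∑' e, f e) * ∑' e, g e := by
  have h1 : ∀ e, ∑ p ∈ Finset.HasAntidiagonal.antidiagonal e, f p.1 * g p.2
      = ∑' p : Finset.HasAntidiagonal.antidiagonal e, f p.1.1 * g p.1.2 := fun e =>
    (Finset.tsum_subtype (Finset.HasAntidiagonal.antidiagonal e) fun p => f p.1 * g p.2).symm
  simp_rw [h1]
  rw [← ENNReal.tsum_sigma (fun e (p : Finset.HasAntidiagonal.antidiagonal e) => f p.1.1 * g p.1.2)]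
  rw [show (∑' p : Σ e : σ →₀ ℕ, Finset.HasAntidiagonal.antidiagonal e, f p.2.1.1 * g p.2.1.2) =
    ∑' p : (σ →₀ ℕ) × (σ →₀ ℕ), f p.1 * g p.2 from
    (Finset.HasAntidiagonal.sigmaAntidiagonalEquivProd).tsum_eq
      (fun p : (σ →₀ ℕ) × (σ →₀ ℕ) => f p.1 * g p.2)]
  rw [ENNReal.tsum_prod', ← ENNReal.tsum_mul_right]
  simp only [ENNReal.tsum_mul_left]

lemma tsum_mul_tsum_eq_tsum_antidiagonal [DecidableEq σ] {f g : (σ →₀ ℕ) → ℂ}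
    (hf : Summable fun e => ‖f e‖) (hg : Summable fun e => ‖g e‖) :
    (∑' e, f e) * ∑' e, g e =
      ∑' e : σ →₀ ℕ, ∑ p ∈ Finset.HasAntidiagonal.antidiagonal e, f p.1 * g p.2 :=
  hf.of_norm.tsum_mul_tsum_eq_tsum_sum_antidiagonal hg.of_norm (summable_mul_of_summable_norm hf hg)

lemma majorant_mul_le (r : ℝ≥0∞) (φ ψ : MvPowerSeries σ ℂ) :
    majorant r (φ * ψ) ≤ majorant r φ * majorant r ψ := by
  classical
  rw [majorant, majorant, majorant, ← tsum_antidiagonal_eq]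
  refine ENNReal.tsum_le_tsum fun e => ?_
  rw [coeff_mul]
  refine (mul_le_mul_left (enorm_sum_le _ _) _).trans ?_
  rw [Finset.sum_mul]
  refine Finset.sum_le_sum fun p hp => ?_
  rw [← Finset.HasAntidiagonal.mem_antidiagonal.1 hp, map_add, pow_add, enorm_mul]
  exact le_of_eq (by ring)

lemma majorant_one (r : ℝ≥0∞) : majorant r (1 : MvPowerSeries σ ℂ) = 1 := by
  simpa using majorant_C (σ := σ) r 1

lemma majorant_pow_le {r s : ℝ≥0∞} {φ : MvPowerSeries σ ℂ} (h : majorant r φ ≤ s) (n : ℕ) :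
    majorant r (φ ^ n) ≤ s ^ n := by
  induction n with
  | zero => simp [majorant_one]
  | succ n ih =>
    rw [pow_succ, pow_succ]
    exact (majorant_mul_le _ _ _).trans (by gcongr)

lemma majorant_finsuppProd_le {r s : ℝ≥0∞} {a : σ → MvPowerSeries τ ℂ}
    (h : ∀ i, majorant r (a i) ≤ s) (d : σ →₀ ℕ) :
    majorant r (d.prod fun i n => a i ^ n) ≤ s ^ d.degree := by
  classical
  have key : ∀ t : Finset σ, majorant r (∏ i ∈ t, a i ^ d i) ≤ s ^ ∑ i ∈ t, d i := by
    intro t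
    induction t using Finset.induction_on with
    | empty => simp [majorant_one]
    | insert i t hi ih =>
      rw [Finset.prod_insert hi, Finset.sum_insert hi, pow_add]
      exact (majorant_mul_le _ _ _).trans (mul_le_mul' (majorant_pow_le (h i) _) ih)
  exact key d.support

lemma tsum_majorant_finsuppProd_le {r s : ℝ≥0∞} {a : σ → MvPowerSeries τ ℂ}
    (h : ∀ i, majorant r (a i) ≤ s) (φ : MvPowerSeries σ ℂ) :
    ∑' d : σ →₀ ℕ, ∑' e : τ →₀ ℕ, ‖coeff d φ‖ₑ *
      (‖coeff e (d.prod fun i n => a i ^ n)‖ₑ * r ^ e.degree) ≤ majorant s φ := by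
  refine ENNReal.tsum_le_tsum fun d => ?_
  rw [ENNReal.tsum_mul_left]
  gcongr
  exact majorant_finsuppProd_le h d

/-- Triangle inequality and submultiplicativity, monomial by monomial. With values in `[0, ∞]` the
sums can be interchanged without any summability assumption. -/
lemma majorant_subst_le {r s : ℝ≥0∞} {a : σ → MvPowerSeries τ ℂ} (ha : HasSubst a)
    (h : ∀ i, majorant r (a i) ≤ s) (φ : MvPowerSeries σ ℂ) :
    majorant r (subst a φ) ≤ majorant s φ := by
  refine le_trans ?_ (tsum_majorant_finsuppProd_le h φ)
  rw [ENNReal.tsum_comm]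
  refine ENNReal.tsum_le_tsum fun e => ?_
  simp_rw [← mul_assoc]
  rw [ENNReal.tsum_mul_right]
  gcongr
  rw [coeff_subst ha, finsum_eq_sum _ (coeff_subst_finite ha φ e)]
  refine (enorm_sum_le _ _).trans ?_
  simp_rw [smul_eq_mul, enorm_mul]
  exact ENNReal.sum_le_tsum _

/-- Only monomials of degree at least `N` occur, and each gains `κ ^ N` when the radius shrinks.
This gain is what makes composition with a contraction small on series of high order. -/
lemma majorant_mul_radius_le {κ : ℝ≥0∞} (hκ : κ ≤ 1) (r : ℝ≥0∞) {N : ℕ} {φ : MvPowerSeries σ ℂ}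
    (hφ : N ≤ φ.order) : majorant (κ * r) φ ≤ κ ^ N * majorant r φ := by
  rw [majorant, majorant, ← ENNReal.tsum_mul_left]
  refine ENNReal.tsum_le_tsum fun e => ?_
  by_cases he : e.degree < N
  · rw [coeff_of_lt_order (lt_of_lt_of_le (by exact_mod_cast he) hφ)]
    simp
  · rw [mul_pow]
    have : κ ^ e.degree ≤ κ ^ N := pow_le_pow_right_of_le_one' hκ (not_lt.1 he)
    calc _ = κ ^ e.degree * (‖coeff e φ‖ₑ * r ^ e.degree) := by ring
      _ ≤ _ := by gcongr

/-- Multiplication by a variable only shifts exponents, so equality holds. It makes convergence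
survive division by an exceptional coordinate. -/
lemma majorant_X_mul (r : ℝ≥0∞) (i : σ) (φ : MvPowerSeries σ ℂ) :
    majorant r (X i * φ) = r * majorant r φ := by
  classical
  rw [majorant, majorant, ← ENNReal.tsum_mul_left]
  have hinj : Function.Injective fun e : σ →₀ ℕ => Finsupp.single i 1 + e :=
    add_right_injective _
  rw [← hinj.tsum_eq]
  · refine tsum_congr fun e => ?_
    have : coeff (Finsupp.single i 1 + e) (X i * φ) = coeff e φ := by
      rw [X, coeff_add_monomial_mul, one_mul]
    simp only [this, map_add, Finsupp.degree_single, pow_add, pow_one]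
    ring
  · intro e he
    by_contra hne
    apply he
    have : e i = 0 := by
      by_contra h0
      exact hne ⟨e - Finsupp.single i 1,
        add_tsub_cancel_of_le (Finsupp.single_le_iff.2 (Nat.one_le_iff_ne_zero.2 h0))⟩
    have h1 : X i ^ 1 ∣ X i * φ := by simp
    simp [X_pow_dvd_iff.1 h1 e (by omega)]

/-- Convergence of a power series on some polydisc. -/
def Convergent (φ : MvPowerSeries σ ℂ) : Prop :=
  ∃ r : ℝ≥0∞, 0 < r ∧ majorant r φ ≠ ⊤

lemma Convergent.exists_lt {φ : MvPowerSeries σ ℂ} (h : Convergent φ) {s : ℝ≥0∞} (hs : 0 < s) :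
    ∃ r : ℝ≥0∞, 0 < r ∧ r < s ∧ r ≠ ⊤ ∧ majorant r φ ≠ ⊤ := by
  obtain ⟨r, hr, hφ⟩ := h
  obtain ⟨t, ht, ht'⟩ := exists_between (lt_min hr hs)
  exact ⟨t, ht, ht'.trans_le (min_le_right _ _), ne_top_of_lt ht',
    ne_top_of_le_ne_top hφ (majorant_mono (ht'.le.trans (min_le_left _ _)) φ)⟩

lemma exists_majorant_le_of_order {φ : MvPowerSeries σ ℂ} (h : Convergent φ) {N : ℕ}
    (hN : N ≤ φ.order) : ∃ r₀ C : ℝ≥0∞, 0 < r₀ ∧ r₀ ≠ ⊤ ∧ C ≠ ⊤ ∧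
      ∀ r ≤ r₀, majorant r φ ≤ C * r ^ N := by
  obtain ⟨r, hr, -, hr', hφ⟩ := h.exists_lt one_pos
  refine ⟨r, majorant r φ * r⁻¹ ^ N, hr, hr', ?_, fun s hs => ?_⟩
  · exact ENNReal.mul_ne_top hφ (ENNReal.pow_ne_top (ENNReal.inv_ne_top.2 hr.ne'))
  · have h1 : s = s * r⁻¹ * r := by
      rw [mul_assoc, ENNReal.inv_mul_cancel hr.ne' hr', mul_one]
    have h2 : s * r⁻¹ ≤ 1 := by
      rw [← div_eq_mul_inv]
      exact ENNReal.div_le_of_le_mul (by simpa using hs)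
    calc majorant s φ = majorant (s * r⁻¹ * r) φ := by rw [← h1]
      _ ≤ (s * r⁻¹) ^ N * majorant r φ := majorant_mul_radius_le h2 r hN
      _ = _ := by rw [mul_pow]; ring

lemma exists_majorant_le {φ : MvPowerSeries σ ℂ} (h : Convergent φ)
    (h0 : constantCoeff φ = 0) {s : ℝ≥0∞} (hs : 0 < s) :
    ∃ r₀ : ℝ≥0∞, 0 < r₀ ∧ ∀ r ≤ r₀, majorant r φ ≤ s := by
  obtain ⟨r₀, C, hr₀, hr₀', hC, hle⟩ := exists_majorant_le_of_order (N := 1) h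
    (one_le_order_iff_constCoeff_eq_zero.2 h0)
  refine ⟨min r₀ (s / (C + 1)), lt_min hr₀ (ENNReal.div_pos hs.ne' (by finiteness)), fun r hr => ?_⟩
  refine (hle r (hr.trans (min_le_left _ _))).trans ?_
  rw [pow_one]
  calc C * r ≤ (C + 1) * (s / (C + 1)) := by
        gcongr
        · exact le_self_add
        · exact hr.trans (min_le_right _ _)
    _ ≤ s := ENNReal.mul_div_le

lemma Convergent.add {φ ψ : MvPowerSeries σ ℂ} (hφ : Convergent φ) (hψ : Convergent ψ) :
    Convergent (φ + ψ) := by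
  obtain ⟨r, hr, h1⟩ := hφ
  obtain ⟨s, hs, h3, -, h2⟩ := hψ.exists_lt hr
  exact ⟨s, hs, ne_top_of_le_ne_top (ENNReal.add_ne_top.2
    ⟨ne_top_of_le_ne_top h1 (majorant_mono h3.le _), h2⟩) (majorant_add_le _ _ _)⟩

lemma Convergent.mul {φ ψ : MvPowerSeries σ ℂ} (hφ : Convergent φ) (hψ : Convergent ψ) :
    Convergent (φ * ψ) := by
  obtain ⟨r, hr, h1⟩ := hφ
  obtain ⟨s, hs, h3, -, h2⟩ := hψ.exists_lt hr
  exact ⟨s, hs, ne_top_of_le_ne_top (ENNReal.mul_ne_top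
    (ne_top_of_le_ne_top h1 (majorant_mono h3.le _)) h2) (majorant_mul_le _ _ _)⟩

lemma Convergent.smul {φ : MvPowerSeries σ ℂ} (hφ : Convergent φ) (c : ℂ) :
    Convergent (c • φ) := by
  obtain ⟨r, hr, h1⟩ := hφ
  exact ⟨r, hr, by rw [majorant_smul]; exact ENNReal.mul_ne_top enorm_ne_top h1⟩

lemma Convergent.sub {φ ψ : MvPowerSeries σ ℂ} (hφ : Convergent φ) (hψ : Convergent ψ) :
    Convergent (φ - ψ) := by
  have := hφ.add (hψ.smul (-1))
  rwa [neg_one_smul, ← sub_eq_add_neg] at this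

lemma convergent_X (i : σ) : Convergent (X i : MvPowerSeries σ ℂ) :=
  ⟨1, one_pos, by simp [majorant_X]⟩

lemma convergent_C (c : ℂ) : Convergent (C c : MvPowerSeries σ ℂ) :=
  ⟨1, one_pos, by simp [majorant_C]⟩

lemma Convergent.of_X_mul {i : σ} {φ : MvPowerSeries σ ℂ} (h : Convergent (X i * φ)) :
    Convergent φ := by
  obtain ⟨r, hr, h1⟩ := h
  refine ⟨r, hr, fun h3 => h1 ?_⟩
  rw [majorant_X_mul, h3, ENNReal.mul_top hr.ne']

lemma exists_forall_majorant_le [Finite σ] {a : σ → MvPowerSeries τ ℂ} (ha : ∀ i, Convergent (a i))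
    (h0 : ∀ i, constantCoeff (a i) = 0) {s : ℝ≥0∞} (hs : 0 < s) :
    ∃ r₀ : ℝ≥0∞, 0 < r₀ ∧ ∀ r ≤ r₀, ∀ i, majorant r (a i) ≤ s := by
  classical
  choose f hf hf' using fun i => exists_majorant_le (ha i) (h0 i) hs
  cases nonempty_fintype σ
  refine ⟨Finset.univ.inf f, ?_, fun r hr i =>
    hf' i r (hr.trans (Finset.inf_le (Finset.mem_univ i)))⟩
  exact (Finset.lt_inf_iff (by simp)).2 fun i _ => hf i

lemma Convergent.subst [Finite σ] {a : σ → MvPowerSeries τ ℂ} (ha : ∀ i, Convergent (a i))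
    (h0 : ∀ i, constantCoeff (a i) = 0) {φ : MvPowerSeries σ ℂ} (hφ : Convergent φ) :
    Convergent (MvPowerSeries.subst a φ) := by
  obtain ⟨s, hs, h1⟩ := hφ
  obtain ⟨r, hr, h2⟩ := exists_forall_majorant_le ha h0 hs
  exact ⟨r, hr, ne_top_of_le_ne_top h1
    (majorant_subst_le (hasSubst_of_constantCoeff_zero h0) (h2 r le_rfl) φ)⟩

end Majorant

/-! ### Sums of convergent power series -/

section Evaluation

variable {σ τ : Type*} [Fintype σ] [Fintype τ]

/-- The sum of a power series at a point. -/
noncomputable def ev (φ : MvPowerSeries σ ℂ) (z : σ → ℂ) : ℂ :=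
  ∑' e : σ →₀ ℕ, coeff e φ * ∏ i, z i ^ e i

lemma enorm_prod_pow_le {r : ℝ≥0∞} {z : σ → ℂ} (hz : ∀ i, ‖z i‖ₑ ≤ r) (e : σ →₀ ℕ) :
    ‖∏ i, z i ^ e i‖ₑ ≤ r ^ e.degree := by
  classical
  rw [Finsupp.degree_eq_sum]
  have key : ∀ t : Finset σ, ‖∏ i ∈ t, z i ^ e i‖ₑ ≤ r ^ ∑ i ∈ t, e i := by
    intro t
    induction t using Finset.induction_on with
    | empty => simp
    | insert i t hi ih =>
      rw [Finset.prod_insert hi, Finset.sum_insert hi, pow_add, enorm_mul, enorm_pow]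
      gcongr
      exact hz i
  exact key _

lemma summable_norm_of_tsum_enorm_ne_top {ι : Type*} {f : ι → ℂ} (h : ∑' i, ‖f i‖ₑ ≠ ⊤) :
    Summable fun i => ‖f i‖ := by
  exact NNReal.summable_coe.2 (ENNReal.tsum_coe_ne_top_iff_summable.1 h)

lemma tsum_enorm_term_le {r : ℝ≥0∞} {z : σ → ℂ} (hz : ∀ i, ‖z i‖ₑ ≤ r) (φ : MvPowerSeries σ ℂ) :
    ∑' e : σ →₀ ℕ, ‖coeff e φ * ∏ i, z i ^ e i‖ₑ ≤ majorant r φ :=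
  ENNReal.tsum_le_tsum fun e => by
    rw [enorm_mul]
    gcongr
    exact enorm_prod_pow_le hz e

lemma summable_norm_ev {r : ℝ≥0∞} {z : σ → ℂ} (hz : ∀ i, ‖z i‖ₑ ≤ r) {φ : MvPowerSeries σ ℂ}
    (hφ : majorant r φ ≠ ⊤) : Summable fun e : σ →₀ ℕ => ‖coeff e φ * ∏ i, z i ^ e i‖ :=
  summable_norm_of_tsum_enorm_ne_top (ne_top_of_le_ne_top hφ (tsum_enorm_term_le hz φ))

lemma hasSum_ev {r : ℝ≥0∞} {z : σ → ℂ} (hz : ∀ i, ‖z i‖ₑ ≤ r) {φ : MvPowerSeries σ ℂ}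
    (hφ : majorant r φ ≠ ⊤) : HasSum (fun e : σ →₀ ℕ => coeff e φ * ∏ i, z i ^ e i) (ev φ z) :=
  (summable_norm_ev hz hφ).of_norm.hasSum

lemma enorm_tsum_le_tsum_enorm' {ι : Type*} (f : ι → ℂ) : ‖∑' i, f i‖ₑ ≤ ∑' i, ‖f i‖ₑ := by
  by_cases h : ∑' i, ‖f i‖ₑ = ⊤
  · simp [h]
  have hs := summable_norm_of_tsum_enorm_ne_top h
  have h1 := norm_tsum_le_tsum_norm hs
  have h2 : ∑' i, ‖f i‖ₑ = ENNReal.ofReal (∑' i, ‖f i‖) := by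
    rw [ENNReal.ofReal_tsum_of_nonneg (fun _ => norm_nonneg _) hs]
    simp only [ofReal_norm]
  rw [h2, ← ofReal_norm]
  exact ENNReal.ofReal_le_ofReal h1

lemma enorm_ev_le {r : ℝ≥0∞} {z : σ → ℂ} (hz : ∀ i, ‖z i‖ₑ ≤ r) (φ : MvPowerSeries σ ℂ) :
    ‖ev φ z‖ₑ ≤ majorant r φ :=
  (enorm_tsum_le_tsum_enorm' _).trans (tsum_enorm_term_le hz φ)

lemma ev_add {r : ℝ≥0∞} {z : σ → ℂ} (hz : ∀ i, ‖z i‖ₑ ≤ r) {φ ψ : MvPowerSeries σ ℂ}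
    (hφ : majorant r φ ≠ ⊤) (hψ : majorant r ψ ≠ ⊤) : ev (φ + ψ) z = ev φ z + ev ψ z := by
  have := (hasSum_ev hz hφ).add (hasSum_ev hz hψ)
  rw [← this.tsum_eq, ev]
  simp only [map_add, add_mul]

lemma ev_smul (c : ℂ) (φ : MvPowerSeries σ ℂ) (z : σ → ℂ) : ev (c • φ) z = c * ev φ z := by
  rw [ev, ev, ← tsum_mul_left]
  simp only [map_smul, smul_eq_mul, mul_assoc]

lemma ev_mul {r : ℝ≥0∞} {z : σ → ℂ} (hz : ∀ i, ‖z i‖ₑ ≤ r) {φ ψ : MvPowerSeries σ ℂ}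
    (hφ : majorant r φ ≠ ⊤) (hψ : majorant r ψ ≠ ⊤) : ev (φ * ψ) z = ev φ z * ev ψ z := by
  classical
  have h := tsum_mul_tsum_eq_tsum_antidiagonal (summable_norm_ev hz hφ) (summable_norm_ev hz hψ)
  unfold ev
  rw [h]
  refine tsum_congr fun e => ?_
  rw [coeff_mul, Finset.sum_mul]
  refine Finset.sum_congr rfl fun p hp => ?_
  have hp' : p.1 + p.2 = e := Finset.HasAntidiagonal.mem_antidiagonal.1 hp
  have h1 : ∏ i, z i ^ e i = (∏ i, z i ^ p.1 i) * ∏ i, z i ^ p.2 i := by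
    rw [← Finset.prod_mul_distrib]
    refine Finset.prod_congr rfl fun i _ => ?_
    rw [← hp', Finsupp.add_apply, pow_add]
  rw [h1]
  ring

lemma ev_monomial (e : σ →₀ ℕ) (c : ℂ) (z : σ → ℂ) :
    ev (monomial e c) z = c * ∏ i, z i ^ e i := by
  classical
  rw [ev, tsum_eq_single e]
  · simp
  · intro d hd
    simp [coeff_monomial, hd]

lemma ev_C (c : ℂ) (z : σ → ℂ) : ev (C c : MvPowerSeries σ ℂ) z = c := by
  simpa [monomial_zero_eq_C_apply] using ev_monomial (0 : σ →₀ ℕ) c z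

lemma ev_X (i : σ) (z : σ → ℂ) : ev (X i : MvPowerSeries σ ℂ) z = z i := by
  classical
  rw [X, ev_monomial, one_mul, Finset.prod_eq_single i]
  · simp
  · intro j _ hj
    simp [hj.symm]
  · simp

lemma ev_pow {r : ℝ≥0∞} {z : σ → ℂ} (hz : ∀ i, ‖z i‖ₑ ≤ r) {φ : MvPowerSeries σ ℂ}
    (hφ : majorant r φ ≠ ⊤) (n : ℕ) : ev (φ ^ n) z = ev φ z ^ n := by
  induction n with
  | zero => simpa using ev_C 1 z
  | succ n ih =>
    rw [pow_succ, ev_mul hz (ne_top_of_le_ne_top (ENNReal.pow_ne_top hφ)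
      (majorant_pow_le le_rfl n)) hφ, ih, pow_succ]

lemma ev_finsuppProd {r s : ℝ≥0∞} {z : τ → ℂ} (hz : ∀ i, ‖z i‖ₑ ≤ r)
    {a : σ → MvPowerSeries τ ℂ} (h : ∀ i, majorant r (a i) ≤ s) (hs : s ≠ ⊤) (d : σ →₀ ℕ) :
    ev (d.prod fun i n => a i ^ n) z = ∏ i, ev (a i) z ^ d i := by
  classical
  have ha : ∀ i, majorant r (a i) ≠ ⊤ := fun i => ne_top_of_le_ne_top hs (h i)
  have key : ∀ t : Finset σ, majorant r (∏ i ∈ t, a i ^ d i) ≠ ⊤ ∧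
      ev (∏ i ∈ t, a i ^ d i) z = ∏ i ∈ t, ev (a i) z ^ d i := by
    intro t
    induction t using Finset.induction_on with
    | empty => simpa [majorant_one] using ev_C 1 z
    | insert i t hi ih =>
      have hp : majorant r (a i ^ d i) ≠ ⊤ :=
        ne_top_of_le_ne_top (ENNReal.pow_ne_top (ha i)) (majorant_pow_le le_rfl _)
      rw [Finset.prod_insert hi, Finset.prod_insert hi, ev_mul hz hp ih.1, ev_pow hz (ha i), ih.2]
      exact ⟨ne_top_of_le_ne_top (ENNReal.mul_ne_top hp ih.1) (majorant_mul_le _ _ _), rfl⟩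
  rw [Finsupp.prod_fintype _ _ (fun i => pow_zero _)]
  exact (key _).2

/-- The double series over the monomials of `φ` and over those of their images converges absolutely
by the majorant estimate, so the order of summation can be exchanged. -/
lemma ev_subst {r s : ℝ≥0∞} {z : τ → ℂ} (hz : ∀ i, ‖z i‖ₑ ≤ r)
    {a : σ → MvPowerSeries τ ℂ} (ha : HasSubst a) (h : ∀ i, majorant r (a i) ≤ s) (hs : s ≠ ⊤)
    {φ : MvPowerSeries σ ℂ} (hφ : majorant s φ ≠ ⊤) :
    ev (subst a φ) z = ev φ fun i => ev (a i) z := by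
  have hsum : Summable (Function.uncurry fun (d : σ →₀ ℕ) (e : τ →₀ ℕ) => coeff d φ *
      (coeff e (d.prod fun i n => a i ^ n) * ∏ i, z i ^ e i)) := by
    refine Summable.of_norm (summable_norm_of_tsum_enorm_ne_top
      (ne_top_of_le_ne_top hφ (le_trans ?_ (tsum_majorant_finsuppProd_le h φ))))
    rw [ENNReal.tsum_prod']
    refine ENNReal.tsum_le_tsum fun d => ENNReal.tsum_le_tsum fun e => ?_
    simp only [Function.uncurry, enorm_mul]
    gcongr
    exact enorm_prod_pow_le hz e
  have h1 : ev (subst a φ) z = ∑' (e : τ →₀ ℕ) (d : σ →₀ ℕ), coeff d φ *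
      (coeff e (d.prod fun i n => a i ^ n) * ∏ i, z i ^ e i) := by
    refine tsum_congr fun e => ?_
    rw [coeff_subst ha, ← tsum_eq_finsum (L := .unconditional _) (coeff_subst_finite ha φ e), ← tsum_mul_right]
    simp only [smul_eq_mul, mul_assoc]
  rw [h1, hsum.tsum_comm, ev]
  refine tsum_congr fun d => ?_
  rw [tsum_mul_left, ← ev_finsuppProd hz h hs]
  rfl

lemma eventually_enorm_le {r : ℝ≥0∞} (hr : 0 < r) : ∀ᶠ z : σ → ℂ in 𝓝 0, ∀ i, ‖z i‖ₑ ≤ r := by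
  refine eventually_all.2 fun i => ?_
  have : Tendsto (fun z : σ → ℂ => ‖z i‖ₑ) (𝓝 0) (𝓝 0) := by
    have : Continuous fun z : σ → ℂ => ‖z i‖ₑ := by fun_prop
    simpa using this.tendsto 0
  exact this.eventually_le_const hr

lemma Convergent.eventually_ev_add {φ ψ : MvPowerSeries σ ℂ} (hφ : Convergent φ)
    (hψ : Convergent ψ) : ∀ᶠ z in 𝓝 (0 : σ → ℂ), ev (φ + ψ) z = ev φ z + ev ψ z := by
  obtain ⟨r, hr, h1⟩ := hφ
  obtain ⟨s, hs, h3, -, h2⟩ := hψ.exists_lt hr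
  filter_upwards [eventually_enorm_le hs] with z hz
  exact ev_add hz (ne_top_of_le_ne_top h1 (majorant_mono h3.le _)) h2

lemma Convergent.eventually_ev_mul {φ ψ : MvPowerSeries σ ℂ} (hφ : Convergent φ)
    (hψ : Convergent ψ) : ∀ᶠ z in 𝓝 (0 : σ → ℂ), ev (φ * ψ) z = ev φ z * ev ψ z := by
  obtain ⟨r, hr, h1⟩ := hφ
  obtain ⟨s, hs, h3, -, h2⟩ := hψ.exists_lt hr
  filter_upwards [eventually_enorm_le hs] with z hz
  exact ev_mul hz (ne_top_of_le_ne_top h1 (majorant_mono h3.le _)) h2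

lemma Convergent.eventually_ev_subst {a : σ → MvPowerSeries τ ℂ} (ha : ∀ i, Convergent (a i))
    (h0 : ∀ i, constantCoeff (a i) = 0) {φ : MvPowerSeries σ ℂ} (hφ : Convergent φ) :
    ∀ᶠ z in 𝓝 (0 : τ → ℂ), ev (MvPowerSeries.subst a φ) z = ev φ fun i => ev (a i) z := by
  obtain ⟨s, hs, -, hs', h1⟩ := hφ.exists_lt one_pos
  obtain ⟨r, hr, h2⟩ := exists_forall_majorant_le ha h0 hs
  filter_upwards [eventually_enorm_le hr] with z hz
  exact ev_subst hz (hasSubst_of_constantCoeff_zero h0) (h2 r le_rfl) hs' h1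

lemma Convergent.exists_norm_ev_le {φ : MvPowerSeries σ ℂ} (hφ : Convergent φ) {N : ℕ}
    (hN : N ≤ φ.order) : ∃ C : ℝ, 0 < C ∧ ∀ᶠ z in 𝓝 (0 : σ → ℂ), ‖ev φ z‖ ≤ C * ‖z‖ ^ N := by
  obtain ⟨r, C, hr, -, hC, hle⟩ := exists_majorant_le_of_order hφ hN
  refine ⟨C.toReal + 1, by positivity, ?_⟩
  have : Tendsto (fun z : σ → ℂ => ‖z‖ₑ) (𝓝 0) (𝓝 0) := by
    simpa using (continuous_enorm (E := σ → ℂ)).tendsto 0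
  filter_upwards [this.eventually_le_const hr] with z hz
  have h1 : ‖ev φ z‖ₑ ≤ C * ‖z‖ₑ ^ N :=
    (enorm_ev_le (fun i => by
      rw [← ofReal_norm, ← ofReal_norm]
      exact ENNReal.ofReal_le_ofReal (norm_le_pi_norm z i)) φ).trans (hle _ hz)
  have h2 := ENNReal.toReal_mono (ENNReal.mul_ne_top hC (ENNReal.pow_ne_top enorm_ne_top)) h1
  rw [ENNReal.toReal_mul, ENNReal.toReal_pow, toReal_enorm, toReal_enorm] at h2
  refine h2.trans ?_
  gcongr
  linarith

end Evaluation

/-! ### Convergent series and Taylor expansions of holomorphic functions -/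

section Expansion

/-- Exponents of monomials in two variables as pairs of natural numbers. -/
noncomputable def exponentEquiv : ℕ × ℕ ≃ (Fin 2 →₀ ℕ) where
  toFun q := Finsupp.single 0 q.1 + Finsupp.single 1 q.2
  invFun e := (e 0, e 1)
  left_inv q := by simp
  right_inv e := by
    ext i
    fin_cases i <;> simp

lemma exponentEquiv_apply (q : ℕ × ℕ) :
    exponentEquiv q = Finsupp.single 0 q.1 + Finsupp.single 1 q.2 := rfl

lemma prod_pow_exponentEquiv (q : ℕ × ℕ) (z : Plane) :
    ∏ i, z i ^ exponentEquiv q i = z 0 ^ q.1 * z 1 ^ q.2 := by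
  simp [exponentEquiv_apply, Fin.prod_univ_two]

lemma degree_exponentEquiv (q : ℕ × ℕ) : (exponentEquiv q).degree = q.1 + q.2 := by
  simp [exponentEquiv_apply]

/-- The monomial `z₀ ^ k z₁ ^ (n - k)` as a multilinear map. -/
noncomputable def monomialMap (n k : ℕ) : ContinuousMultilinearMap ℂ (fun _ : Fin n => Plane) ℂ :=
  (ContinuousMultilinearMap.mkPiAlgebra ℂ (Fin n) ℂ).compContinuousLinearMap
    fun j => ContinuousLinearMap.proj (if (j : ℕ) < k then 0 else 1)

lemma monomialMap_apply (q : ℕ × ℕ) (z : Plane) :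
    monomialMap (q.1 + q.2) q.1 (fun _ => z) = z 0 ^ q.1 * z 1 ^ q.2 := by
  simp [monomialMap, Fin.prod_univ_add]

lemma norm_monomialMap_le (n k : ℕ) : ‖monomialMap n k‖ ≤ 1 := by
  refine ContinuousMultilinearMap.opNorm_le_bound zero_le_one fun m => ?_
  simp only [monomialMap, ContinuousMultilinearMap.compContinuousLinearMap_apply,
    ContinuousMultilinearMap.mkPiAlgebra_apply, ContinuousLinearMap.proj_apply, one_mul, norm_prod]
  exact Finset.prod_le_prod (fun _ _ => norm_nonneg _) fun i _ => norm_le_pi_norm _ _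

/-- A power series in two variables as a formal multilinear series. -/
noncomputable def toMultilinear (φ : Series) : FormalMultilinearSeries ℂ Plane ℂ := fun n =>
  ∑ q ∈ Finset.HasAntidiagonal.antidiagonal n, coeff (exponentEquiv q) φ • monomialMap n q.1

/-- Grouping the monomials by degree gives a formal multilinear series. Every `monomialMap` has norm
at most one, so the finite majorant bounds the radius of convergence from below. -/
lemma Convergent.analyticAt {φ : Series} (hφ : Convergent φ) : AnalyticAt ℂ (ev φ) 0 := by
  obtain ⟨r, hr, -, hr', h⟩ := hφ.exists_lt one_pos
  lift r to NNReal using hr'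
  refine ⟨toMultilinear φ, r, ?_, hr, fun {y} hy => ?_⟩
  · refine FormalMultilinearSeries.le_radius_of_bound _ (majorant r φ).toReal fun n => ?_
    have h1 : ‖toMultilinear φ n‖ₑ * (r : ℝ≥0∞) ^ n ≤ majorant r φ := by
      have h2 : ‖toMultilinear φ n‖ₑ ≤
          ∑ q ∈ Finset.HasAntidiagonal.antidiagonal n, ‖coeff (exponentEquiv q) φ‖ₑ := by
        rw [toMultilinear]
        refine (enorm_sum_le (Finset.HasAntidiagonal.antidiagonal n) fun q : ℕ × ℕ =>
          coeff (exponentEquiv q) φ • monomialMap n q.1).trans (Finset.sum_le_sum fun q _ => ?_)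
        rw [enorm_smul]
        refine mul_le_of_le_one_right' ?_
        rw [← ofReal_norm]
        exact ENNReal.ofReal_le_one.2 (norm_monomialMap_le _ _)
      refine (mul_le_mul_left h2 _).trans ?_
      rw [majorant, ← exponentEquiv.tsum_eq, Finset.sum_mul]
      refine le_trans (le_of_eq ?_) (ENNReal.sum_le_tsum (Finset.HasAntidiagonal.antidiagonal n))
      refine Finset.sum_congr rfl fun q hq => ?_
      rw [degree_exponentEquiv, Finset.HasAntidiagonal.mem_antidiagonal.1 hq]
    have h3 := ENNReal.toReal_mono h h1
    simpa [ENNReal.toReal_mul] using h3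
  · have hz : ∀ i, ‖y i‖ₑ ≤ r := fun i => by
      have : ‖y‖ₑ < r := by
        rwa [Metric.mem_eball, edist_zero_right] at hy
      refine le_trans ?_ this.le
      rw [← ofReal_norm, ← ofReal_norm]
      exact ENNReal.ofReal_le_ofReal (norm_le_pi_norm y i)
    have h1 := hasSum_ev hz h
    rw [← exponentEquiv.hasSum_iff, ← Finset.HasAntidiagonal.sigmaAntidiagonalEquivProd.hasSum_iff] at h1
    have h2 := h1.sigma (fun n => hasSum_fintype _)
    rw [zero_add]
    refine (congrArg (fun f => HasSum f (ev φ y)) (funext fun n => ?_)).mpr h2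
    have h0 : toMultilinear φ n = ∑ q ∈ Finset.HasAntidiagonal.antidiagonal n,
      coeff (exponentEquiv q) φ • monomialMap n q.1 := rfl
    rw [h0, ContinuousMultilinearMap.sum_apply, ← Finset.sum_coe_sort]
    refine Finset.sum_congr rfl fun q _ => ?_
    have hq := Finset.HasAntidiagonal.mem_antidiagonal.1 q.2
    have h3 := monomialMap_apply q.1 y
    rw [hq] at h3
    simp only [ContinuousMultilinearMap.smul_apply, h3, smul_eq_mul, Function.comp_apply,
      prod_pow_exponentEquiv]
    rfl

lemma Convergent.hasExpansion {φ : Series} (hφ : Convergent φ) : HasExpansion (ev φ) φ := by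
  obtain ⟨r, hr, h⟩ := hφ
  filter_upwards [eventually_enorm_le hr] with z hz
  exact hasSum_ev hz h

lemma HasExpansion.eventually_eq {g : Plane → ℂ} {φ : Series} (h : HasExpansion g φ) :
    g =ᶠ[𝓝 0] ev φ := by
  filter_upwards [h] with z hz
  exact hz.tsum_eq.symm

/-- Summability in `ℂ` is absolute, so the sum at the single point with both coordinates `ε / 2`
already bounds the majorant of radius `ε / 2`. -/
lemma HasExpansion.convergent {g : Plane → ℂ} {φ : Series} (h : HasExpansion g φ) :
    Convergent φ := by
  obtain ⟨ε, hε, hball⟩ := Metric.eventually_nhds_iff_ball.1 h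
  have h1 : (fun _ => ((ε / 2 : ℝ) : ℂ)) ∈ Metric.ball (0 : Plane) ε := by
    rw [mem_ball_zero_iff, pi_norm_lt_iff hε]
    intro i
    rw [Complex.norm_of_nonneg (by positivity)]
    linarith
  have h2 := (hball _ h1).summable.norm
  refine ⟨ENNReal.ofReal (ε / 2), by simpa using hε, ?_⟩
  have h3 : majorant (ENNReal.ofReal (ε / 2)) φ = ∑' e : Fin 2 →₀ ℕ,
      ENNReal.ofReal ‖coeff e φ * ∏ i, ((ε / 2 : ℝ) : ℂ) ^ e i‖ := by
    refine tsum_congr fun e => ?_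
    rw [Finset.prod_pow_eq_pow_sum, ← Finsupp.degree_eq_sum, norm_mul, norm_pow,
      Complex.norm_of_nonneg (by positivity), ENNReal.ofReal_mul (norm_nonneg _),
      ENNReal.ofReal_pow (by positivity), ofReal_norm]
  rw [h3, ← ENNReal.ofReal_tsum_of_nonneg (fun _ => norm_nonneg _) h2]
  exact ENNReal.ofReal_ne_top

end Expansion

/-! ### Orders, homogeneous parts and their behaviour under substitution -/

section Forms

variable {σ τ : Type*}

lemma constantCoeff_subst_of_zero [Finite σ] {a : σ → MvPowerSeries τ ℂ}
    (h0 : ∀ i, constantCoeff (a i) = 0) (f : MvPowerSeries σ ℂ) :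
    constantCoeff (subst a f) = constantCoeff f := by
  have ha := hasSubst_of_constantCoeff_zero h0
  have h1 := constantCoeff_subst_eq_zero ha h0 (f := f - C (constantCoeff f)) (by simp)
  rw [subst_sub ha] at h1
  have h2 : subst a (C (constantCoeff f)) = (C (constantCoeff f) : MvPowerSeries τ ℂ) := by
    have := subst_C (a := a) (S := ℂ) (constantCoeff f)
    exact this
  rw [h2] at h1
  simpa [sub_eq_zero] using h1

lemma le_order_sub {n : ℕ∞} {f g : MvPowerSeries σ ℂ} (hf : n ≤ f.order) (hg : n ≤ g.order) :
    n ≤ (f - g).order := by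
  rw [sub_eq_add_neg]
  exact (le_min hf (by rwa [order_neg])).trans min_order_le_add

lemma le_order_add {n : ℕ∞} {f g : MvPowerSeries σ ℂ} (hf : n ≤ f.order) (hg : n ≤ g.order) :
    n ≤ (f + g).order := (le_min hf hg).trans min_order_le_add

lemma le_order_mul_left {n : ℕ∞} (f : MvPowerSeries σ ℂ) {g : MvPowerSeries σ ℂ}
    (hg : n ≤ g.order) : n ≤ (f * g).order := by
  rw [order_mul]
  exact hg.trans le_add_self

lemma order_X (i : σ) : (X i : MvPowerSeries σ ℂ).order = 1 := by
  rw [X, order_monomial_of_ne_zero one_ne_zero]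
  simp

/-- The part of a series in two variables that is free of `X 0`. -/
noncomputable def dropX0 (f : Series) : Series := fun m => if m 0 = 0 then coeff m f else 0

lemma coeff_dropX0 (f : Series) (m : Fin 2 →₀ ℕ) :
    coeff m (dropX0 f) = if m 0 = 0 then coeff m f else 0 := rfl

lemma degree_fin_two (m : Fin 2 →₀ ℕ) : m.degree = m 0 + m 1 := by
  rw [Finsupp.degree_eq_sum, Fin.sum_univ_two]

lemma X0_dvd_sub_dropX0 (f : Series) : X 0 ∣ f - dropX0 f := by
  rw [← pow_one (X (0 : Fin 2)), X_pow_dvd_iff]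
  intro m hm
  rw [map_sub, coeff_dropX0, if_pos (by omega), sub_self]

lemma X1_pow_dvd_dropX0 {f : Series} {N : ℕ} (h : N ≤ f.order) : X 1 ^ N ∣ dropX0 f := by
  rw [X_pow_dvd_iff]
  intro m hm
  rw [coeff_dropX0]
  split_ifs with h0
  · refine coeff_of_lt_order (lt_of_lt_of_le ?_ h)
    rw [degree_fin_two]
    exact_mod_cast (by omega)
  · rfl

lemma le_order_dropX0 {f : Series} {N : ℕ} (h : N ≤ f.order) : N ≤ (dropX0 f).order := by
  refine le_order fun m hm => ?_
  rw [coeff_dropX0]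
  split_ifs with h0
  · exact coeff_of_lt_order (hm.trans_le h)
  · rfl

/-- The terms free of `X 0` are divisible by `X 1 ^ N`, and the rest is `X 0` times a series of
order at least `N - 1`. In terms of ideals, the order condition can be transported by the
substitution homomorphism. -/
lemma mem_span_pow_of_le_order {f : Series} {N : ℕ} (h : N ≤ f.order) :
    f ∈ (Ideal.span {X 0, X 1} : Ideal Series) ^ N := by
  induction N generalizing f with
  | zero => simp
  | succ N ih =>
    obtain ⟨g, hg⟩ := X0_dvd_sub_dropX0 f
    have h1 : N ≤ g.order := by
      have h2 : ((N + 1 : ℕ) : ℕ∞) ≤ (X 0 * g).order := by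
        rw [← hg]
        exact le_order_sub h (le_order_dropX0 h)
      rw [order_mul, order_X, Nat.cast_add, Nat.cast_one, add_comm] at h2
      exact (ENat.add_le_add_iff_left (by simp)).1 h2
    have h3 : f = X 0 * g + dropX0 f := by rw [← hg]; ring
    rw [h3]
    refine Ideal.add_mem _ ?_ ?_
    · rw [pow_succ']
      exact Ideal.mul_mem_mul (Ideal.subset_span (by simp)) (ih h1)
    · exact Ideal.mem_of_dvd _ (X1_pow_dvd_dropX0 h)
        (Ideal.pow_mem_pow (Ideal.subset_span (by simp)) _)

lemma pow_dvd_subst {a : Fin 2 → MvPowerSeries τ ℂ} (ha : HasSubst a) {t : MvPowerSeries τ ℂ}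
    (ht : ∀ i, t ∣ a i) {f : Series} {N : ℕ} (h : N ≤ f.order) : t ^ N ∣ subst a f := by
  have h1 := Ideal.mem_map_of_mem (substAlgHom ha).toRingHom (mem_span_pow_of_le_order h)
  rw [Ideal.map_pow, Ideal.map_span] at h1
  have h2 : (Ideal.span ((substAlgHom (R := ℂ) ha).toRingHom '' {X 0, X 1})) ≤ Ideal.span {t} := by
    rw [Ideal.span_le]
    rintro _ ⟨x, hx, rfl⟩
    rw [SetLike.mem_coe, Ideal.mem_span_singleton]
    rcases hx with rfl | rfl
    · simpa [subst_X ha] using ht 0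
    · simpa [subst_X ha] using ht 1
  have h3 := Ideal.pow_right_mono h2 N h1
  rw [Ideal.span_singleton_pow, Ideal.mem_span_singleton] at h3
  rw [← coe_substAlgHom ha]
  exact h3

/-- The value at `v` of the homogeneous part of degree `k` of `f`. -/
noncomputable def form (k : ℕ) (f : Series) (v : Plane) : ℂ :=
  ∑ i ∈ Finset.range (k + 1),
    coeff (Finsupp.single 0 i + Finsupp.single 1 (k - i)) f * v 0 ^ i * v 1 ^ (k - i)

lemma initialForm_eq (f : Series) (v : Plane) : initialForm f v = form f.order.toNat f v := rfl

lemma eq_single_add_single (m : Fin 2 →₀ ℕ) :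
    m = Finsupp.single 0 (m 0) + Finsupp.single 1 (m 1) := by
  ext i
  fin_cases i <;> simp

lemma le_order_succ_of_coeff {f : Series} {k : ℕ} (h : k ≤ f.order)
    (h' : ∀ i ≤ k, coeff (Finsupp.single 0 i + Finsupp.single 1 (k - i)) f = 0) :
    ((k + 1 : ℕ) : ℕ∞) ≤ f.order := by
  refine le_order fun m hm => ?_
  have hm' : m.degree < k + 1 := by exact_mod_cast hm
  rcases Nat.lt_succ_iff_lt_or_eq.1 hm' with h1 | h1
  · exact coeff_of_lt_order (lt_of_lt_of_le (by exact_mod_cast h1) h)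
  · rw [degree_fin_two] at h1
    have := h' (m 0) (by omega)
    rwa [show k - m 0 = m 1 by omega, ← eq_single_add_single] at this

/-- The homogeneous part `P` of degree `k` contributes exactly `t ^ k P(b)`; the remainder `f - P`
has order at least `k + 1` and contributes a multiple of `t ^ (k + 1)`. This serves both for arcs
and for blow-ups. -/
lemma exists_subst_mul_eq {t : MvPowerSeries τ ℂ} {b : Fin 2 → MvPowerSeries τ ℂ}
    (hs : HasSubst fun i => t * b i) {f : Series} {k : ℕ} (h : k ≤ f.order) :
    ∃ g, subst (fun i => t * b i) f = t ^ k * ((∑ i ∈ Finset.range (k + 1),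
      C (coeff (Finsupp.single 0 i + Finsupp.single 1 (k - i)) f) * b 0 ^ i * b 1 ^ (k - i)) +
        t * g) := by
  classical
  set P : Series := ∑ i ∈ Finset.range (k + 1),
    monomial (Finsupp.single 0 i + Finsupp.single 1 (k - i))
      (coeff (Finsupp.single 0 i + Finsupp.single 1 (k - i)) f) with hP
  have hcoeff : ∀ m : Fin 2 →₀ ℕ, coeff m P = if m.degree = k then coeff m f else 0 := by
    intro m
    rw [hP, map_sum]
    split_ifs with hm
    · rw [degree_fin_two] at hm
      rw [Finset.sum_eq_single (m 0)]
      · rw [show k - m 0 = m 1 by omega, ← eq_single_add_single, coeff_monomial_same]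
      · intro i _ hi
        rw [coeff_monomial, if_neg]
        rintro rfl
        simp at hi
      · intro hm'
        simp at hm'
        omega
    · refine Finset.sum_eq_zero fun i hi => ?_
      rw [coeff_monomial, if_neg]
      rintro rfl
      rw [Finset.mem_range] at hi
      rw [map_add, Finsupp.degree_single, Finsupp.degree_single] at hm
      omega
  have h1 : ((k + 1 : ℕ) : ℕ∞) ≤ (f - P).order := by
    refine le_order fun m hm => ?_
    have hm' : m.degree < k + 1 := by exact_mod_cast hm
    rw [map_sub, hcoeff]
    split_ifs with hk
    · simp
    · rw [coeff_of_lt_order (lt_of_lt_of_le _ h), sub_zero]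
      exact_mod_cast (by omega)
  obtain ⟨g, hg⟩ := pow_dvd_subst hs (fun i => Dvd.intro _ rfl) h1
  refine ⟨g, ?_⟩
  have h2 : subst (fun i => t * b i) P = t ^ k * ∑ i ∈ Finset.range (k + 1),
      C (coeff (Finsupp.single 0 i + Finsupp.single 1 (k - i)) f) * b 0 ^ i * b 1 ^ (k - i) := by
    rw [hP, ← coe_substAlgHom hs, map_sum, Finset.mul_sum]
    refine Finset.sum_congr rfl fun i hi => ?_
    have hi' : i ≤ k := by simpa [Nat.lt_succ_iff] using hi
    rw [substAlgHom_monomial, Finsupp.prod_fintype _ _ (fun i => pow_zero _), Fin.prod_univ_two]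
    simp only [Finsupp.add_apply, Finsupp.single_eq_same, mul_pow, MvPowerSeries.algebraMap_apply,
      Algebra.algebraMap_self, RingHom.id_apply]
    rw [Finsupp.single_eq_of_ne (by simp), Finsupp.single_eq_of_ne (by simp)]
    rw [add_zero, zero_add]
    conv_rhs => rw [show t ^ k = t ^ i * t ^ (k - i) by rw [← pow_add]; congr 1; omega]
    ring
  have h3 : subst (fun i => t * b i) f =
      subst (fun i => t * b i) P + subst (fun i => t * b i) (f - P) := by
    rw [← subst_add hs]
    congr 1
    ring
  rw [h3, h2, hg]
  ring

lemma form_one (f : Series) (v : Plane) : form 1 f v =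
    coeff (Finsupp.single 0 1) f * v 0 + coeff (Finsupp.single 1 1) f * v 1 := by
  simp [form, Finset.sum_range_succ]
  ring

lemma hasSubst_mul {t : MvPowerSeries τ ℂ} (ht : constantCoeff t = 0)
    (b : Fin 2 → MvPowerSeries τ ℂ) : HasSubst fun i => t * b i :=
  hasSubst_of_constantCoeff_zero fun i => by simp [ht]

/-- Restriction of a series to a formal arc `t ↦ t b(t)`. -/
lemma exists_subst_arc {b : Fin 2 → MvPowerSeries Unit ℂ} {f : Series} {k : ℕ} (h : k ≤ f.order) :
    ∃ g, subst (fun i => X () * b i) f = X () ^ k * g ∧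
      constantCoeff g = form k f fun i => constantCoeff (b i) := by
  obtain ⟨g, hg⟩ := exists_subst_mul_eq (hasSubst_mul (t := X ()) (by simp) b) h
  refine ⟨_, hg, ?_⟩
  simp [form]

/-- The linear part of a tuple of power series, as a map. -/
noncomputable def linearPart (Φ : Fin 2 → Series) (v : Plane) : Plane := fun i => form 1 (Φ i) v

lemma X_ne_zero' (i : σ) : (X i : MvPowerSeries σ ℂ) ≠ 0 := by
  intro h
  have := order_X i
  simp [h] at this

lemma order_le_order_subst [Finite σ] {a : σ → MvPowerSeries τ ℂ}
    (h0 : ∀ i, constantCoeff (a i) = 0) (f : MvPowerSeries σ ℂ) :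
    f.order ≤ (subst a f).order := by
  refine le_trans ?_ (le_order_subst (hasSubst_of_constantCoeff_zero h0) f)
  calc f.order = 1 * f.order := (one_mul _).symm
    _ ≤ _ := by
      gcongr
      exact le_iInf fun i => one_le_order_iff_constCoeff_eq_zero.2 (h0 i)

/-- The form is the leading coefficient along the line `t ↦ t v`, so identities between forms reduce
to cancellation in one variable. -/
lemma form_eq_of_subst_eq {f : Series} {k : ℕ} (h : k ≤ f.order) {v : Plane}
    {g : MvPowerSeries Unit ℂ} (hg : subst (fun i => X () * C (v i)) f = X () ^ k * g) :
    form k f v = constantCoeff g := by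
  obtain ⟨g', hg', h'⟩ := exists_subst_arc (b := fun j => C (v j)) h
  rw [hg'] at hg
  rw [← mul_left_cancel₀ (pow_ne_zero k (X_ne_zero' ())) hg, h']
  simp

lemma form_mul {f : Series} {k : ℕ} (h : k ≤ f.order) (u : Series) (v : Plane) :
    form k (u * f) v = constantCoeff u * form k f v := by
  obtain ⟨g, hg, hg'⟩ := exists_subst_arc (b := fun j => C (v j)) h
  have h0 : ∀ i, constantCoeff (X () * C (v i) : MvPowerSeries Unit ℂ) = 0 := fun i => by simp
  rw [form_eq_of_subst_eq (g := subst (fun i => X () * C (v i)) u * g) (le_order_mul_left u h),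
    map_mul, hg', constantCoeff_subst_of_zero h0]
  · simp
  · rw [subst_mul (hasSubst_of_constantCoeff_zero h0), hg]
    ring

lemma form_subst {Φ : Fin 2 → Series} (hΦ : ∀ i, constantCoeff (Φ i) = 0) {f : Series} {k : ℕ}
    (h : k ≤ f.order) (v : Plane) : form k (subst Φ f) v = form k f (linearPart Φ v) := by
  have h0 : ∀ i, constantCoeff (X () * C (v i) : MvPowerSeries Unit ℂ) = 0 := fun i => by simp
  choose b hb hb' using fun i => exists_subst_arc (b := fun j => C (v j)) (f := Φ i) (k := 1)
    (one_le_order_iff_constCoeff_eq_zero.2 (hΦ i))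
  obtain ⟨g, hg, hg'⟩ := exists_subst_arc (b := b) h
  rw [form_eq_of_subst_eq (g := g) (h.trans (order_le_order_subst hΦ f)), hg']
  · simp only [hb', constantCoeff_C]
    rfl
  · rw [subst_comp_subst_apply (hasSubst_of_constantCoeff_zero hΦ)
      (hasSubst_of_constantCoeff_zero h0), ← hg]
    simp only [hb, pow_one]

/-- Leading terms of `f ∘ Φ = u f`. This ties the constant term of the cofactor to the eigenvalues
of the linear part. -/
lemma form_linearPart {Φ : Fin 2 → Series} (hΦ : ∀ i, constantCoeff (Φ i) = 0) {f u : Series}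
    (huf : subst Φ f = u * f) {k : ℕ} (h : k ≤ f.order) (v : Plane) :
    form k f (linearPart Φ v) = constantCoeff u * form k f v := by
  rw [← form_subst hΦ h, huf, form_mul h]

lemma coeff_eq_zero_of_forall_sum_pow {k : ℕ} {c : ℕ → ℂ}
    (h : ∀ x : ℂ, ∑ i ∈ Finset.range (k + 1), c i * x ^ i = 0) : ∀ i ≤ k, c i = 0 := by
  have h1 : (∑ i ∈ Finset.range (k + 1), Polynomial.C (c i) * Polynomial.X ^ i) = 0 := by
    refine Polynomial.funext fun x => ?_
    simpa [Polynomial.eval_finsetSum] using h x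
  intro i hi
  have h2 := congrArg (fun p => Polynomial.coeff p i) h1
  simpa [Polynomial.finsetSum_coeff, Polynomial.coeff_C_mul, Polynomial.coeff_X_pow,
    Nat.lt_succ_iff, hi] using h2

lemma le_order_succ_of_form {f : Series} {k : ℕ} (h : k ≤ f.order)
    (h' : ∀ v, form k f v = 0) : ((k + 1 : ℕ) : ℕ∞) ≤ f.order := by
  refine le_order_succ_of_coeff h (coeff_eq_zero_of_forall_sum_pow fun x => ?_)
  simpa [form] using h' ![x, 1]

lemma order_eq_toNat {f : Series} (h : f ≠ 0) : ((f.order.toNat : ℕ) : ℕ∞) = f.order :=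
  ne_zero_iff_order_finite.1 h

lemma exists_form_ne_zero {f : Series} (h : f ≠ 0) : ∃ v, form f.order.toNat f v ≠ 0 := by
  by_contra! hv
  have := le_order_succ_of_form (order_eq_toNat h).le hv
  rw [← order_eq_toNat h] at this
  have h2 : f.order.toNat + 1 ≤ f.order.toNat := by exact_mod_cast this
  omega

end Forms

/-! ### Lifting a sequence through successive blow-ups -/

section Lifts

/-- The coordinate that vanishes on the exceptional divisor, in the coordinates of `blowUp ℓ`. -/
def excIndex : OnePoint ℂ → Fin 2
  | .some _ => 0
  | .infty => 1

/-- The line where the `j`-th coordinate vanishes. -/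
def axisLine (j : Fin 2) : OnePoint ℂ := if j = 0 then .infty else .some 0

/-- The Riemann sphere is compact, and every cluster point of the directions belongs to the tangent
set; a unique cluster point is a limit. -/
lemma tendsto_lineThrough {S : Set Plane} {ℓ : OnePoint ℂ} (hS : tangentSet S ⊆ {ℓ})
    {p : ℕ → Plane} (hp : Tendsto p atTop (𝓝 0)) (hpS : ∀ᶠ m in atTop, p m ∈ S) :
    Tendsto (fun m => lineThrough (p m)) atTop (𝓝 ℓ) := by
  refine le_nhds_of_unique_clusterPt fun x hx => ?_
  refine hS ?_
  rw [tangentSet, Set.mem_ofPred_eq, mem_closure_iff_nhds]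
  intro t ht
  obtain ⟨u, hu, v, hv, huv⟩ := mem_nhds_prod_iff.1 ht
  have h1 : ∃ᶠ m in atTop, lineThrough (p m) ∈ v := by
    have hx' : MapClusterPt x atTop fun m => lineThrough (p m) := hx
    exact hx'.frequently hv
  obtain ⟨m, hm, hm', hm''⟩ := (h1.and_eventually ((hp.eventually_mem hu).and hpS)).exists
  exact ⟨_, huv ⟨hm', hm⟩, p m, hm'', rfl⟩

lemma tendsto_plane {q : ℕ → Plane} (h0 : Tendsto (fun m => q m 0) atTop (𝓝 0))
    (h1 : Tendsto (fun m => q m 1) atTop (𝓝 0)) : Tendsto q atTop (𝓝 0) := by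
  refine tendsto_pi_nhds.2 fun i => ?_
  fin_cases i
  · exact h0
  · exact h1

lemma plane_ne_zero {z : Plane} (h : z ≠ 0) (h0 : z 0 = 0) : z 1 ≠ 0 := by
  intro h1
  apply h
  ext i
  fin_cases i
  · exact h0
  · exact h1

lemma exists_lift {ℓ : OnePoint ℂ} {p : ℕ → Plane}
    (hp : Tendsto p atTop (𝓝 0)) (hp0 : ∀ᶠ m in atTop, p m ≠ 0)
    (hℓ : Tendsto (fun m => lineThrough (p m)) atTop (𝓝 ℓ)) :
    ∃ q : ℕ → Plane, Tendsto q atTop (𝓝 0) ∧ (∀ᶠ m in atTop, q m ≠ 0) ∧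
      ∀ᶠ m in atTop, blowUp ℓ (q m) = p m := by
  have hp0' : Tendsto (fun m => p m 0) atTop (𝓝 0) := tendsto_pi_nhds.1 hp 0
  have hp1' : Tendsto (fun m => p m 1) atTop (𝓝 0) := tendsto_pi_nhds.1 hp 1
  induction ℓ using OnePoint.rec with
  | infty =>
    have key : ∀ ε > 0, ∀ᶠ m in atTop, p m 1 ≠ 0 ∧ ‖p m 0 / p m 1‖ < ε := by
      intro ε hε
      -- Complements of compact sets are neighbourhoods of `∞`; outside the closed disc of radius
      -- `ε⁻¹` the reciprocal slope is smaller than `ε`.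
      have h1 : ((↑) '' (Metric.closedBall (0 : ℂ) ε⁻¹) : Set (OnePoint ℂ))ᶜ ∈ 𝓝 OnePoint.infty := by
        refine IsOpen.mem_nhds ?_ (by simp)
        rw [OnePoint.isOpen_compl_image_coe]
        exact ⟨Metric.isClosed_closedBall, isCompact_closedBall _ _⟩
      filter_upwards [hℓ.eventually_mem h1, hp0] with m hm hm0
      by_cases h0 : p m 0 = 0
      · exact ⟨plane_ne_zero hm0 h0, by simpa [h0] using hε⟩
      · rw [lineThrough, if_neg h0] at hm
        have h2 : ε⁻¹ < ‖p m 1 / p m 0‖ := by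
          by_contra! h3
          exact hm ⟨_, by simpa using h3, rfl⟩
        have h4 : p m 1 ≠ 0 := by
          intro h5
          rw [h5] at h2
          simp at h2
          exact absurd h2 (not_lt.2 hε.le)
        refine ⟨h4, ?_⟩
        rw [← inv_div, norm_inv]
        exact inv_lt_of_inv_lt₀ hε h2
    refine ⟨fun m => ![p m 0 / p m 1, p m 1], tendsto_plane ?_ hp1', ?_, ?_⟩
    · rw [NormedAddGroup.tendsto_nhds_zero]
      exact fun ε hε => (key ε hε).mono fun m hm => hm.2
    · filter_upwards [key 1 one_pos] with m hm h
      exact hm.1 (by simpa using congrFun h 1)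
    · filter_upwards [key 1 one_pos] with m hm
      ext i
      fin_cases i
      · simp [blowUp, hm.1]
      · simp [blowUp]
  | coe c =>
    have h0 : ∀ᶠ m in atTop, p m 0 ≠ 0 := by
      filter_upwards [hℓ.eventually_ne (OnePoint.coe_ne_infty c)] with m hm h
      rw [lineThrough, if_pos h] at hm
      exact hm rfl
    have h1 : Tendsto (fun m => p m 1 / p m 0) atTop (𝓝 c) := by
      rw [OnePoint.isOpenEmbedding_coe.isInducing.tendsto_nhds_iff]
      refine hℓ.congr' ?_
      filter_upwards [h0] with m hm
      rw [lineThrough, if_neg hm]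
      rfl
    refine ⟨fun m => ![p m 0, p m 1 / p m 0 - c], tendsto_plane hp0' ?_, ?_, ?_⟩
    · simpa using h1.sub_const c
    · filter_upwards [h0] with m hm h
      exact hm (by simpa using congrFun h 0)
    · filter_upwards [h0] with m hm
      ext i
      fin_cases i
      · simp [blowUp]
      · simp [blowUp]
        field_simp

/-- A sequence of points together with its lifts by the blow-ups at `ℓ 0, ℓ 1, …`. -/
structure IsLiftSeq (ℓ : ℕ → OnePoint ℂ) (p : ℕ → ℕ → Plane) : Prop where
  tendsto : ∀ n, Tendsto (p n) atTop (𝓝 0)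
  blowUp_eq : ∀ n, ∀ᶠ m in atTop, blowUp (ℓ n) (p (n + 1) m) = p n m

/-- Dependent choice. The invariant carried along includes that the lift eventually lies in the
`n`-th transform, since this is what lets the next iterated tangent determine the limit direction.
-/
lemma exists_isLiftSeq {ℓ : ℕ → OnePoint ℂ} {a : ℕ → Plane} (ha : Tendsto a atTop (𝓝 0))
    (h : HasIteratedTangents (Set.range a) ℓ) : ∃ p, p 0 = a ∧ IsLiftSeq ℓ p := by
  let P : ℕ → (ℕ → Plane) → Prop := fun n q => Tendsto q atTop (𝓝 0) ∧
    (∀ᶠ m in atTop, q m ≠ 0) ∧ ∀ᶠ m in atTop, q m ∈ transform ℓ (Set.range a) n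
  have step : ∀ n (q : {q // P n q}), ∃ q' : {q // P (n + 1) q},
      ∀ᶠ m in atTop, blowUp (ℓ n) (q'.1 m) = q.1 m := by
    rintro n ⟨q, h1, h2, h3⟩
    obtain ⟨q', h4, h5, h6⟩ := exists_lift h1 h2 (tendsto_lineThrough (h.2 n).le h1 h3)
    refine ⟨⟨q', h4, h5, ?_⟩, h6⟩
    filter_upwards [h6, h3] with m hm hm'
    change blowUp (ℓ n) (q' m) ∈ transform ℓ (Set.range a) n
    rwa [hm]
  choose f hf using step
  let s : ∀ n, {q // P n q} := fun n => Nat.rec ⟨a, ha, Eventually.of_forall fun m hm =>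
    h.1 ⟨m, hm⟩, Eventually.of_forall fun m => ⟨m, rfl⟩⟩ f n
  exact ⟨fun n => (s n).1, rfl, fun n => (s n).2.1, fun n => hf n (s n)⟩

lemma blowUp_excIndex (ℓ : OnePoint ℂ) (z : Plane) : blowUp ℓ z (excIndex ℓ) = z (excIndex ℓ) := by
  induction ℓ using OnePoint.rec <;> rfl

lemma axisLine_excIndex_ne (ℓ : OnePoint ℂ) : ℓ ≠ axisLine (excIndex ℓ) := by
  induction ℓ using OnePoint.rec with
  | infty => exact fun h => OnePoint.infty_ne_coe (0 : ℂ) h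
  | coe c => exact OnePoint.coe_ne_infty c

lemma excIndex_axisLine (j : Fin 2) : excIndex (axisLine j) = j.rev := by
  fin_cases j <;> rfl

lemma axisLine_ne_rev (j : Fin 2) : axisLine j ≠ axisLine j.rev := by
  have := axisLine_excIndex_ne (axisLine j)
  rwa [excIndex_axisLine] at this

lemma blowUp_axisLine (j : Fin 2) (z : Plane) : blowUp (axisLine j) z j = z j * z j.rev := by
  fin_cases j
  · rfl
  · change z 0 * (0 + z 1) = z 1 * z 0
    ring

lemma norm_plane_le {z : Plane} {C : ℝ} (h0 : ‖z 0‖ ≤ C) (h1 : ‖z 1‖ ≤ C) : ‖z‖ ≤ C := by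
  refine (pi_norm_le_iff_of_nonneg ((norm_nonneg _).trans h0)).2 fun i => ?_
  fin_cases i
  · exact h0
  · exact h1

variable {ℓ : ℕ → OnePoint ℂ} {p : ℕ → ℕ → Plane}

lemma IsLiftSeq.apply_excIndex (h : IsLiftSeq ℓ p) (n : ℕ) :
    ∀ᶠ m in atTop, p n m (excIndex (ℓ n)) = p (n + 1) m (excIndex (ℓ n)) := by
  filter_upwards [h.blowUp_eq n] with m hm
  rw [← hm, blowUp_excIndex]

/-- The direction of `p n m` tends to `ℓ n`, because the next lift tends to the centre of its chart.
If `ℓ n` is not the line where the `j`-th coordinate vanishes, that coordinate controls the other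
one. -/
lemma IsLiftSeq.norm_le (h : IsLiftSeq ℓ p) {n : ℕ} {j : Fin 2} (hj : ℓ n ≠ axisLine j) :
    ∃ C > 0, ∀ᶠ m in atTop, ‖p n m‖ ≤ C * ‖p n m j‖ := by
  have ht := h.tendsto (n + 1)
  have h0 := (tendsto_pi_nhds.1 ht 0).norm.eventually_le_const (u := 1) (by simp)
  have h1 := tendsto_pi_nhds.1 ht 1
  have hb := h.blowUp_eq n
  generalize ℓ n = l at hj hb
  induction l using OnePoint.rec with
  | infty =>
    have hj : j = 1 := by
      fin_cases j
      · exact absurd rfl hj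
      · rfl
    subst hj
    refine ⟨1, one_pos, ?_⟩
    filter_upwards [hb, h0] with m hm hm0
    rw [one_mul, ← hm]
    refine norm_plane_le ?_ le_rfl
    change ‖p (n + 1) m 0 * p (n + 1) m 1‖ ≤ ‖p (n + 1) m 1‖
    rw [norm_mul]
    exact mul_le_of_le_one_left (norm_nonneg _) hm0
  | coe c =>
    have h2 : ∀ᶠ m in atTop, ‖c + p (n + 1) m 1‖ ≤ ‖c‖ + 1 :=
      (h1.const_add c).norm.eventually_le_const (by simp)
    fin_cases j
    · refine ⟨‖c‖ + 1, by positivity, ?_⟩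
      filter_upwards [hb, h2] with m hm hm2
      rw [← hm]
      refine norm_plane_le ?_ ?_
      · change ‖p (n + 1) m 0‖ ≤ (‖c‖ + 1) * ‖p (n + 1) m 0‖
        nlinarith [norm_nonneg (p (n + 1) m 0), norm_nonneg c]
      · change ‖p (n + 1) m 0 * (c + p (n + 1) m 1)‖ ≤ (‖c‖ + 1) * ‖p (n + 1) m 0‖
        rw [norm_mul, mul_comm]
        gcongr
    · have hc : c ≠ 0 := by
        rintro rfl
        exact hj rfl
      have hc' : 0 < ‖c‖ := norm_pos_iff.2 hc
      have h3 : ∀ᶠ m in atTop, ‖c‖ / 2 ≤ ‖c + p (n + 1) m 1‖ :=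
        (h1.const_add c).norm.eventually_const_le (by simpa using hc)
      refine ⟨1 + 2 / ‖c‖, by positivity, ?_⟩
      filter_upwards [hb, h3] with m hm hm3
      rw [← hm]
      refine norm_plane_le ?_ ?_
      · change ‖p (n + 1) m 0‖ ≤ (1 + 2 / ‖c‖) * ‖p (n + 1) m 0 * (c + p (n + 1) m 1)‖
        rw [norm_mul]
        have h4 : 1 ≤ (1 + 2 / ‖c‖) * ‖c + p (n + 1) m 1‖ := by
          calc (1 : ℝ) = 2 / ‖c‖ * (‖c‖ / 2) := by field_simp
            _ ≤ (1 + 2 / ‖c‖) * ‖c + p (n + 1) m 1‖ := by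
              gcongr
              linarith
        nlinarith [norm_nonneg (p (n + 1) m 0)]
      · refine le_mul_of_one_le_left (norm_nonneg _) ?_
        have : 0 < 2 / ‖c‖ := by positivity
        linarith

end Lifts

/-! ### Strict transforms and their contact with the coordinate axes -/

section StrictTransforms

/-- Divisibility by `X i` means positive order for the weight that counts only `X i`, and weighted
orders are additive on products. -/
lemma X_dvd_or_dvd_of_mul {σ : Type*} {i : σ} {f g : MvPowerSeries σ ℂ} (h : X i ∣ f * g) :
    X i ∣ f ∨ X i ∣ g := by
  classical
  have key : ∀ f : MvPowerSeries σ ℂ, X i ∣ f ↔ 1 ≤ f.weightedOrder (Pi.single i 1) := by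
    intro f
    have hw : ∀ d : σ →₀ ℕ, Finsupp.weight (Pi.single i 1 : σ → ℕ) d = d i := by
      intro d
      rw [Finsupp.weight_apply, Finsupp.sum]
      simp only [Pi.single_apply, smul_eq_mul, mul_ite, mul_one, mul_zero,
        Finset.sum_ite_eq', Finsupp.mem_support_iff, ite_not, ite_eq_right_iff]
      exact Eq.symm
    rw [← pow_one (X i), X_pow_dvd_iff]
    constructor
    · intro h
      refine nat_le_weightedOrder _ fun d hd => h d ?_
      rwa [hw] at hd
    · intro h d hd
      refine coeff_eq_zero_of_lt_weightedOrder (Pi.single i 1) (lt_of_lt_of_le ?_ h)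
      rw [hw]
      exact_mod_cast hd
  simp only [key, weightedOrder_mul] at h ⊢
  by_contra! hc
  rw [Order.lt_one_iff, Order.lt_one_iff] at hc
  rw [hc.1, hc.2] at h
  simp at h

lemma dvd_of_dvd_X_mul {σ : Type*} {i : σ} {f g : MvPowerSeries σ ℂ}
    (hgX : ¬ X i ∣ g) (h : g ∣ X i * f) : g ∣ f := by
  obtain ⟨k, hk⟩ := h
  rcases X_dvd_or_dvd_of_mul (Dvd.intro f hk : X i ∣ g * k) with h1 | ⟨k', rfl⟩
  · exact absurd h1 hgX
  · refine ⟨k', mul_left_cancel₀ (X_ne_zero' i) ?_⟩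
    rw [hk]
    ring

lemma dvd_of_dvd_X_pow_mul {σ : Type*} {i : σ} {f g : MvPowerSeries σ ℂ}
    (hgX : ¬ X i ∣ g) {n : ℕ} (h : g ∣ X i ^ n * f) : g ∣ f := by
  induction n with
  | zero => simpa using h
  | succ n ih =>
    rw [pow_succ', mul_assoc] at h
    exact ih (dvd_of_dvd_X_mul hgX h)

lemma exists_coeff_axis_ne_zero {j : Fin 2} {g : Series} (h : ¬ X j ∣ g) :
    ∃ n, coeff (Finsupp.single j.rev n) g ≠ 0 := by
  by_contra! hc
  apply h
  rw [← pow_one (X j), X_pow_dvd_iff]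
  intro m hm
  rw [← hc (m j.rev)]
  congr 1
  congr 1
  ext i
  fin_cases j <;> fin_cases i <;> simp at hm ⊢ <;> omega

lemma coeff_axis_mul_eq_zero {j : Fin 2} {N : ℕ} {g : Series}
    (h : ∀ i < N, coeff (Finsupp.single j i) g = 0) (k : Series) :
    ∀ i < N, coeff (Finsupp.single j i) (k * g) = 0 := by
  classical
  intro i hi
  rw [coeff_mul]
  refine Finset.sum_eq_zero fun q hq => ?_
  have hq : q.1 + q.2 = Finsupp.single j i := Finset.HasAntidiagonal.mem_antidiagonal.1 hq
  have h1 : q.2 = Finsupp.single j (q.2 j) := by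
    ext l
    by_cases hl : l = j
    · simp [hl]
    · have := DFunLike.congr_fun hq l
      rw [Finsupp.add_apply, Finsupp.single_eq_of_ne hl] at this
      rw [Finsupp.single_eq_of_ne hl]
      omega
  have h2 : q.2 j ≤ i := by
    have := DFunLike.congr_fun hq j
    rw [Finsupp.add_apply, Finsupp.single_eq_same] at this
    omega
  rw [h1, h _ (by omega), mul_zero]

lemma coeff_axis_X_mul {j : Fin 2} (g : Series) (i : ℕ) :
    coeff (Finsupp.single j.rev i) (X j * g) = 0 := by
  have : X j ^ 1 ∣ X j * g := by simp
  refine X_pow_dvd_iff.1 this _ ?_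
  fin_cases j <;> simp

lemma coeff_axis_aeval (j : Fin 2) (q : Polynomial ℂ) (i : ℕ) :
    coeff (Finsupp.single j i) (Polynomial.aeval (X j : Series) q) = q.coeff i := by
  classical
  induction q using Polynomial.induction_on' with
  | add p q hp hq => simp [hp, hq]
  | monomial n c =>
    rw [Polynomial.aeval_monomial, MvPowerSeries.algebraMap_apply, coeff_C_mul, coeff_X_pow,
      Polynomial.coeff_monomial]
    by_cases h : i = n
    · simp [h]
    · rw [if_neg (Ne.symm h), if_neg (fun h' => h (by simpa using DFunLike.congr_fun h' j)), mul_zero]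

/-- The cofactors of the exceptional coordinate in `blowUpSeries ℓ`. -/
noncomputable def blowUpCofactor : OnePoint ℂ → Fin 2 → Series
  | .some c => ![1, C c + X 1]
  | .infty => ![X 0, 1]

lemma blowUpSeries_eq (ℓ : OnePoint ℂ) (i : Fin 2) :
    blowUpSeries ℓ i = X (excIndex ℓ) * blowUpCofactor ℓ i := by
  induction ℓ using OnePoint.rec with
  | infty =>
    change (![X 0 * X 1, X 1] : Fin 2 → Series) i = X 1 * (![X 0, 1] : Fin 2 → Series) i
    fin_cases i <;> simp [mul_comm]
  | coe c =>
    change (![X 0, X 0 * (C c + X 1)] : Fin 2 → Series) i =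
      X 0 * (![1, C c + X 1] : Fin 2 → Series) i
    fin_cases i <;> simp

lemma constantCoeff_blowUpSeries (ℓ : OnePoint ℂ) (i : Fin 2) :
    constantCoeff (blowUpSeries ℓ i) = 0 := by
  rw [blowUpSeries_eq, map_mul, constantCoeff_X, zero_mul]

lemma hasSubst_blowUpSeries (ℓ : OnePoint ℂ) : HasSubst (blowUpSeries ℓ) :=
  hasSubst_of_constantCoeff_zero (constantCoeff_blowUpSeries ℓ)

lemma convergent_blowUpSeries (ℓ : OnePoint ℂ) (i : Fin 2) : Convergent (blowUpSeries ℓ i) := by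
  induction ℓ using OnePoint.rec with
  | infty =>
    change Convergent ((![X 0 * X 1, X 1] : Fin 2 → Series) i)
    fin_cases i
    · exact (convergent_X 0).mul (convergent_X 1)
    · exact convergent_X 1
  | coe c =>
    change Convergent ((![X 0, X 0 * (C c + X 1)] : Fin 2 → Series) i)
    fin_cases i
    · exact convergent_X 0
    · exact (convergent_X 0).mul ((convergent_C c).add (convergent_X 1))

lemma ev_blowUpSeries (ℓ : OnePoint ℂ) (z : Plane) :
    (fun i => ev (blowUpSeries ℓ i) z) = blowUp ℓ z := by
  have hz : ∀ i, ‖z i‖ₑ ≤ ‖z 0‖ₑ + ‖z 1‖ₑ := fun i => by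
    fin_cases i
    · exact le_self_add
    · exact le_add_self
  have hX : ∀ i : Fin 2, majorant (‖z 0‖ₑ + ‖z 1‖ₑ) (X i : Series) ≠ ⊤ := fun i => by
    rw [majorant_X]
    finiteness
  funext i
  induction ℓ using OnePoint.rec with
  | infty =>
    change ev ((![X 0 * X 1, X 1] : Fin 2 → Series) i) z = (![z 0 * z 1, z 1] : Plane) i
    fin_cases i
    · simp [ev_mul hz (hX 0) (hX 1), ev_X]
    · simp [ev_X]
  | coe c =>
    change ev ((![X 0, X 0 * (C c + X 1)] : Fin 2 → Series) i) z =
      (![z 0, z 0 * (c + z 1)] : Plane) i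
    have hC : majorant (‖z 0‖ₑ + ‖z 1‖ₑ) (C c : Series) ≠ ⊤ := by
      rw [majorant_C]
      finiteness
    fin_cases i
    · simp [ev_X]
    · have h1 := ne_top_of_le_ne_top (ENNReal.add_ne_top.2 ⟨hC, hX 1⟩)
        (majorant_add_le (‖z 0‖ₑ + ‖z 1‖ₑ) (C c) (X 1))
      simp [ev_mul hz (hX 0) h1, ev_add hz hC (hX 1), ev_X, ev_C]

/-- On the exceptional divisor the sum is a binary form written in the affine coordinate centred at
`ℓ`. It is a polynomial of degree at most `k`, and it is non-zero because dehomogenization and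
translation are injective. -/
lemma exists_coeff_axis_cofactor_ne_zero (ℓ : OnePoint ℂ) {k : ℕ} {a : ℕ → ℂ}
    (ha : ∃ i ≤ k, a i ≠ 0) : ∃ i ≤ k, coeff (Finsupp.single (excIndex ℓ).rev i)
      (∑ i ∈ Finset.range (k + 1), C (a i) * blowUpCofactor ℓ 0 ^ i *
        blowUpCofactor ℓ 1 ^ (k - i)) ≠ 0 := by
  obtain ⟨i₀, hi₀, ha₀⟩ := ha
  induction ℓ using OnePoint.rec with
  | infty =>
    refine ⟨i₀, hi₀, ?_⟩
    change coeff (Finsupp.single 0 i₀)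
      (∑ i ∈ Finset.range (k + 1), C (a i) * X 0 ^ i * 1 ^ (k - i)) ≠ 0
    have h1 := coeff_axis_aeval 0
      (∑ i ∈ Finset.range (k + 1), Polynomial.C (a i) * Polynomial.X ^ i) i₀
    simp only [map_sum, map_mul, map_pow, Polynomial.aeval_C, Polynomial.aeval_X] at h1
    simp only [one_pow, mul_one, map_sum]
    erw [h1]
    simp only [Polynomial.finsetSum_coeff, Polynomial.coeff_C_mul, Polynomial.coeff_X_pow]
    simpa [Nat.lt_succ_iff, hi₀] using ha₀
  | coe c =>
    by_contra! hc
    set q : Polynomial ℂ := ∑ i ∈ Finset.range (k + 1),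
      Polynomial.C (a i) * (Polynomial.C c + Polynomial.X) ^ (k - i) with hq
    have h1 : ∀ i ≤ k, q.coeff i = 0 := by
      intro i hi
      rw [← hc i hi, ← coeff_axis_aeval 1 q i, hq]
      change _ = coeff (Finsupp.single 1 i)
        (∑ i ∈ Finset.range (k + 1), C (a i) * 1 ^ i * (C c + X 1) ^ (k - i))
      simp only [map_sum, map_mul, map_pow, map_add, Polynomial.aeval_C, Polynomial.aeval_X,
        one_pow, mul_one]
      rfl
    have h2 : q = 0 := by
      ext i
      by_cases hi : i ≤ k
      · simpa using h1 i hi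
      · rw [Polynomial.coeff_zero]
        refine Polynomial.coeff_eq_zero_of_natDegree_lt (lt_of_le_of_lt ?_ (not_le.1 hi))
        refine Polynomial.natDegree_sum_le_of_forall_le _ _ fun j _ => ?_
        compute_degree
        omega
    have h3 : ∀ x : ℂ, ∑ i ∈ Finset.range (k + 1), a (k - i) * x ^ i = 0 := by
      intro x
      -- Evaluation at `x - c` undoes the translation to the point of slope `c`; the exponents then
      -- run backwards, hence the reflected sum below.
      have h4 := congrArg (Polynomial.eval (x - c)) h2
      rw [hq, Polynomial.eval_finsetSum] at h4
      simp only [Polynomial.eval_mul, Polynomial.eval_C, Polynomial.eval_pow, Polynomial.eval_add,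
        Polynomial.eval_X, add_sub_cancel, Polynomial.eval_zero] at h4
      rw [← h4, ← Finset.sum_range_reflect]
      refine Finset.sum_congr rfl fun i hi => ?_
      have : i < k + 1 := Finset.mem_range.1 hi
      rw [show k + 1 - 1 - i = k - i by omega, show k - (k - i) = i by omega]
    have h5 := coeff_eq_zero_of_forall_sum_pow h3 (k - i₀) (by omega)
    rw [show k - (k - i₀) = i₀ by omega] at h5
    exact ha₀ h5

lemma exists_coeff_form_ne_zero {f : Series} (h : f ≠ 0) : ∃ i ≤ f.order.toNat,
    coeff (Finsupp.single 0 i + Finsupp.single 1 (f.order.toNat - i)) f ≠ 0 := by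
  by_contra! hc
  obtain ⟨v, hv⟩ := exists_form_ne_zero h
  apply hv
  refine Finset.sum_eq_zero fun i hi => ?_
  rw [hc i (by simpa [Nat.lt_succ_iff] using hi)]
  ring

/-- The strict transform meets the exceptional divisor with multiplicity at most the order. -/
lemma exists_coeff_axis_strictTransform {ℓ : OnePoint ℂ} {g g' : Series} (hg : g ≠ 0)
    (hX : ¬ X (excIndex ℓ) ∣ g') (h : g' ∣ subst (blowUpSeries ℓ) g) :
    ∃ i ≤ g.order.toNat, coeff (Finsupp.single (excIndex ℓ).rev i) g' ≠ 0 := by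
  have hb : blowUpSeries ℓ = fun i => X (excIndex ℓ) * blowUpCofactor ℓ i :=
    funext (blowUpSeries_eq ℓ)
  obtain ⟨r, hr⟩ := exists_subst_mul_eq (hb ▸ hasSubst_blowUpSeries ℓ) (order_eq_toNat hg).le
  rw [hb, hr] at h
  -- `g'` is prime to the exceptional coordinate, so it divides what remains of the total transform
  -- after removal of the full power `ν` of that coordinate, where `ν` is the order of `g`. On the
  -- divisor this quotient is the dehomogenized initial form, of degree at most `ν`.
  obtain ⟨s, hs⟩ := dvd_of_dvd_X_pow_mul hX h
  obtain ⟨i, hi, hne⟩ := exists_coeff_axis_cofactor_ne_zero ℓ (exists_coeff_form_ne_zero hg)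
  by_contra! hc
  apply hne
  have h1 := coeff_axis_mul_eq_zero (j := (excIndex ℓ).rev) (N := g.order.toNat + 1) (g := g')
    (fun i hi => hc i (by omega)) s i (by omega)
  rw [mul_comm, ← hs, map_add, coeff_axis_X_mul, add_zero] at h1
  exact h1

lemma blowUpSeries_axisLine_rev (j : Fin 2) : blowUpSeries (axisLine j) j.rev = X j.rev := by
  fin_cases j <;> rfl

lemma blowUpSeries_axisLine (j : Fin 2) : blowUpSeries (axisLine j) j = X j * X j.rev := by
  fin_cases j
  · rfl
  · change X 0 * (C 0 + X 1) = X 1 * X 0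
    rw [map_zero]
    ring

/-- The strict transform of the axis `X j = 0` is again `X j = 0` in this chart, and the blow-up
restricts to the identity on it. So restriction to the axis commutes with the blow-up. -/
lemma coeff_axis_subst_blowUp (j : Fin 2) (g : Series) (N : ℕ) :
    coeff (Finsupp.single j.rev N) (subst (blowUpSeries (axisLine j)) g) =
      coeff (Finsupp.single j.rev N) g := by
  classical
  rw [coeff_subst (hasSubst_blowUpSeries _)]
  have hprod : ∀ d : Fin 2 →₀ ℕ, (d.prod fun s e => blowUpSeries (axisLine j) s ^ e) =
      (X j * X j.rev) ^ d j * X j.rev ^ d j.rev := by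
    intro d
    rw [Finsupp.prod_fintype _ _ (fun i => pow_zero _), ← blowUpSeries_axisLine,
      ← blowUpSeries_axisLine_rev, Fin.prod_univ_two]
    fin_cases j
    · rfl
    · exact mul_comm _ _
  have hrev : j.rev ≠ j := by fin_cases j <;> simp
  rw [finsum_eq_single _ (Finsupp.single j.rev N)]
  · rw [hprod]
    simp [hrev.symm, coeff_X_pow]
  · intro d hd
    rw [hprod, smul_eq_mul]
    by_cases h0 : d j = 0
    · rw [h0, pow_zero, one_mul, coeff_X_pow, if_neg, mul_zero]
      intro h1
      apply hd
      ext i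
      have h2 : N = d j.rev := by simpa using DFunLike.congr_fun h1 j.rev
      by_cases hi : i = j.rev
      · rw [hi, Finsupp.single_eq_same, h2]
      · have : i = j := by
          fin_cases i <;> fin_cases j <;> simp_all
        rw [this, h0, Finsupp.single_eq_of_ne hrev.symm]
    · obtain ⟨k, hk⟩ := Nat.exists_eq_succ_of_ne_zero h0
      rw [hk, pow_succ', mul_assoc, mul_assoc, coeff_axis_X_mul, mul_zero]

/-- Blowing up lowers the contact with a line to which the curve is tangent. -/
lemma exists_coeff_axis_lt {j : Fin 2} {g g' : Series} (hg : constantCoeff g = 0)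
    (hX : ¬ X j.rev ∣ g')
    (h : g' ∣ subst (blowUpSeries (axisLine j)) g) {N : ℕ}
    (hN : coeff (Finsupp.single j.rev N) g ≠ 0) :
    ∃ N' < N, coeff (Finsupp.single j.rev N') g' ≠ 0 := by
  have h1 : X j.rev ^ 1 ∣ subst (blowUpSeries (axisLine j)) g := by
    refine pow_dvd_subst (hasSubst_blowUpSeries _) (fun i => ?_)
      (one_le_order_iff_constCoeff_eq_zero.2 hg)
    rw [blowUpSeries_eq, excIndex_axisLine]
    exact dvd_mul_right _ _
  rw [pow_one] at h1
  obtain ⟨k, hk⟩ := h1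
  rw [hk] at h
  -- The exceptional coordinate is here `X j.rev`, the parameter of the axis, so dividing by it
  -- lowers the order along the axis by one.
  obtain ⟨s, hs⟩ := dvd_of_dvd_X_mul hX h
  by_contra! hc
  apply hN
  rw [← coeff_axis_subst_blowUp, hk, hs]
  cases N with
  | zero => simp
  | succ N =>
    have h2 := coeff_axis_mul_eq_zero (j := j.rev) hc s N (by omega)
    rw [show Finsupp.single j.rev (N + 1) = Finsupp.single j.rev 1 + Finsupp.single j.rev N by
      rw [← Finsupp.single_add, add_comm]]
    rw [X, coeff_add_monomial_mul, one_mul, mul_comm g' s]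
    exact h2

end StrictTransforms

/-! ### Infinite contact of asymptotic sequences -/

section Contact

instance : IsDomain Series := NoZeroDivisors.to_isDomain _

/-- Generators of a sequence of successive strict transforms. -/
structure IsCurveChain (ℓ : ℕ → OnePoint ℂ) (g : ℕ → Series) : Prop where
  irreducible : ∀ n, Irreducible (g n)
  tangent : ∀ n, initialForm (g n) (lineVector (ℓ n)) = 0
  not_dvd : ∀ n, ¬ X (excIndex (ℓ n)) ∣ g (n + 1)
  dvd_subst : ∀ n, g (n + 1) ∣ subst (blowUpSeries (ℓ n)) (g n)

lemma IsFormalCurve.irreducible {Γ : Ideal Series} (h : IsFormalCurve Γ) {g : Series}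
    (hg : Γ = Ideal.span {g}) : Irreducible g := by
  obtain ⟨f, hf, rfl⟩ := h
  exact (Ideal.span_singleton_eq_span_singleton.1 hg).irreducible hf

lemma constantCoeff_of_irreducible {g : Series} (hg : Irreducible g) : constantCoeff g = 0 := by
  by_contra h
  exact hg.not_isUnit (isUnit_iff_constantCoeff.2 (isUnit_iff_ne_zero.2 h))

lemma exceptionalDivisor_eq (ℓ : OnePoint ℂ) :
    exceptionalDivisor ℓ = Ideal.span {X (excIndex ℓ)} := by
  induction ℓ using OnePoint.rec <;> rfl

lemma exists_isCurveChain {Γ : Ideal Series} (hΓ : IsFormalCurve Γ) {ℓ : ℕ → OnePoint ℂ}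
    (h : IsInfinitelyNearSeq Γ ℓ) : ∃ g, Γ = Ideal.span {g 0} ∧ IsCurveChain ℓ g := by
  obtain ⟨G, rfl, hG⟩ := h
  choose g hg hg' using fun n => (hG n).1.2
  have hcurve : ∀ n, IsFormalCurve (G n) := fun n => by
    cases n with
    | zero => exact hΓ
    | succ n => exact (hG n).2.1
  have hirr := fun n => (hcurve n).irreducible (hg n)
  refine ⟨g, hg 0, hirr, hg', fun n hX => (hG n).2.2.1 ?_, fun n => ?_⟩
  · rw [hg, exceptionalDivisor_eq, Ideal.span_singleton_eq_span_singleton]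
    obtain ⟨k, hk⟩ := hX
    rcases (hirr (n + 1)).isUnit_or_isUnit hk with hu | hu
    · rw [isUnit_iff_constantCoeff, constantCoeff_X] at hu
      exact absurd hu (by simp)
    · rw [hk]
      exact associated_mul_unit_left _ _ hu
  · have h1 := (hG n).2.2.2 (g n) (by rw [hg n]; exact Ideal.mem_span_singleton_self _)
    rwa [hg (n + 1), Ideal.mem_span_singleton] at h1

variable {ℓ : ℕ → OnePoint ℂ} {g : ℕ → Series} {p : ℕ → ℕ → Plane}

lemma IsCurveChain.exists_coeff (h : IsCurveChain ℓ g) (n : ℕ) :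
    ∃ i ≤ (g n).order.toNat,
      coeff (Finsupp.single (excIndex (ℓ n)).rev i) (g (n + 1)) ≠ 0 :=
  exists_coeff_axis_strictTransform (h.irreducible n).ne_zero (h.not_dvd n) (h.dvd_subst n)

lemma order_toNat_le {f : Series} {d : Fin 2 →₀ ℕ} (h : coeff d f ≠ 0) :
    f.order.toNat ≤ d.degree :=
  ENat.toNat_le_of_le_natCast (order_le h)

lemma IsCurveChain.order_le (h : IsCurveChain ℓ g) (n : ℕ) :
    (g (n + 1)).order.toNat ≤ (g n).order.toNat := by
  obtain ⟨i, hi, hne⟩ := h.exists_coeff n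
  have := order_toNat_le hne
  rw [Finsupp.degree_single] at this
  omega

/-- The contact of the strict transform with the divisor lies between its own order and the order of
the curve below. If the two orders agree, the initial form does not vanish along the divisor, so the
next tangent is transversal to it. -/
lemma IsCurveChain.ne_axisLine (h : IsCurveChain ℓ g) {n : ℕ}
    (hn : (g (n + 1)).order.toNat = (g n).order.toNat) :
    ℓ (n + 1) ≠ axisLine (excIndex (ℓ n)) := by
  intro hℓ
  obtain ⟨i, hi, hne⟩ := h.exists_coeff n
  have h1 := order_toNat_le hne
  rw [Finsupp.degree_single] at h1
  obtain rfl : i = (g (n + 1)).order.toNat := by omega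
  have ht := h.tangent (n + 1)
  rw [initialForm_eq, hℓ] at ht
  generalize (g (n + 1)).order.toNat = k at ht hne
  apply hne
  generalize excIndex (ℓ n) = j at ht
  fin_cases j
  · change form k (g (n + 1)) ![0, 1] = 0 at ht
    rw [form, Finset.sum_eq_single 0] at ht
    · simpa using ht
    · intro i _ hi
      simp [hi]
    · simp
  · change form k (g (n + 1)) ![1, 0] = 0 at ht
    rw [form, Finset.sum_eq_single k] at ht
    · simpa using ht
    · intro i hi hik
      have : k - i ≠ 0 := by
        have := Finset.mem_range.1 hi
        omega
      simp [this]
    · simp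

lemma IsCurveChain.exists_order_stable (h : IsCurveChain ℓ g) :
    ∃ K, ∀ n ≥ K, (g (n + 1)).order.toNat = (g n).order.toNat := by
  have hanti : Antitone fun n => (g n).order.toNat := antitone_nat_of_succ_le h.order_le
  obtain ⟨m, ⟨K, rfl⟩, hmin⟩ := WellFounded.has_min (wellFounded_lt (α := ℕ))
    (Set.range fun n => (g n).order.toNat) ⟨_, 0, rfl⟩
  have key : ∀ n ≥ K, (g n).order.toNat = (g K).order.toNat := fun n hn =>
    le_antisymm (hanti hn) (not_lt.1 (hmin _ ⟨n, rfl⟩))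
  exact ⟨K, fun n hn => (key _ (by omega)).trans (key n hn).symm⟩

/-- A Łojasiewicz inequality along the sequence, by induction on a bound `N` for the contact of the
curve with the axis where coordinate `j` vanishes. If `ℓ n` is not that axis, the coordinate is
comparable with the norm. Otherwise a blow-up lowers the contact, and the coordinate is the product
of its lift and the exceptional coordinate, which costs one more power of the norm. -/
lemma IsCurveChain.pow_norm_le_coordinate (h : IsCurveChain ℓ g) (hp : IsLiftSeq ℓ p) (N : ℕ) :
    ∀ n j, coeff (Finsupp.single (Fin.rev j) N) (g n) ≠ 0 →
      ∃ M : ℕ, ∃ C > 0, ∀ᶠ m in atTop, ‖p n m‖ ^ M ≤ C * ‖p n m j‖ := by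
  induction N using Nat.strong_induction_on with
  | _ N ih =>
    intro n j hN
    by_cases hj : ℓ n = axisLine j
    · obtain ⟨N', hlt, hN'⟩ := exists_coeff_axis_lt (j := j)
        (constantCoeff_of_irreducible (h.irreducible n))
        (by simpa [hj, excIndex_axisLine] using h.not_dvd n) (by simpa [hj] using h.dvd_subst n) hN
      obtain ⟨M, C, hC, hM⟩ := ih N' hlt (n + 1) j hN'
      obtain ⟨D, hD, hD'⟩ := hp.norm_le (n := n) (j := j.rev) (by rw [hj]; exact axisLine_ne_rev j)
      refine ⟨M + 1, D ^ M * C * D, by positivity, ?_⟩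
      have h1 := hp.apply_excIndex n
      rw [hj, excIndex_axisLine] at h1
      filter_upwards [hM, hD', h1, hp.blowUp_eq n] with m hm hm' hm1 hm2
      have h2 : p n m j = p (n + 1) m j * p n m j.rev := by
        rw [hm1, ← hm2, hj, blowUp_axisLine]
      rw [h2, norm_mul]
      have h3 : ‖p n m j.rev‖ ^ M ≤ C * ‖p (n + 1) m j‖ := by
        refine le_trans ?_ hm
        rw [hm1]
        gcongr
        exact norm_le_pi_norm _ _
      calc ‖p n m‖ ^ (M + 1) ≤ (D * ‖p n m j.rev‖) ^ (M + 1) := by gcongr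
        _ = D ^ M * ‖p n m j.rev‖ ^ M * D * ‖p n m j.rev‖ := by ring
        _ ≤ D ^ M * (C * ‖p (n + 1) m j‖) * D * ‖p n m j.rev‖ := by gcongr
        _ = _ := by ring
    · obtain ⟨C, hC, hle⟩ := hp.norm_le hj
      exact ⟨1, C, hC, by simpa using hle⟩

/-- The strict transform has finite contact with the divisor, so the exceptional coordinate
dominates a power of the norm of the lift; this coordinate is also a coordinate of the point below.
-/
lemma IsCurveChain.pow_norm_succ_le (h : IsCurveChain ℓ g) (hp : IsLiftSeq ℓ p) (n : ℕ) :
    ∃ M : ℕ, ∃ C > 0, ∀ᶠ m in atTop, ‖p (n + 1) m‖ ^ M ≤ C * ‖p n m‖ := by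
  obtain ⟨i, -, hi⟩ := h.exists_coeff n
  obtain ⟨M, C, hC, hM⟩ := h.pow_norm_le_coordinate hp i (n + 1) _ hi
  refine ⟨M, C, hC, ?_⟩
  filter_upwards [hM, hp.apply_excIndex n] with m hm hm'
  refine hm.trans ?_
  rw [← hm']
  gcongr
  exact norm_le_pi_norm _ _

lemma IsCurveChain.pow_norm_le (h : IsCurveChain ℓ g) (hp : IsLiftSeq ℓ p) (n : ℕ) :
    ∃ M : ℕ, ∃ C > 0, ∀ᶠ m in atTop, ‖p n m‖ ^ M ≤ C * ‖p 0 m‖ := by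
  induction n with
  | zero => exact ⟨1, 1, one_pos, by simp⟩
  | succ n ih =>
    obtain ⟨M, C, hC, hM⟩ := ih
    obtain ⟨L, D, hD, hL⟩ := h.pow_norm_succ_le hp n
    refine ⟨L * M, D ^ M * C, by positivity, ?_⟩
    filter_upwards [hM, hL] with m hm hm'
    calc ‖p (n + 1) m‖ ^ (L * M) = (‖p (n + 1) m‖ ^ L) ^ M := pow_mul _ _ _
      _ ≤ (D * ‖p n m‖) ^ M := by gcongr
      _ = D ^ M * ‖p n m‖ ^ M := mul_pow _ _ _
      _ ≤ D ^ M * (C * ‖p 0 m‖) := by gcongr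
      _ = _ := by ring

/-- Since `φ` vanishes at the origin, its total transform is the exceptional coordinate times a
convergent `ψ`, and `ψ` is again divisible by the next curve. Each blow-up therefore yields one
factor of the product, and the induction continues with `ψ`. -/
lemma IsCurveChain.norm_ev_le_prod (h : IsCurveChain ℓ g) (hp : IsLiftSeq ℓ p) (k : ℕ) :
    ∀ n φ, Convergent φ → g n ∣ φ → ∃ C > 0, ∀ᶠ m in atTop,
      ‖ev φ (p n m)‖ ≤ C * ∏ i ∈ Finset.range k, ‖p (n + i) m‖ := by
  induction k with
  | zero =>
    intro n φ hφ _
    obtain ⟨C, hC, hle⟩ := hφ.exists_norm_ev_le (N := 0) (by simp)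
    refine ⟨C, hC, ?_⟩
    filter_upwards [(hp.tendsto n).eventually hle] with m hm
    simpa using hm
  | succ k ih =>
    intro n φ hφ hdvd
    have h0 : constantCoeff φ = 0 := by
      obtain ⟨s, rfl⟩ := hdvd
      rw [map_mul, constantCoeff_of_irreducible (h.irreducible n), zero_mul]
    have hs := hasSubst_blowUpSeries (ℓ n)
    have h1 : X (excIndex (ℓ n)) ^ 1 ∣ subst (blowUpSeries (ℓ n)) φ := by
      refine pow_dvd_subst hs (fun i => ?_) (one_le_order_iff_constCoeff_eq_zero.2 h0)
      rw [blowUpSeries_eq]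
      exact dvd_mul_right _ _
    rw [pow_one] at h1
    obtain ⟨ψ, hψ⟩ := h1
    have hc : Convergent (subst (blowUpSeries (ℓ n)) φ) :=
      hφ.subst (convergent_blowUpSeries _) (constantCoeff_blowUpSeries _)
    have hψc : Convergent ψ := by
      rw [hψ] at hc
      exact hc.of_X_mul
    have hdvd' : g (n + 1) ∣ ψ := by
      refine dvd_of_dvd_X_mul (h.not_dvd n) ?_
      rw [← hψ]
      obtain ⟨s, rfl⟩ := hdvd
      rw [subst_mul hs]
      exact (h.dvd_subst n).mul_right _
    obtain ⟨C, hC, hle⟩ := ih (n + 1) ψ hψc hdvd'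
    refine ⟨C, hC, ?_⟩
    have ht := hp.tendsto (n + 1)
    filter_upwards [hle, hp.blowUp_eq n, hp.apply_excIndex n,
      ht.eventually (Convergent.eventually_ev_subst (convergent_blowUpSeries (ℓ n))
        (constantCoeff_blowUpSeries _) hφ),
      ht.eventually ((convergent_X (excIndex (ℓ n))).eventually_ev_mul hψc)] with m h2 h3 h4 h5 h6
    rw [ev_blowUpSeries, h3, hψ, h6, ev_X, ← h4] at h5
    rw [← h5, norm_mul, Finset.prod_range_succ', add_zero]
    calc ‖p n m (excIndex (ℓ n))‖ * ‖ev ψ (p (n + 1) m)‖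
        ≤ ‖p n m‖ * (C * ∏ i ∈ Finset.range k, ‖p (n + 1 + i) m‖) := by
          gcongr
          exact norm_le_pi_norm _ _
      _ = _ := by
          simp only [add_assoc, add_comm 1]
          ring

/-- By transversality to the preceding divisor, the norm of a lift is controlled by its exceptional
coordinate, which it shares with the point below. -/
lemma IsCurveChain.norm_stable_le (h : IsCurveChain ℓ g) (hp : IsLiftSeq ℓ p) {K : ℕ}
    (hK : ∀ n ≥ K, (g (n + 1)).order.toNat = (g n).order.toNat) (i : ℕ) :
    ∃ C > 0, ∀ᶠ m in atTop, ‖p (K + i) m‖ ≤ C * ‖p K m‖ := by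
  induction i with
  | zero => exact ⟨1, one_pos, by simp⟩
  | succ i ih =>
    obtain ⟨C, hC, hle⟩ := ih
    obtain ⟨D, hD, hle'⟩ := hp.norm_le (h.ne_axisLine (hK (K + i) (by omega)))
    refine ⟨D * C, by positivity, ?_⟩
    filter_upwards [hle, hle', hp.apply_excIndex (K + i)] with m h1 h2 h3
    rw [← h3] at h2
    calc ‖p (K + (i + 1)) m‖ ≤ D * ‖p (K + i) m (excIndex (ℓ (K + i)))‖ := h2
      _ ≤ D * ‖p (K + i) m‖ := by
        gcongr
        exact norm_le_pi_norm _ _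
      _ ≤ D * (C * ‖p K m‖) := by gcongr
      _ = _ := by ring

lemma IsCurveChain.norm_ev_le_pow (h : IsCurveChain ℓ g) (hp : IsLiftSeq ℓ p) {φ : Series}
    (hφ : Convergent φ) (hdvd : g 0 ∣ φ) (k : ℕ) :
    ∃ C > 0, ∀ᶠ m in atTop, ‖ev φ (p 0 m)‖ ≤ C * ‖p 0 m‖ ^ k := by
  obtain ⟨K, hK⟩ := h.exists_order_stable
  obtain ⟨M, A, hA, hM⟩ := h.pow_norm_le hp K
  -- The first `K` factors are only used as bounded by one. The other `M * k` are `O(‖p K m‖)`, and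
  -- `‖p K m‖ ^ M = O(‖p 0 m‖)` turns them into `‖p 0 m‖ ^ k`.
  obtain ⟨B, hB, hle⟩ := h.norm_ev_le_prod hp (K + M * k) 0 φ hφ hdvd
  choose D hD hDle using h.norm_stable_le hp hK
  have hD' : 0 < ∏ i ∈ Finset.range (M * k), D i := Finset.prod_pos fun i _ => hD i
  refine ⟨B * ((∏ i ∈ Finset.range (M * k), D i) * A ^ k), by positivity, ?_⟩
  have hsmall : ∀ᶠ m in atTop, ∀ i ∈ Finset.range K, ‖p i m‖ ≤ 1 :=
    (eventually_all_finset _).2 fun i _ =>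
      (hp.tendsto i).norm.eventually_le_const (by simp)
  have hbig : ∀ᶠ m in atTop, ∀ i ∈ Finset.range (M * k), ‖p (K + i) m‖ ≤ D i * ‖p K m‖ :=
    (eventually_all_finset _).2 fun i _ => hDle i
  filter_upwards [hle, hM, hsmall, hbig] with m h1 h2 h3 h4
  refine h1.trans ?_
  simp only [zero_add]
  rw [Finset.prod_range_add, mul_assoc]
  refine mul_le_mul_of_nonneg_left ?_ hB.le
  have h5 : ∏ i ∈ Finset.range K, ‖p i m‖ ≤ 1 :=
    Finset.prod_le_one (fun _ _ => norm_nonneg _) h3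
  calc (∏ i ∈ Finset.range K, ‖p i m‖) * ∏ i ∈ Finset.range (M * k), ‖p (K + i) m‖
      ≤ 1 * ∏ i ∈ Finset.range (M * k), (D i * ‖p K m‖) := by
        gcongr with i hi
        exact h4 i hi
    _ = (∏ i ∈ Finset.range (M * k), D i) * (‖p K m‖ ^ M) ^ k := by
        rw [one_mul, Finset.prod_mul_distrib, Finset.prod_const, Finset.card_range, pow_mul]
    _ ≤ (∏ i ∈ Finset.range (M * k), D i) * (A * ‖p 0 m‖) ^ k := by
        gcongr
    _ = _ := by rw [mul_pow]; ring

/-- A sequence asymptotic to a formal curve has contact of infinite order with it. -/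
theorem norm_ev_le_of_isAsymptoticTo {Γ : Ideal Series} (hΓ : IsFormalCurve Γ) {a : ℕ → Plane}
    (ha : Tendsto a atTop (𝓝 0)) (h : IsAsymptoticTo (Set.range a) Γ) {φ : Series}
    (hφ : Convergent φ) (hφΓ : φ ∈ Γ) (k : ℕ) :
    ∃ C > 0, ∀ᶠ m in atTop, ‖ev φ (a m)‖ ≤ C * ‖a m‖ ^ k := by
  obtain ⟨ℓ, hℓ, hℓ'⟩ := h
  obtain ⟨p, rfl, hp⟩ := exists_isLiftSeq ha hℓ
  obtain ⟨g, hg, hchain⟩ := exists_isCurveChain hΓ hℓ'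
  rw [hg, Ideal.mem_span_singleton] at hφΓ
  exact hchain.norm_ev_le_pow hp hφ hφΓ k

end Contact

/-! ### Truncations of power series -/

section Truncation

variable {σ τ : Type*} [Finite σ] [Finite τ]

/-- The terms of degree less than `k` of a power series. -/
noncomputable def truncSeries (k : ℕ) (f : MvPowerSeries σ ℂ) : MvPowerSeries σ ℂ :=
  (truncTotal k f : MvPolynomial σ ℂ)

lemma coeff_truncSeries (k : ℕ) (f : MvPowerSeries σ ℂ) (e : σ →₀ ℕ) :
    coeff e (truncSeries k f) = if e.degree < k then coeff e f else 0 := by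
  rw [truncSeries, MvPolynomial.coeff_coe, coeff_truncTotal_eq_ite]

lemma truncSeries_eq_iff {k : ℕ} {f g : MvPowerSeries σ ℂ} :
    truncSeries k f = truncSeries k g ↔ (k : ℕ∞) ≤ (f - g).order := by
  constructor
  · intro h
    refine le_order fun e he => ?_
    have he' : e.degree < k := by exact_mod_cast he
    have := congrArg (coeff e) h
    rw [coeff_truncSeries, coeff_truncSeries, if_pos he', if_pos he'] at this
    rw [map_sub, this, sub_self]
  · intro h
    ext e
    rw [coeff_truncSeries, coeff_truncSeries]
    split_ifs with he
    · rw [← sub_eq_zero, ← map_sub]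
      exact coeff_of_lt_order (lt_of_lt_of_le (by exact_mod_cast he) h)
    · rfl

lemma truncSeries_add (k : ℕ) (f g : MvPowerSeries σ ℂ) :
    truncSeries k (f + g) = truncSeries k f + truncSeries k g := by
  ext e
  simp only [map_add, coeff_truncSeries]
  split_ifs <;> simp

lemma truncSeries_sub (k : ℕ) (f g : MvPowerSeries σ ℂ) :
    truncSeries k (f - g) = truncSeries k f - truncSeries k g := by
  ext e
  simp only [map_sub, coeff_truncSeries]
  split_ifs <;> simp

lemma truncSeries_smul (k : ℕ) (c : ℂ) (f : MvPowerSeries σ ℂ) :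
    truncSeries k (c • f) = c • truncSeries k f := by
  ext e
  simp only [map_smul, coeff_truncSeries]
  split_ifs <;> simp

lemma le_order_sub_truncSeries (k : ℕ) (f : MvPowerSeries σ ℂ) :
    (k : ℕ∞) ≤ (f - truncSeries k f).order := by
  refine le_order fun e he => ?_
  rw [map_sub, coeff_truncSeries, if_pos (by exact_mod_cast he), sub_self]

lemma le_order_truncSeries {n : ℕ∞} {f : MvPowerSeries σ ℂ} (h : n ≤ f.order) (k : ℕ) :
    n ≤ (truncSeries k f).order := by
  refine le_order fun e he => ?_
  rw [coeff_truncSeries]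
  split_ifs
  · exact coeff_of_lt_order (he.trans_le h)
  · rfl

lemma majorant_truncSeries_le (r : ℝ≥0∞) (k : ℕ) (f : MvPowerSeries σ ℂ) :
    majorant r (truncSeries k f) ≤ majorant r f := by
  refine majorant_mono_coeff fun e => ?_
  rw [coeff_truncSeries]
  split_ifs <;> simp

lemma majorant_truncSeries_ne_top {r : ℝ≥0∞} (hr : r ≠ ⊤) (k : ℕ) (f : MvPowerSeries σ ℂ) :
    majorant r (truncSeries k f) ≠ ⊤ := by
  have h1 : truncSeries k f = ∑ e ∈ (truncTotal k f).support,
      monomial e (MvPolynomial.coeff e (truncTotal k f)) := by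
    classical
    ext d
    rw [truncSeries, MvPolynomial.coeff_coe, map_sum]
    simp only [coeff_monomial]
    rw [Finset.sum_ite_eq]
    split_ifs with h
    · rfl
    · simpa using h
  rw [h1]
  refine ne_top_of_le_ne_top ?_ (majorant_sum_le _ _ _)
  refine ENNReal.sum_ne_top.2 fun e _ => ?_
  rw [majorant_monomial]
  finiteness

/-- Reduces convergence to bounds uniform in `k` for polynomials; at a finite radius their majorants
are finite and can be cancelled from inequalities. -/
lemma majorant_le_of_truncSeries {r B : ℝ≥0∞} {f : MvPowerSeries σ ℂ}
    (h : ∀ k, majorant r (truncSeries k f) ≤ B) : majorant r f ≤ B := by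
  rw [majorant, ENNReal.tsum_eq_iSup_sum]
  refine iSup_le fun s => ?_
  refine le_trans ?_ (h (s.sup Finsupp.degree + 1))
  refine le_trans (Finset.sum_le_sum fun e he => ?_) (ENNReal.sum_le_tsum s)
  rw [coeff_truncSeries, if_pos (Nat.lt_succ_of_le (Finset.le_sup (f := Finsupp.degree) he))]

lemma le_order_subst_sub {a b : σ → MvPowerSeries τ ℂ} (ha : ∀ i, constantCoeff (a i) = 0)
    (hb : ∀ i, constantCoeff (b i) = 0) {k : ℕ} (h : ∀ i, (k : ℕ∞) ≤ (a i - b i).order)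
    (f : MvPowerSeries σ ℂ) : (k : ℕ∞) ≤ (subst a f - subst b f).order := by
  have h1 : ∀ i, truncTotal k (a i) = truncTotal k (b i) := fun i => by
    simpa [truncSeries] using truncSeries_eq_iff.2 (h i)
  rw [← truncSeries_eq_iff, truncSeries, truncSeries, truncTotal_subst ha, truncTotal_subst hb]
  simp only [h1]

end Truncation

/-! ### Degree-by-degree solution of equations in power series -/

section Newton

variable {σ τ : Type*}

/-- A version of Newton's method in the adic topology of a ring of power series. -/
lemma exists_eq_zero_of_newton {E : MvPowerSeries σ ℂ → MvPowerSeries τ ℂ} {s₀ : MvPowerSeries σ ℂ}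
    {k₀ : ℕ} (h0 : (k₀ : ℕ∞) ≤ (E s₀).order)
    (h1 : ∀ (k : ℕ) s s', (k₀ : ℕ∞) ≤ (s - s₀).order → (k₀ : ℕ∞) ≤ (s' - s₀).order →
      (k : ℕ∞) ≤ (s - s').order → (k : ℕ∞) ≤ (E s - E s').order)
    (h2 : ∀ k ≥ k₀, ∀ s, (k₀ : ℕ∞) ≤ (s - s₀).order → (k : ℕ∞) ≤ (E s).order →
      ∃ h, (k : ℕ∞) ≤ h.order ∧ ((k + 1 : ℕ) : ℕ∞) ≤ (E (s + h)).order) :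
    ∃ s, (k₀ : ℕ∞) ≤ (s - s₀).order ∧ E s = 0 := by
  let P : ℕ → MvPowerSeries σ ℂ → Prop := fun j s =>
    (k₀ : ℕ∞) ≤ (s - s₀).order ∧ ((k₀ + j : ℕ) : ℕ∞) ≤ (E s).order
  have step : ∀ j (s : {s // P j s}), ∃ s' : {s // P (j + 1) s},
      ((k₀ + j : ℕ) : ℕ∞) ≤ (s'.1 - s.1).order := by
    rintro j ⟨s, hs, hs'⟩
    obtain ⟨h, hh, hE⟩ := h2 (k₀ + j) (by omega) s hs hs'
    refine ⟨⟨s + h, ?_, hE⟩, by simpa using hh⟩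
    rw [add_sub_right_comm]
    exact le_order_add hs (le_trans (by exact_mod_cast (by omega)) hh)
  choose f hf using step
  let t : ∀ j, {s // P j s} := fun j => Nat.rec ⟨s₀, by simp, by simpa using h0⟩ f j
  have ht : ∀ j, ((k₀ + j : ℕ) : ℕ∞) ≤ ((t (j + 1)).1 - (t j).1).order := fun j => hf j (t j)
  have ht' : ∀ j i, ((k₀ + j : ℕ) : ℕ∞) ≤ ((t (j + i)).1 - (t j).1).order := by
    intro j i
    induction i with
    | zero => simp
    | succ i ih =>
      rw [← sub_add_sub_cancel _ (t (j + i)).1]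
      exact le_order_add (le_trans (by exact_mod_cast (by omega)) (ht (j + i))) ih
  have hcoeff : ∀ j i e, e.degree < k₀ + j → coeff e (t (j + i)).1 = coeff e (t j).1 := by
    intro j i e he
    rw [← sub_eq_zero, ← map_sub]
    exact coeff_of_lt_order (lt_of_lt_of_le (by exact_mod_cast he) (ht' j i))
  -- The iterates from index `j` on agree in degrees below `k₀ + j`, so at index `e.degree + 1` the
  -- coefficient of `e` is already stationary, even for `k₀ = 0`.
  let s : MvPowerSeries σ ℂ := fun e => coeff e (t (e.degree + 1)).1
  have hs : ∀ j, ((k₀ + j : ℕ) : ℕ∞) ≤ (s - (t j).1).order := by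
    intro j
    refine le_order fun e he => ?_
    have he' : e.degree < k₀ + j := by exact_mod_cast he
    have h3 : coeff e s = coeff e (t (e.degree + 1)).1 := rfl
    rw [map_sub, h3, sub_eq_zero]
    rcases le_total j (e.degree + 1) with h | h
    · obtain ⟨i, hi⟩ := Nat.exists_eq_add_of_le h
      rw [hi, hcoeff _ _ _ he']
    · obtain ⟨i, hi⟩ := Nat.exists_eq_add_of_le h
      rw [hi, hcoeff _ _ _ (by omega)]
  have hs0 : (k₀ : ℕ∞) ≤ (s - s₀).order := hs 0
  refine ⟨s, hs0, ?_⟩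
  rw [← order_eq_top_iff, ENat.eq_top_iff_forall_ge]
  intro j
  rw [← sub_add_cancel (E s) (E (t j).1)]
  refine le_order_add (h1 j _ _ hs0 (t j).2.1 (le_trans ?_ (hs j))) (le_trans ?_ (t j).2.2) <;>
  exact_mod_cast (by omega)

end Newton

/-! ### Formal contractions: cohomological equation and convergence of eigenvectors -/

section Contraction

variable {Φ : Fin 2 → Series}

/-- The homogeneous polynomial of degree `k` with given coefficients. -/
noncomputable def formSeries (k : ℕ) : (Fin (k + 1) → ℂ) →ₗ[ℂ] Series :=
  ∑ i : Fin (k + 1), (monomial (Finsupp.single 0 (i : ℕ) + Finsupp.single 1 (k - i))).comp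
    (LinearMap.proj i)

/-- The coefficients of the homogeneous part of degree `k`. -/
noncomputable def formCoeff (k : ℕ) : Series →ₗ[ℂ] (Fin (k + 1) → ℂ) :=
  LinearMap.pi fun i => coeff (Finsupp.single 0 (i : ℕ) + Finsupp.single 1 (k - i))

lemma formCoeff_apply (k : ℕ) (f : Series) (i : Fin (k + 1)) :
    formCoeff k f i = coeff (Finsupp.single 0 (i : ℕ) + Finsupp.single 1 (k - i)) f := rfl

lemma formSeries_apply (k : ℕ) (c : Fin (k + 1) → ℂ) : formSeries k c =
    ∑ i : Fin (k + 1), monomial (Finsupp.single 0 (i : ℕ) + Finsupp.single 1 (k - i)) (c i) := by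
  simp [formSeries]

lemma formCoeff_formSeries (k : ℕ) (c : Fin (k + 1) → ℂ) : formCoeff k (formSeries k c) = c := by
  classical
  ext i
  rw [formCoeff_apply, formSeries_apply, map_sum, Finset.sum_eq_single i]
  · exact coeff_monomial_same _ _
  · intro j _ hj
    rw [coeff_monomial, if_neg]
    intro h
    have := DFunLike.congr_fun h 0
    simp at this
    exact hj (Fin.ext this.symm)
  · simp

lemma le_order_formSeries (k : ℕ) (c : Fin (k + 1) → ℂ) : (k : ℕ∞) ≤ (formSeries k c).order := by
  classical
  refine le_order fun e he => ?_
  rw [formSeries_apply, map_sum]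
  refine Finset.sum_eq_zero fun i _ => ?_
  rw [coeff_monomial, if_neg]
  rintro rfl
  rw [map_add, Finsupp.degree_single, Finsupp.degree_single] at he
  have he' : (i : ℕ) + (k - i) < k := by exact_mod_cast he
  omega

lemma le_order_succ_of_formCoeff {f : Series} {k : ℕ} (h : k ≤ f.order)
    (h' : formCoeff k f = 0) : ((k + 1 : ℕ) : ℕ∞) ≤ f.order :=
  le_order_succ_of_coeff h fun i hi => congrFun h' ⟨i, Nat.lt_succ_of_le hi⟩

lemma form_eq_zero_of_formCoeff {f : Series} {k : ℕ} (h : formCoeff k f = 0) (v : Plane) :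
    form k f v = 0 := by
  refine Finset.sum_eq_zero fun i hi => ?_
  have h1 : coeff (Finsupp.single 0 i + Finsupp.single 1 (k - i)) f = 0 :=
    congrFun h ⟨i, Finset.mem_range.1 hi⟩
  rw [h1]
  ring

lemma formCoeff_eq_zero_of_form {f : Series} {k : ℕ} (h : ∀ v, form k f v = 0) :
    formCoeff k f = 0 := by
  ext i
  exact coeff_eq_zero_of_forall_sum_pow
    (c := fun i => coeff (Finsupp.single 0 i + Finsupp.single 1 (k - i)) f)
    (fun x => by simpa [form] using h ![x, 1]) i (Nat.lt_succ_iff.1 i.2)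

lemma form_sub (k : ℕ) (f g : Series) (v : Plane) : form k (f - g) v = form k f v - form k g v := by
  simp only [form, map_sub, sub_mul, Finset.sum_sub_distrib]

/-- The value at `v` equals the value at `A^[n] v`, which tends to the value at `0`; that value is
zero in positive degree. -/
lemma form_eq_zero_of_invariant {A : Plane → Plane} {κ : ℝ} (hκ0 : 0 ≤ κ) (hκ : κ < 1)
    (hA : ∀ v, ‖A v‖ ≤ κ * ‖v‖) {k : ℕ} (hk : 1 ≤ k) {f : Series}
    (h : ∀ v, form k f (A v) = form k f v) (v : Plane) : form k f v = 0 := by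
  have h1 : ∀ n : ℕ, form k f (A^[n] v) = form k f v := by
    intro n
    induction n with
    | zero => rfl
    | succ n ih => rw [Function.iterate_succ_apply', h, ih]
  have h2 : ∀ n : ℕ, ‖A^[n] v‖ ≤ κ ^ n * ‖v‖ := by
    intro n
    induction n with
    | zero => simp
    | succ n ih =>
      rw [Function.iterate_succ_apply', pow_succ', mul_assoc]
      exact (hA _).trans (by gcongr)
  have h3 : Tendsto (fun n => A^[n] v) atTop (𝓝 0) := by
    refine squeeze_zero_norm h2 ?_
    simpa using (tendsto_pow_atTop_nhds_zero_of_lt_one hκ0 hκ).mul_const ‖v‖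
  have h4 : Continuous (form k f) := by
    unfold form
    fun_prop
  have h5 : form k f 0 = 0 := by
    refine Finset.sum_eq_zero fun i hi => ?_
    rcases Nat.eq_zero_or_pos i with rfl | hi
    · simp [show k ≠ 0 by omega]
    · simp [hi.ne']
  have h6 := (h4.tendsto 0).comp h3
  rw [h5] at h6
  refine tendsto_nhds_unique ?_ h6
  exact tendsto_const_nhds.congr fun n => (h1 n).symm

/-- Solution of the multiplicative cohomological equation of a formal contraction. -/
lemma exists_eq_mul_subst (hΦ : ∀ i, constantCoeff (Φ i) = 0) {κ : ℝ} (hκ0 : 0 ≤ κ) (hκ : κ < 1)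
    (hA : ∀ v, ‖linearPart Φ v‖ ≤ κ * ‖v‖) {u : Series} (hu : constantCoeff u = 1) :
    ∃ v : Series, constantCoeff v = 1 ∧ v = u * subst Φ v := by
  have hs := hasSubst_of_constantCoeff_zero hΦ
  let L : Series →ₗ[ℂ] Series :=
    LinearMap.id - (LinearMap.mulLeft ℂ u).comp (substAlgHom (R := ℂ) hs).toLinearMap
  have hL : ∀ s, L s = s - u * subst Φ s := fun s => by
    simp [L, coe_substAlgHom hs]
  have hLord : ∀ s, s.order ≤ (L s).order := fun s => by
    rw [hL]
    exact le_order_sub le_rfl (le_order_mul_left _ (order_le_order_subst hΦ s))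
  have key : ∃ v, ((1 : ℕ) : ℕ∞) ≤ (v - 1).order ∧ L v = 0 := by
    refine exists_eq_zero_of_newton ?_ ?_ ?_
    · refine one_le_order_iff_constCoeff_eq_zero.2 ?_
      rw [hL, map_sub, map_mul, constantCoeff_subst_of_zero hΦ, hu]
      simp
    · intro k s s' _ _ h
      rw [← map_sub]
      exact h.trans (hLord _)
    · intro k hk s _ hE
      -- As `u` has constant term one, `L` acts in degree `k` as the identity minus composition with
      -- the linear part. A contraction has no invariant form of positive degree, so `T` is
      -- injective, hence surjective by finite dimension.
      let T : (Fin (k + 1) → ℂ) →ₗ[ℂ] (Fin (k + 1) → ℂ) := (formCoeff k ∘ₗ L) ∘ₗ formSeries k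
      have hinj : Function.Injective T := by
        refine (injective_iff_map_eq_zero T).2 fun c hc => ?_
        have h1 : ∀ v, form k (formSeries k c) (linearPart Φ v) = form k (formSeries k c) v := by
          intro v
          have h2 := form_eq_zero_of_formCoeff (f := L (formSeries k c)) hc v
          rw [hL, form_sub, form_mul ((le_order_formSeries k c).trans (order_le_order_subst hΦ _)),
            hu, one_mul, form_subst hΦ (le_order_formSeries k c)] at h2
          exact (sub_eq_zero.1 h2).symm
        rw [← formCoeff_formSeries k c]
        exact formCoeff_eq_zero_of_form (form_eq_zero_of_invariant hκ0 hκ hA hk h1)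
      obtain ⟨c, hc⟩ := LinearMap.injective_iff_surjective.1 hinj (-formCoeff k (L s))
      refine ⟨formSeries k c, le_order_formSeries k c, ?_⟩
      rw [map_add]
      refine le_order_succ_of_formCoeff
        (le_order_add hE ((le_order_formSeries k c).trans (hLord _))) ?_
      rw [map_add]
      change formCoeff k (L s) + T c = 0
      rw [hc, add_neg_cancel]
  obtain ⟨v, hv, hLv⟩ := key
  refine ⟨v, ?_, ?_⟩
  · have := one_le_order_iff_constCoeff_eq_zero.1 hv
    simpa [sub_eq_zero] using this
  · rw [hL] at hLv
    exact sub_eq_zero.1 hLv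

/-- A formal eigenvector of a contraction converges. -/
lemma majorant_ne_top_of_subst_eq_smul (hΦ : ∀ i, constantCoeff (Φ i) = 0) {r κ : ℝ≥0∞}
    (hr : r ≠ ⊤) (hκ : κ < 1) (hr' : ∀ i, majorant r (Φ i) ≤ κ * r) {f : Series} {c : ℂ}
    (hc : c ≠ 0) (h : subst Φ f = c • f) : majorant r f ≠ ⊤ := by
  have hs := hasSubst_of_constantCoeff_zero hΦ
  have hc0 : ‖c‖ₑ ≠ 0 := by simpa using hc
  -- On series of order at least `N`, composition with `Φ` has norm at most half the modulus of the
  -- eigenvalue. The equation for the remainder `R` can thus be solved for its norm, with the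
  -- polynomial `P` supplying the error `Q`.
  obtain ⟨N, hN⟩ : ∃ N : ℕ, κ ^ N ≤ ‖c‖ₑ / 2 := by
    have h1 := ENNReal.tendsto_pow_atTop_nhds_zero_of_lt_one hκ
    exact (h1.eventually_le_const (ENNReal.half_pos hc0)).exists
  set P := truncSeries N f with hP
  set R := f - P with hR
  set Q := subst Φ P - c • P with hQ
  have hPtop : majorant r P ≠ ⊤ := majorant_truncSeries_ne_top hr N f
  have hκr : κ * r ≤ r := mul_le_of_le_one_left' hκ.le
  have hQtop : majorant r Q ≠ ⊤ := by
    refine ne_top_of_le_ne_top ?_ (majorant_sub_le _ _ _)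
    rw [majorant_smul]
    refine ENNReal.add_ne_top.2 ⟨?_, ENNReal.mul_ne_top enorm_ne_top hPtop⟩
    exact ne_top_of_le_ne_top hPtop
      ((majorant_subst_le hs hr' P).trans (majorant_mono hκr P))
  have hRord : (N : ℕ∞) ≤ R.order := le_order_sub_truncSeries N f
  have hRQ : c • R = subst Φ R + Q := by
    rw [hR, hQ, subst_sub hs, h, smul_sub]
    ring
  -- The absorption is carried out for truncations, since the majorant of `R` is not yet known to be
  -- finite and cannot be subtracted.
  have hle : ∀ k, majorant r (truncSeries k R) ≤ 2 * (majorant r Q / ‖c‖ₑ) := by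
    intro k
    have h1 : c • truncSeries k R =
        truncSeries k (subst Φ (truncSeries k R)) + truncSeries k Q := by
      rw [← truncSeries_smul, hRQ, truncSeries_add]
      congr 1
      rw [truncSeries_eq_iff, ← subst_sub hs]
      exact (le_order_sub_truncSeries k R).trans (order_le_order_subst hΦ _)
    have h2 : majorant r (truncSeries k R) ≠ ⊤ := majorant_truncSeries_ne_top hr k R
    have h3 : ‖c‖ₑ * majorant r (truncSeries k R) ≤
        ‖c‖ₑ / 2 * majorant r (truncSeries k R) + majorant r Q := by
      rw [← majorant_smul, h1]
      refine (majorant_add_le _ _ _).trans ?_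
      refine add_le_add ?_ (majorant_truncSeries_le r k Q)
      refine (majorant_truncSeries_le r k _).trans ?_
      refine (majorant_subst_le hs hr' _).trans ?_
      refine (majorant_mul_radius_le hκ.le r (le_order_truncSeries hRord k)).trans ?_
      gcongr
    have h4 : ‖c‖ₑ / 2 * majorant r (truncSeries k R) ≤ majorant r Q := by
      have h5 : ‖c‖ₑ * majorant r (truncSeries k R) =
          ‖c‖ₑ / 2 * majorant r (truncSeries k R) + ‖c‖ₑ / 2 * majorant r (truncSeries k R) := by
        rw [← add_mul, ENNReal.add_halves]
      rw [h5] at h3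
      refine (ENNReal.add_le_add_iff_left ?_).1 h3
      exact ENNReal.mul_ne_top (ENNReal.div_ne_top enorm_ne_top (by simp)) h2
    have h6 : majorant r (truncSeries k R) ≤ majorant r Q / (‖c‖ₑ / 2) := by
      rw [ENNReal.le_div_iff_mul_le (Or.inl (ENNReal.half_pos hc0).ne')
        (Or.inl (ENNReal.div_ne_top enorm_ne_top (by simp))), mul_comm]
      exact h4
    refine h6.trans (le_of_eq ?_)
    rw [div_eq_mul_inv, ENNReal.inv_div (by simp) (by simp), div_eq_mul_inv, div_eq_mul_inv]
    ring
  have hRtop : majorant r R ≠ ⊤ :=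
    ne_top_of_le_ne_top (ENNReal.mul_ne_top (by simp) (ENNReal.div_ne_top hQtop hc0))
      (majorant_le_of_truncSeries hle)
  have hf : f = R + P := by rw [hR, sub_add_cancel]
  rw [hf]
  exact ne_top_of_le_ne_top (ENNReal.add_ne_top.2 ⟨hRtop, hPtop⟩) (majorant_add_le _ _ _)

end Contraction

/-! ### Formal invariant graphs tangent to the first axis -/

section Saddle

variable {τ : Type*}

lemma exists_eq_X_mul_add {f : Series} {N : ℕ} (h : ((N + 1 : ℕ) : ℕ∞) ≤ f.order) :
    ∃ g : Fin 2 → Series, (∀ i, (N : ℕ∞) ≤ (g i).order) ∧ f = X 0 * g 0 + X 1 * g 1 := by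
  have key : ∀ (i : Fin 2) (g : Series), ((N + 1 : ℕ) : ℕ∞) ≤ (X i * g).order →
      (N : ℕ∞) ≤ g.order := by
    intro i g hg
    rw [order_mul, order_X, Nat.cast_add, Nat.cast_one, add_comm] at hg
    exact (ENat.add_le_add_iff_left (by simp)).1 hg
  obtain ⟨g0, h0⟩ := X0_dvd_sub_dropX0 f
  obtain ⟨g1, h1⟩ := (dvd_pow_self (X 1) (Nat.succ_ne_zero N)).trans (X1_pow_dvd_dropX0 h)
  refine ⟨![g0, g1], fun i => ?_, ?_⟩
  · fin_cases i
    · exact key 0 _ (h0 ▸ le_order_sub h (le_order_dropX0 h))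
    · exact key 1 _ (h1 ▸ le_order_dropX0 h)
  · change f = X 0 * g0 + X 1 * g1
    rw [← h0, ← h1, sub_add_cancel]

lemma le_order_mul_of_add {σ : Type*} {f g : MvPowerSeries σ ℂ} {m n k : ℕ}
    (hf : (m : ℕ∞) ≤ f.order) (hg : (n : ℕ∞) ≤ g.order) (hk : k ≤ m + n) :
    (k : ℕ∞) ≤ (f * g).order := by
  rw [order_mul]
  exact le_trans (by exact_mod_cast hk) (add_le_add hf hg)

lemma le_order_smul' {σ : Type*} {n : ℕ∞} {f : MvPowerSeries σ ℂ} (c : ℂ) (h : n ≤ f.order) :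
    n ≤ (c • f).order := h.trans le_order_smul

/-- Without constant and linear terms, `f = X 0 * g 0 + X 1 * g 1` with `g i` of positive order. By
the product rule every term of the difference has a factor of order at least `k` and one of order at
least one. -/
lemma le_order_subst_sub_succ [Finite τ] {a b : Fin 2 → MvPowerSeries τ ℂ}
    (ha : ∀ i, constantCoeff (a i) = 0)
    (hb : ∀ i, constantCoeff (b i) = 0) {k : ℕ} (h : ∀ i, (k : ℕ∞) ≤ (a i - b i).order)
    {f : Series} (hf : 2 ≤ f.order) : ((k + 1 : ℕ) : ℕ∞) ≤ (subst a f - subst b f).order := by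
  obtain ⟨g, hg, rfl⟩ := exists_eq_X_mul_add (N := 1) (f := f) hf
  have hsa := hasSubst_of_constantCoeff_zero ha
  have hsb := hasSubst_of_constantCoeff_zero hb
  have key : ∀ i, ((k + 1 : ℕ) : ℕ∞) ≤
      (a i * subst a (g i) - b i * subst b (g i)).order := by
    intro i
    have h1 : a i * subst a (g i) - b i * subst b (g i) =
        (a i - b i) * subst a (g i) + b i * (subst a (g i) - subst b (g i)) := by ring
    rw [h1]
    refine le_order_add ?_ ?_
    · exact le_order_mul_of_add (h i) ((hg i).trans (order_le_order_subst ha _)) le_rfl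
    · exact le_order_mul_of_add (m := 1) (one_le_order_iff_constCoeff_eq_zero.2 (hb i))
        (le_order_subst_sub ha hb h (g i)) (by omega)
  rw [subst_add hsa, subst_add hsb, subst_mul hsa, subst_mul hsa, subst_mul hsb, subst_mul hsb,
    subst_X hsa, subst_X hsa, subst_X hsb, subst_X hsb, add_sub_add_comm]
  exact le_order_add (key 0) (key 1)

lemma X_pow_dvd_of_le_order {f : MvPowerSeries Unit ℂ} {n : ℕ} (h : (n : ℕ∞) ≤ f.order) :
    X () ^ n ∣ f := by
  rw [X_pow_dvd_iff]
  intro m hm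
  refine coeff_of_lt_order (lt_of_lt_of_le ?_ h)
  rw [Finsupp.degree_eq_sum]
  simpa using hm

lemma le_order_X_pow_mul {σ : Type*} (i : σ) (n : ℕ) (f : MvPowerSeries σ ℂ) :
    (n : ℕ∞) ≤ (X i ^ n * f).order := by
  have h1 : (n : ℕ∞) ≤ (X i ^ n : MvPowerSeries σ ℂ).order := by
    rw [X_pow_eq, order_monomial_of_ne_zero one_ne_zero]
    simp
  rw [order_mul]
  exact h1.trans le_self_add

/-- The formal arc `t ↦ (t, s(t))`. -/
noncomputable def graphArc (s : MvPowerSeries Unit ℂ) : Fin 2 → MvPowerSeries Unit ℂ := ![X (), s]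

lemma graphArc_zero (s : MvPowerSeries Unit ℂ) : graphArc s 0 = X () := rfl

lemma graphArc_one (s : MvPowerSeries Unit ℂ) : graphArc s 1 = s := rfl

lemma constantCoeff_graphArc {s : MvPowerSeries Unit ℂ} (hs : constantCoeff s = 0) (i : Fin 2) :
    constantCoeff (graphArc s i) = 0 := by
  fin_cases i
  · exact constantCoeff_X _
  · exact hs

lemma constantCoeff_of_two_le {σ : Type*} {s : MvPowerSeries σ ℂ} (hs : 2 ≤ s.order) :
    constantCoeff s = 0 :=
  one_le_order_iff_constCoeff_eq_zero.1 (le_trans (by norm_num) hs)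

lemma le_order_graphArc_sub {s s' : MvPowerSeries Unit ℂ} {k : ℕ∞} (h : k ≤ (s - s').order)
    (i : Fin 2) : k ≤ (graphArc s i - graphArc s' i).order := by
  fin_cases i
  · change k ≤ (X () - X () : MvPowerSeries Unit ℂ).order
    simp
  · exact h

variable {Φ : Fin 2 → Series} {d : Fin 2 → ℂ}

/-- The defect of invariance of the graph of `s` under `Φ`. -/
noncomputable def graphDefect (Φ : Fin 2 → Series) (s : MvPowerSeries Unit ℂ) :
    MvPowerSeries Unit ℂ :=
  subst (graphArc s) (Φ 1) - subst (fun _ : Unit => subst (graphArc s) (Φ 0)) s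

lemma subst_graphArc_eq {s : MvPowerSeries Unit ℂ} (hs : constantCoeff s = 0) (i : Fin 2) :
    subst (graphArc s) (Φ i) =
      d i • graphArc s i + subst (graphArc s) (Φ i - d i • X i) := by
  have h := hasSubst_of_constantCoeff_zero (constantCoeff_graphArc hs)
  rw [subst_sub h, subst_smul h, subst_X h, add_sub_cancel]

lemma exists_subst_graphArc_eq (hN : ∀ i, 2 ≤ (Φ i - d i • X i).order)
    {s : MvPowerSeries Unit ℂ} (hs : constantCoeff s = 0) :
    ∃ b, subst (graphArc s) (Φ 0) = X () * b ∧ constantCoeff b = d 0 := by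
  have h1 : ((2 : ℕ) : ℕ∞) ≤ (subst (graphArc s) (Φ 0 - d 0 • X 0)).order :=
    (hN 0).trans (order_le_order_subst (constantCoeff_graphArc hs) _)
  obtain ⟨g, hg⟩ := X_pow_dvd_of_le_order h1
  refine ⟨C (d 0) + X () * g, ?_, by simp⟩
  rw [subst_graphArc_eq (d := d) hs 0, hg, graphArc_zero, smul_eq_C_mul]
  ring

lemma le_order_subst_graphArc_sub (hΦ : ∀ i, constantCoeff (Φ i) = 0)
    {s s' : MvPowerSeries Unit ℂ} (hs : constantCoeff s = 0) (hs' : constantCoeff s' = 0)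
    {k : ℕ} (h : (k : ℕ∞) ≤ (s - s').order) : (k : ℕ∞) ≤ (graphDefect Φ s - graphDefect Φ s').order := by
  have hc := constantCoeff_graphArc hs
  have hc' := constantCoeff_graphArc hs'
  have h1 := fun i => le_order_subst_sub hc hc' (le_order_graphArc_sub h) (Φ i)
  have hX : constantCoeff (subst (graphArc s) (Φ 0)) = 0 := by
    rw [constantCoeff_subst_of_zero hc, hΦ]
  have hX' : constantCoeff (subst (graphArc s') (Φ 0)) = 0 := by
    rw [constantCoeff_subst_of_zero hc', hΦ]
  rw [graphDefect, graphDefect, sub_sub_sub_comm]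
  refine le_order_sub (h1 1) ?_
  rw [← sub_add_sub_cancel _ (subst (fun _ : Unit => subst (graphArc s) (Φ 0)) s')]
  refine le_order_add ?_ (le_order_subst_sub (fun _ => hX) (fun _ => hX') (fun _ => h1 0) s')
  rw [← subst_sub (hasSubst_of_constantCoeff_zero fun _ => hX)]
  exact h.trans (order_le_order_subst (fun _ => hX) _)

/-- The linearized invariance equation. A perturbation `c t ^ k` enters the second component with
factor `d 1`, and the composite with the first component `d 0 t + ⋯` with factor `d 0 ^ k`. All
other changes come from terms of order two and have degree above `k`. -/
lemma le_order_graphDefect_add (hΦ : ∀ i, constantCoeff (Φ i) = 0)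
    (hN : ∀ i, 2 ≤ (Φ i - d i • X i).order) {s : MvPowerSeries Unit ℂ} (hs : constantCoeff s = 0)
    {k : ℕ} (hk : 1 ≤ k) (c : ℂ) : ((k + 1 : ℕ) : ℕ∞) ≤ (graphDefect Φ (s + c • X () ^ k) -
      graphDefect Φ s - (c * (d 1 - d 0 ^ k)) • X () ^ k).order := by
  set h : MvPowerSeries Unit ℂ := c • X () ^ k with hh
  have hhk : (k : ℕ∞) ≤ h.order := by
    have := le_order_X_pow_mul () k (1 : MvPowerSeries Unit ℂ)
    rw [mul_one] at this
    exact le_order_smul' c this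
  have hh0 : constantCoeff h = 0 :=
    one_le_order_iff_constCoeff_eq_zero.1 (le_trans (by exact_mod_cast hk) hhk)
  have hsh : constantCoeff (s + h) = 0 := by rw [map_add, hs, hh0, add_zero]
  have hc := constantCoeff_graphArc hs
  have hc' := constantCoeff_graphArc hsh
  have hsub : (k : ℕ∞) ≤ (s + h - s).order := by rwa [add_sub_cancel_left]
  have h1 := fun i => le_order_subst_sub_succ hc' hc (le_order_graphArc_sub hsub) (hN i)
  have hX : constantCoeff (subst (graphArc s) (Φ 0)) = 0 := by
    rw [constantCoeff_subst_of_zero hc, hΦ]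
  have hX' : constantCoeff (subst (graphArc (s + h)) (Φ 0)) = 0 := by
    rw [constantCoeff_subst_of_zero hc', hΦ]
  have h2 : ((k + 1 : ℕ) : ℕ∞) ≤
      (subst (graphArc (s + h)) (Φ 0) - subst (graphArc s) (Φ 0)).order := by
    rw [subst_graphArc_eq (d := d) hsh, subst_graphArc_eq (d := d) hs, graphArc_zero,
      graphArc_zero, add_sub_add_left_eq_sub]
    exact h1 0
  obtain ⟨b, hb, hb0⟩ := exists_subst_graphArc_eq hN hsh
  have h3 := le_order_subst_sub (fun _ => hX') (fun _ => hX) (fun _ : Unit => h2) s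
  have h4 : subst (fun _ : Unit => subst (graphArc (s + h)) (Φ 0)) h =
      (c * d 0 ^ k) • X () ^ k + c • (X () ^ k * (b ^ k - C (d 0 ^ k))) := by
    have hsX := hasSubst_of_constantCoeff_zero (fun _ : Unit => hX')
    rw [hh, subst_smul hsX, subst_pow hsX, subst_X hsX, hb]
    simp only [smul_eq_C_mul, map_mul, mul_pow]
    ring
  have h5 : ((k + 1 : ℕ) : ℕ∞) ≤ (X () ^ k * (b ^ k - C (d 0 ^ k))).order := by
    have := le_order_X_pow_mul () k (1 : MvPowerSeries Unit ℂ)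
    rw [mul_one] at this
    refine le_order_mul_of_add this (n := 1) ?_ le_rfl
    refine one_le_order_iff_constCoeff_eq_zero.2 ?_
    simp [hb0]
  have h6 : graphDefect Φ (s + h) - graphDefect Φ s - (c * (d 1 - d 0 ^ k)) • X () ^ k =
      (subst (graphArc (s + h)) (Φ 1 - d 1 • X 1) - subst (graphArc s) (Φ 1 - d 1 • X 1)) -
      (subst (fun _ : Unit => subst (graphArc (s + h)) (Φ 0)) s -
        subst (fun _ : Unit => subst (graphArc s) (Φ 0)) s) -
      c • (X () ^ k * (b ^ k - C (d 0 ^ k))) := by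
    rw [graphDefect, graphDefect, subst_graphArc_eq (d := d) hsh 1,
      subst_graphArc_eq (d := d) hs 1, graphArc_one, graphArc_one,
      subst_add (hasSubst_of_constantCoeff_zero fun _ => hX'), h4, hh]
    simp only [smul_eq_C_mul, map_mul, map_sub]
    ring
  rw [h6]
  exact le_order_sub (le_order_sub (h1 1) h3) (le_order_smul' c h5)

lemma le_order_succ_of_coeff_unit {f : MvPowerSeries Unit ℂ} {k : ℕ} (h : (k : ℕ∞) ≤ f.order)
    (h' : coeff (Finsupp.single () k) f = 0) : ((k + 1 : ℕ) : ℕ∞) ≤ f.order := by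
  refine le_order fun m hm => ?_
  have hm' : m.degree < k + 1 := by exact_mod_cast hm
  rcases Nat.lt_succ_iff_lt_or_eq.1 hm' with h1 | h1
  · exact coeff_of_lt_order (lt_of_lt_of_le (by exact_mod_cast h1) h)
  · have h2 : m = Finsupp.single () k := by
      ext
      rw [Finsupp.degree_eq_sum] at h1
      simpa using h1
    rw [h2, h']

/-- Existence of a formal invariant graph tangent to the first axis. -/
lemma exists_graphDefect_eq_zero (hΦ : ∀ i, constantCoeff (Φ i) = 0)
    (hN : ∀ i, 2 ≤ (Φ i - d i • X i).order) (hd : ∀ k ≥ 2, d 1 ≠ d 0 ^ k) :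
    ∃ s : MvPowerSeries Unit ℂ, 2 ≤ s.order ∧ graphDefect Φ s = 0 := by
  have h00 : constantCoeff (0 : MvPowerSeries Unit ℂ) = 0 := map_zero _
  have key : ∃ s : MvPowerSeries Unit ℂ, ((2 : ℕ) : ℕ∞) ≤ (s - 0).order ∧
      graphDefect Φ s = 0 := by
    refine exists_eq_zero_of_newton ?_ ?_ ?_
    · have h1 : graphDefect Φ 0 = subst (graphArc 0) (Φ 1 - d 1 • X 1) := by
        rw [graphDefect, subst_graphArc_eq (d := d) h00 1, graphArc_one, smul_zero, zero_add,
          ← coe_substAlgHom (hasSubst_of_constantCoeff_zero (a := fun _ : Unit =>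
            subst (graphArc 0) (Φ 0)) (fun _ => by
              rw [constantCoeff_subst_of_zero (constantCoeff_graphArc h00), hΦ])), map_zero,
          sub_zero]
      rw [h1]
      exact (hN 1).trans (order_le_order_subst (constantCoeff_graphArc h00) _)
    · intro k s s' hs hs' h
      rw [sub_zero] at hs hs'
      exact le_order_subst_graphArc_sub hΦ (constantCoeff_of_two_le hs)
        (constantCoeff_of_two_le hs') h
    · intro k hk s hs hE
      rw [sub_zero] at hs
      set e := coeff (Finsupp.single () k) (graphDefect Φ s) with he
      -- Cancels the coefficient of degree `k` of the defect; non-resonance makes the denominator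
      -- non-zero.
      set c := -e / (d 1 - d 0 ^ k) with hc
      refine ⟨c • X () ^ k, ?_, ?_⟩
      · have := le_order_X_pow_mul () k (1 : MvPowerSeries Unit ℂ)
        rw [mul_one] at this
        exact le_order_smul' c this
      · have h1 := le_order_graphDefect_add hΦ hN (constantCoeff_of_two_le hs) (k := k) (by omega) c
        have h2 : c * (d 1 - d 0 ^ k) = -e := div_mul_cancel₀ _ (sub_ne_zero.2 (hd k hk))
        rw [h2, sub_sub] at h1
        rw [← sub_add_cancel (graphDefect Φ (s + c • X () ^ k))
          (graphDefect Φ s + -e • X () ^ k)]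
        refine le_order_add h1 (le_order_succ_of_coeff_unit (le_order_add hE ?_) ?_)
        · have := le_order_X_pow_mul () k (1 : MvPowerSeries Unit ℂ)
          rw [mul_one] at this
          exact le_order_smul' _ this
        · rw [map_add, ← he, map_smul, X_pow_eq, coeff_monomial_same]
          simp
  obtain ⟨s, hs, hs'⟩ := key
  rw [sub_zero] at hs
  exact ⟨s, hs, hs'⟩

end Saddle

/-! ### Convergence of the invariant graph -/

section SaddleConvergence

variable {σ : Type*}

lemma Convergent.exists_majorant_le_mul {f : MvPowerSeries σ ℂ} (hf : Convergent f)
    (h2 : 2 ≤ f.order) {ε : ℝ≥0∞} (hε : ε ≠ 0) :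
    ∃ r₀ : ℝ≥0∞, 0 < r₀ ∧ r₀ ≠ ⊤ ∧ ∀ r ≤ r₀, majorant r f ≤ ε * r := by
  obtain ⟨r₀, C, h0, h1, hC, h⟩ := exists_majorant_le_of_order hf (N := 2) h2
  refine ⟨min r₀ (ε / C), lt_min h0 (ENNReal.div_pos hε hC), ?_, fun r hr => ?_⟩
  · exact ne_top_of_le_ne_top h1 (min_le_left _ _)
  · refine (h r (hr.trans (min_le_left _ _))).trans ?_
    rw [pow_two, ← mul_assoc]
    gcongr
    calc C * r ≤ C * (ε / C) := by gcongr; exact hr.trans (min_le_right _ _)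
      _ ≤ ε := ENNReal.mul_div_le

lemma exists_radius {Φ : Fin 2 → Series} (hΦ : ∀ i, Convergent (Φ i))
    (h2 : ∀ i, 2 ≤ (Φ i).order) {ε : ℝ≥0∞} (hε : ε ≠ 0) :
    ∃ r₀ : ℝ≥0∞, 0 < r₀ ∧ r₀ ≠ ⊤ ∧ ∀ r ≤ r₀, ∀ i, majorant r (Φ i) ≤ ε * r := by
  obtain ⟨r₀, h0, h0', h⟩ := (hΦ 0).exists_majorant_le_mul (h2 0) hε
  obtain ⟨r₁, h1, h1', h'⟩ := (hΦ 1).exists_majorant_le_mul (h2 1) hε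
  refine ⟨min r₀ r₁, lt_min h0 h1, ne_top_of_le_ne_top h0' (min_le_left _ _), fun r hr => ?_⟩
  rw [Fin.forall_fin_two]
  exact ⟨h r (hr.trans (min_le_left _ _)), h' r (hr.trans (min_le_right _ _))⟩

lemma convergent_smul_X {d : ℂ} (i : Fin 2) : Convergent (d • X i : Series) :=
  (convergent_X i).smul d

variable {Φ : Fin 2 → Series} {d : Fin 2 → ℂ}

/-- The non-linear terms have order at least two, so up to degree `k` they see only the part of `s`
of degree below `k`. The new truncation remains on the right only inside a composite, which is a
contraction. -/
lemma smul_truncSeries_eq_of_graphDefect (hΦ : ∀ i, constantCoeff (Φ i) = 0)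
    (hN : ∀ i, 2 ≤ (Φ i - d i • X i).order) {s : MvPowerSeries Unit ℂ} (hs : constantCoeff s = 0)
    (h : graphDefect Φ s = 0) (k : ℕ) (hk : constantCoeff (truncSeries k s) = 0) :
    d 1 • truncSeries (k + 1) s =
      truncSeries (k + 1) (subst (fun _ : Unit => subst (graphArc (truncSeries k s)) (Φ 0))
        (truncSeries (k + 1) s)) -
      truncSeries (k + 1) (subst (graphArc (truncSeries k s)) (Φ 1 - d 1 • X 1)) := by
  have hc := constantCoeff_graphArc hs
  have hc' := constantCoeff_graphArc hk
  have hX : constantCoeff (subst (graphArc s) (Φ 0)) = 0 := by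
    rw [constantCoeff_subst_of_zero hc, hΦ]
  have hX' : constantCoeff (subst (graphArc (truncSeries k s)) (Φ 0)) = 0 := by
    rw [constantCoeff_subst_of_zero hc', hΦ]
  have hsub := fun i => le_order_subst_sub_succ hc hc'
    (le_order_graphArc_sub (le_order_sub_truncSeries k s)) (hN i)
  have hXX : ((k + 1 : ℕ) : ℕ∞) ≤
      (subst (graphArc s) (Φ 0) - subst (graphArc (truncSeries k s)) (Φ 0)).order := by
    rw [subst_graphArc_eq (d := d) hs, subst_graphArc_eq (d := d) hk, graphArc_zero,
      graphArc_zero, add_sub_add_left_eq_sub]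
    exact hsub 0
  have h1 : d 1 • s = subst (fun _ : Unit => subst (graphArc s) (Φ 0)) s -
      subst (graphArc s) (Φ 1 - d 1 • X 1) := by
    rw [← sub_eq_zero.1 h, subst_graphArc_eq (d := d) hs 1, graphArc_one, add_sub_cancel_right]
  rw [← truncSeries_smul, h1, truncSeries_sub, truncSeries_eq_iff.2 (hsub 1)]
  congr 1
  rw [truncSeries_eq_iff, ← sub_add_sub_cancel _
    (subst (fun _ : Unit => subst (graphArc s) (Φ 0)) (truncSeries (k + 1) s))]
  refine le_order_add ?_ (le_order_subst_sub (fun _ => hX) (fun _ => hX') (fun _ => hXX) _)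
  rw [← subst_sub (hasSubst_of_constantCoeff_zero fun _ => hX)]
  exact (le_order_sub_truncSeries (k + 1) s).trans (order_le_order_subst (fun _ => hX) _)

/-- The bound `r` for the truncations propagates by induction. The first component along the
truncated graph has majorant at most `κ r`, so composition with it costs a factor `κ ^ 2` on series
of order two. Since `|d 1| ≥ 1`, the majorant `S` of the next truncation satisfies `S ≤ κ ^ 2 S + (1
- κ ^ 2) r`, whence `S ≤ r`. -/
lemma convergent_of_graphDefect_eq_zero (hΦ : ∀ i, constantCoeff (Φ i) = 0)
    (hΦ' : ∀ i, Convergent (Φ i)) (hN : ∀ i, 2 ≤ (Φ i - d i • X i).order) (h0 : ‖d 0‖ < 1)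
    (h1 : 1 ≤ ‖d 1‖) {s : MvPowerSeries Unit ℂ} (hs : 2 ≤ s.order) (h : graphDefect Φ s = 0) :
    Convergent s := by
  have h0' : ‖d 0‖ₑ < 1 := by
    rw [← ofReal_norm, ENNReal.ofReal_lt_one]; exact h0
  have h1' : 1 ≤ ‖d 1‖ₑ := by
    rw [← ofReal_norm, ENNReal.one_le_ofReal]; exact h1
  obtain ⟨κ, hκ0, hκ1⟩ := exists_between h0'
  have hκ2 : κ ^ 2 < 1 := pow_lt_one₀ zero_le hκ1 two_ne_zero
  obtain ⟨r, hr0, hr1, hr⟩ := exists_radius (fun i => (hΦ' i).sub (convergent_smul_X (d := d i) i)) hN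
    -- The first bound keeps the first component within `κ r`, the second keeps the non-linear part
    -- of the second component within `(1 - κ ^ 2) r`.
    (ε := min (κ - ‖d 0‖ₑ) (1 - κ ^ 2))
    (lt_min (tsub_pos_of_lt hκ0) (tsub_pos_of_lt hκ2)).ne'
  replace hr := hr r le_rfl
  have key : ∀ k, majorant r (truncSeries k s) ≤ r := by
    intro k
    induction k with
    | zero =>
      have : truncSeries 0 s = 0 := by
        refine MvPowerSeries.ext fun e => ?_
        simp [coeff_truncSeries]
      rw [this]
      simp [majorant]
    | succ k ih =>
      have hk : constantCoeff (truncSeries k s) = 0 :=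
        constantCoeff_of_two_le (le_order_truncSeries hs k)
      have hc := constantCoeff_graphArc hk
      have hsub := hasSubst_of_constantCoeff_zero hc
      have hX : constantCoeff (subst (graphArc (truncSeries k s)) (Φ 0)) = 0 := by
        rw [constantCoeff_subst_of_zero hc, hΦ]
      have hγ : ∀ i, majorant r (graphArc (truncSeries k s) i) ≤ r :=
        Fin.forall_fin_two.2 ⟨(majorant_X _ _).le, ih⟩
      have hNr := fun i => (majorant_subst_le hsub hγ (Φ i - d i • X i)).trans (hr i)
      have hXr : majorant r (subst (graphArc (truncSeries k s)) (Φ 0)) ≤ κ * r := by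
        rw [subst_graphArc_eq (d := d) hk, graphArc_zero]
        refine (majorant_add_le _ _ _).trans ?_
        rw [majorant_smul, majorant_X]
        refine (add_le_add_right (hNr 0) _).trans ?_
        rw [← add_mul]
        gcongr
        refine (add_le_add_right (min_le_left _ _) _).trans ?_
        rw [add_tsub_cancel_of_le hκ0.le]
      set S := majorant r (truncSeries (k + 1) s) with hS
      have hStop : S ≠ ⊤ := majorant_truncSeries_ne_top hr1 _ _
      have h2 : S ≤ κ ^ 2 * S + (1 - κ ^ 2) * r := by
        calc S ≤ ‖d 1‖ₑ * S := le_mul_of_one_le_left' h1'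
          _ = majorant r (d 1 • truncSeries (k + 1) s) := (majorant_smul _ _ _).symm
          _ ≤ _ := by
            rw [smul_truncSeries_eq_of_graphDefect hΦ hN (constantCoeff_of_two_le hs) h k hk]
            refine (majorant_sub_le _ _ _).trans (add_le_add ?_ ?_)
            · refine (majorant_truncSeries_le _ _ _).trans ?_
              refine (majorant_subst_le (hasSubst_of_constantCoeff_zero fun _ => hX)
                (fun _ => hXr) _).trans ?_
              exact majorant_mul_radius_le hκ1.le r (le_order_truncSeries hs _)
            · refine (majorant_truncSeries_le _ _ _).trans ((hNr 1).trans ?_)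
              gcongr
              exact min_le_right _ _
      have h3 : (1 - κ ^ 2) * S ≤ (1 - κ ^ 2) * r := by
        rw [ENNReal.sub_mul fun _ _ => hStop, one_mul]
        exact tsub_le_iff_left.2 h2
      exact (ENNReal.mul_le_mul_iff_right (tsub_pos_of_lt hκ2).ne'
        (ENNReal.sub_ne_top ENNReal.one_ne_top)).1 h3
  exact ⟨r, hr0, ne_top_of_le_ne_top hr1 (majorant_le_of_truncSeries key)⟩

end SaddleConvergence

/-! ### Division by the equation of a graph -/

section Division

lemma coeff_subst_axis (f : Series) (n : ℕ) :
    coeff (Finsupp.single () n) (subst ![(X () : MvPowerSeries Unit ℂ), 0] f) =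
      coeff (Finsupp.single 0 n) f := by
  have h0 : ∀ i, constantCoeff (![(X () : MvPowerSeries Unit ℂ), 0] i) = 0 :=
    Fin.forall_fin_two.2 ⟨constantCoeff_X _, map_zero _⟩
  rw [coeff_subst (hasSubst_of_constantCoeff_zero h0), finsum_eq_single _ (Finsupp.single 0 n)]
  · rw [Finsupp.prod_single_index (by simp)]
    change coeff (Finsupp.single 0 n) f • coeff _ ((X () : MvPowerSeries Unit ℂ) ^ n) = _
    rw [X_pow_eq, coeff_monomial_same, smul_eq_mul, mul_one]
  · intro d hd
    rw [Finsupp.prod_fintype _ _ (by simp), Fin.prod_univ_two]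
    change _ • coeff _ ((X () : MvPowerSeries Unit ℂ) ^ d 0 * 0 ^ d 1) = 0
    by_cases h1 : d 1 = 0
    · have h2 : n ≠ d 0 := by
        rintro rfl
        apply hd
        ext i
        fin_cases i
        · simp
        · simpa using h1
      rw [h1, pow_zero, mul_one, coeff_X_pow, if_neg, smul_zero]
      exact fun h => h2 (Finsupp.single_injective () |>.eq_iff.1 h |> id)
    · rw [zero_pow h1, mul_zero, map_zero, smul_zero]

lemma X_one_dvd_of_subst_axis {f : Series} (h : subst ![(X () : MvPowerSeries Unit ℂ), 0] f = 0) :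
    X 1 ∣ f := by
  by_contra h1
  obtain ⟨n, hn⟩ := exists_coeff_axis_ne_zero (j := 1) h1
  apply hn
  have := coeff_subst_axis f n
  rw [h, map_zero] at this
  exact this.symm

/-- The equation `y - s(x)` of the graph of `s`. -/
noncomputable def graphSeries (s : MvPowerSeries Unit ℂ) : Series :=
  X 1 - subst (fun _ : Unit => (X 0 : Series)) s

variable {s : MvPowerSeries Unit ℂ}

lemma constantCoeff_X_zero (_ : Unit) : constantCoeff (X 0 : Series) = 0 := constantCoeff_X _

lemma constantCoeff_graphSeries (hs : constantCoeff s = 0) : constantCoeff (graphSeries s) = 0 := by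
  rw [graphSeries, map_sub, constantCoeff_subst_of_zero constantCoeff_X_zero, hs, constantCoeff_X,
    sub_zero]

lemma convergent_subst_X_zero (hs : Convergent s) :
    Convergent (subst (fun _ : Unit => (X 0 : Series)) s) :=
  hs.subst (fun _ => convergent_X 0) constantCoeff_X_zero

lemma subst_subst_X_zero {τ : Type*} {a : Fin 2 → MvPowerSeries τ ℂ}
    (ha : ∀ i, constantCoeff (a i) = 0) (s : MvPowerSeries Unit ℂ) :
    subst a (subst (fun _ : Unit => (X 0 : Series)) s) = subst (fun _ : Unit => a 0) s := by
  have h := hasSubst_of_constantCoeff_zero ha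
  rw [subst_comp_subst_apply (hasSubst_of_constantCoeff_zero constantCoeff_X_zero) h]
  simp only [subst_X h]

lemma subst_graphSeries {τ : Type*} {a : Fin 2 → MvPowerSeries τ ℂ}
    (ha : ∀ i, constantCoeff (a i) = 0) (s : MvPowerSeries Unit ℂ) :
    subst a (graphSeries s) = a 1 - subst (fun _ : Unit => a 0) s := by
  have h := hasSubst_of_constantCoeff_zero ha
  rw [graphSeries, subst_sub h, subst_X h, subst_subst_X_zero ha]

/-- A series that vanishes on a graph is divisible by the equation of the graph. -/
lemma exists_eq_graphSeries_mul (hs : constantCoeff s = 0) {f : Series}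
    (hf : subst (graphArc s) f = 0) :
    ∃ q, f = graphSeries s * q ∧ (Convergent f → Convergent s → Convergent q) := by
  set S : Series := subst (fun _ : Unit => (X 0 : Series)) s with hS
  have hS0 : constantCoeff S = 0 := by
    rw [hS, constantCoeff_subst_of_zero constantCoeff_X_zero, hs]
  have hp : ∀ i, constantCoeff (![X 0, X 1 + S] i) = 0 :=
    Fin.forall_fin_two.2 ⟨constantCoeff_X _, by simp [hS0]⟩
  have hm : ∀ i, constantCoeff (![X 0, X 1 - S] i) = 0 :=
    Fin.forall_fin_two.2 ⟨constantCoeff_X _, by simp [hS0]⟩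
  have hax : ∀ i, constantCoeff (![(X () : MvPowerSeries Unit ℂ), 0] i) = 0 :=
    Fin.forall_fin_two.2 ⟨constantCoeff_X _, map_zero _⟩
  have hp' := hasSubst_of_constantCoeff_zero hp
  have hm' := hasSubst_of_constantCoeff_zero hm
  have hax' := hasSubst_of_constantCoeff_zero hax
  -- The shear `(x, y) ↦ (x, y + s(x))` carries the first axis to the graph, so the claim becomes
  -- divisibility by `X 1`; the inverse shear brings the quotient back.
  obtain ⟨q, hq⟩ : X 1 ∣ subst ![X 0, X 1 + S] f := by
    refine X_one_dvd_of_subst_axis ?_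
    rw [subst_comp_subst_apply hp' hax']
    refine Eq.trans ?_ hf
    congr 1
    ext1 i
    fin_cases i
    · change subst _ (X 0) = X ()
      rw [subst_X hax', Matrix.cons_val_zero]
    · change subst _ (X 1 + S) = s
      rw [subst_add hax', subst_X hax', hS, subst_subst_X_zero hax]
      simp only [Matrix.cons_val_zero, Matrix.cons_val_one, zero_add]
      exact congrFun subst_self s
  refine ⟨subst ![X 0, X 1 - S] q, ?_, fun hf' hs' => ?_⟩
  · have h1 : subst ![X 0, X 1 - S] (subst ![X 0, X 1 + S] f) = f := by
      rw [subst_comp_subst_apply hp' hm']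
      have h2 : (fun i => subst ![X 0, X 1 - S] ((![X 0, X 1 + S] : Fin 2 → Series) i)) = X := by
        ext1 i
        fin_cases i
        · change subst _ (X 0) = X 0
          rw [subst_X hm', Matrix.cons_val_zero]
        · change subst _ (X 1 + S) = X 1
          rw [subst_add hm', subst_X hm', hS, subst_subst_X_zero hm]
          simp only [Matrix.cons_val_zero, Matrix.cons_val_one]
          rw [← hS, sub_add_cancel]
      rw [h2, subst_self, id]
    rw [← h1, hq, subst_mul hm', subst_X hm']
    rfl
  · have hSc := convergent_subst_X_zero hs'
    have hpc : ∀ i, Convergent ((![X 0, X 1 + S] : Fin 2 → Series) i) :=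
      Fin.forall_fin_two.2 ⟨convergent_X 0, (convergent_X 1).add hSc⟩
    have hmc : ∀ i, Convergent ((![X 0, X 1 - S] : Fin 2 → Series) i) :=
      Fin.forall_fin_two.2 ⟨convergent_X 0, (convergent_X 1).sub hSc⟩
    have h1 : Convergent (X 1 * q) := hq ▸ hf'.subst hpc hp
    exact h1.of_X_mul.subst hmc hm

end Division

/-! ### Diagonal linear part: the curve is the invariant graph -/

section Diagonal

variable {Φ : Fin 2 → Series} {d : Fin 2 → ℂ}

lemma form_one_smul_X (c : ℂ) (i : Fin 2) (v : Plane) : form 1 (c • X i) v = c * v i := by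
  classical
  rw [form_one]
  fin_cases i <;> simp [coeff_X, Finsupp.single_left_inj]

lemma two_le_order_sub_of_diagonal (hΦ : ∀ i, constantCoeff (Φ i) = 0)
    (hA : ∀ v i, linearPart Φ v i = d i * v i) (i : Fin 2) :
    2 ≤ (Φ i - d i • X i).order := by
  refine le_order_succ_of_form (k := 1) ?_ fun v => ?_
  · refine one_le_order_iff_constCoeff_eq_zero.2 ?_
    simp [hΦ]
  · rw [form_sub, form_one_smul_X, ← hA, linearPart, sub_self]

/-- Monomials are eigenvectors of composition with a diagonal map, so `u(0)` is the eigenvalue of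
every monomial in the initial form. Vanishing at `(1, 0)` excludes the pure power of the first
coordinate, hence the strict inequality `k < ν` for the order `ν` of `f`. -/
lemma exists_eigenvalue_eq (hΦ : ∀ i, constantCoeff (Φ i) = 0)
    (hA : ∀ v i, linearPart Φ v i = d i * v i) {f u : Series} (hf : f ≠ 0)
    (hu : subst Φ f = u * f) (hT : form f.order.toNat f ![1, 0] = 0) :
    ∃ k < f.order.toNat, constantCoeff u = d 0 ^ k * d 1 ^ (f.order.toNat - k) := by
  set ν := f.order.toNat
  set a : ℕ → ℂ := fun k => coeff (Finsupp.single 0 k + Finsupp.single 1 (ν - k)) f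
  have h1 : ∀ k ≤ ν, a k * (d 0 ^ k * d 1 ^ (ν - k) - constantCoeff u) = 0 := by
    refine coeff_eq_zero_of_forall_sum_pow fun x => ?_
    have := form_linearPart hΦ hu (order_eq_toNat hf).le ![x, 1]
    rw [← sub_eq_zero, form, form, Finset.mul_sum, ← Finset.sum_sub_distrib] at this
    rw [← this]
    refine Finset.sum_congr rfl fun k _ => ?_
    simp only [hA, a, Matrix.cons_val_zero, Matrix.cons_val_one, one_pow, mul_one]
    ring
  by_contra! hc
  obtain ⟨v, hv⟩ := exists_form_ne_zero hf
  apply hv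
  refine Finset.sum_eq_zero fun k hk => ?_
  have hk' : k ≤ ν := Nat.lt_succ_iff.1 (Finset.mem_range.1 hk)
  have h2 : a k = 0 := by
    rcases hk'.lt_or_eq with h | rfl
    · exact (mul_eq_zero.1 (h1 k hk')).resolve_right (sub_ne_zero.2 (hc k h).symm)
    · rw [form, Finset.sum_range_succ, Finset.sum_eq_zero] at hT
      · simpa [a] using hT
      · intro i hi
        have : ν - i ≠ 0 := by have := Finset.mem_range.1 hi; omega
        simp [this]
  change a k * _ * _ = 0
  rw [h2, zero_mul, zero_mul]

/-- A semi-invariant series vanishes on an invariant graph which is tangent to it. -/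
lemma subst_graphArc_eq_zero (hΦ : ∀ i, constantCoeff (Φ i) = 0)
    (hA : ∀ v i, linearPart Φ v i = d i * v i) (h00 : d 0 ≠ 0) (h0 : ‖d 0‖ < 1)
    (h1 : 1 ≤ ‖d 1‖) (hs : constantCoeff s = 0) (h : graphDefect Φ s = 0) {f u : Series}
    (hf : f ≠ 0) (hu : subst Φ f = u * f) (hT : form f.order.toNat f ![1, 0] = 0) :
    subst (graphArc s) f = 0 := by
  by_contra hθ
  have hc := constantCoeff_graphArc hs
  have hc' := hasSubst_of_constantCoeff_zero hc
  have hX : constantCoeff (subst (graphArc s) (Φ 0)) = 0 := by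
    rw [constantCoeff_subst_of_zero hc, hΦ]
  have hX' := hasSubst_of_constantCoeff_zero fun _ : Unit => hX
  set θ := subst (graphArc s) f with hθ'
  -- Restriction of `f ∘ Φ = u f` to the invariant graph, on which `Φ` acts through its first
  -- component. If `θ ≠ 0`, leading coefficients give `u(0) = d 0 ^ ord θ`.
  have key : subst (fun _ : Unit => subst (graphArc s) (Φ 0)) θ = subst (graphArc s) u * θ := by
    rw [hθ', ← subst_mul hc', ← hu, subst_comp_subst_apply hc' hX',
      subst_comp_subst_apply (hasSubst_of_constantCoeff_zero hΦ) hc']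
    congr 1
    ext1 i
    fin_cases i
    · exact subst_X hX' ()
    · exact (sub_eq_zero.1 h).symm
  obtain ⟨b, hb, hb0⟩ := exists_subst_graphArc_eq (two_le_order_sub_of_diagonal hΦ hA) hs
  have ha : ((θ.order.toNat : ℕ) : ℕ∞) = θ.order := ne_zero_iff_order_finite.1 hθ
  obtain ⟨η, hη⟩ := X_pow_dvd_of_le_order ha.le
  have hη0 : constantCoeff η ≠ 0 := by
    intro h2
    have h3 : ((θ.order.toNat + 1 : ℕ) : ℕ∞) ≤ θ.order := by
      conv_rhs => rw [hη]
      exact le_order_mul_of_add (by simpa using le_order_X_pow_mul () θ.order.toNat 1)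
        (n := 1) (one_le_order_iff_constCoeff_eq_zero.2 h2) le_rfl
    rw [← ha] at h3
    have : θ.order.toNat + 1 ≤ θ.order.toNat := by exact_mod_cast h3
    omega
  have h2 : constantCoeff u = d 0 ^ θ.order.toNat := by
    rw [hη, subst_mul hX', subst_pow hX', subst_X hX', hb, mul_pow, mul_left_comm, mul_assoc] at key
    have h3 := congrArg constantCoeff (mul_left_cancel₀ (pow_ne_zero _ (X_ne_zero' ())) key)
    rw [← hb, map_mul, map_mul, map_pow, constantCoeff_subst_of_zero (fun _ => hX),
      constantCoeff_subst_of_zero hc, hb0] at h3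
    exact (mul_right_cancel₀ hη0 h3).symm
  obtain ⟨k, hk, hk'⟩ := exists_eigenvalue_eq hΦ hA hf hu hT
  have h3 : f.order.toNat ≤ θ.order.toNat := by
    have := order_le_order_subst hc f
    rw [← hθ', ← ha, ← order_eq_toNat hf] at this
    exact_mod_cast this
  -- The contradiction: `k` is less than the order of `f`, hence less than that of `θ`, whereas
  -- `|u(0)| ≥ |d 0| ^ k` because `|d 1| ≥ 1`.
  have h4 : ‖d 0‖ ^ θ.order.toNat < ‖d 0‖ ^ k :=
    pow_lt_pow_right_of_lt_one₀ (norm_pos_iff.2 h00) h0 (by omega)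
  have h5 : ‖d 0‖ ^ k ≤ ‖constantCoeff u‖ := by
    rw [hk', norm_mul, norm_pow, norm_pow]
    exact le_mul_of_one_le_right (by positivity) (one_le_pow₀ h1)
  rw [h2, norm_pow] at h5
  exact absurd h4 (not_lt.2 h5)

lemma form_one_graphSeries (hs : 2 ≤ s.order) (v : Plane) : form 1 (graphSeries s) v = v 1 := by
  have h1 := hs.trans (order_le_order_subst constantCoeff_X_zero s)
  have h2 : ∀ j : Fin 2, coeff (Finsupp.single j 1)
      (subst (fun _ : Unit => (X 0 : Series)) s) = 0 := fun j =>
    coeff_of_lt_order (lt_of_lt_of_le (by simp) h1)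
  rw [graphSeries, form_sub, ← one_smul ℂ (X 1), form_one_smul_X, one_mul, form_one, h2, h2]
  ring

lemma exists_subst_graphSeries_eq (hΦ : ∀ i, constantCoeff (Φ i) = 0)
    (hA : ∀ v i, linearPart Φ v i = d i * v i) (hs : 2 ≤ s.order) (h : graphDefect Φ s = 0) :
    ∃ u, subst Φ (graphSeries s) = u * graphSeries s ∧ constantCoeff u = d 1 ∧
      ((∀ i, Convergent (Φ i)) → Convergent s → Convergent u) := by
  have hs0 := constantCoeff_of_two_le hs
  have hc := constantCoeff_graphArc hs0
  have h1 : subst (graphArc s) (subst Φ (graphSeries s)) = 0 := by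
    have h0 : ∀ i, constantCoeff (subst (graphArc s) (Φ i)) = 0 := fun i => by
      rw [constantCoeff_subst_of_zero hc, hΦ]
    rw [subst_comp_subst_apply (hasSubst_of_constantCoeff_zero hΦ)
      (hasSubst_of_constantCoeff_zero hc), subst_graphSeries h0]
    exact h
  obtain ⟨u, hu, hu'⟩ := exists_eq_graphSeries_mul hs0 h1
  rw [mul_comm] at hu
  refine ⟨u, hu, ?_, fun hΦc hsc => ?_⟩
  · have h2 := form_one_graphSeries hs
    have h3 := form_linearPart hΦ hu (k := 1)
      (one_le_order_iff_constCoeff_eq_zero.2 (constantCoeff_graphSeries hs0)) ![0, 1]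
    rw [h2, h2, hA] at h3
    simpa using h3.symm
  · refine hu' ?_ hsc
    exact ((convergent_X 1).sub (convergent_subst_X_zero hsc)).subst hΦc hΦ

end Diagonal

/-! ### Comparison of a series with its linear part -/

section Linearization

/-- The linear part of a series. -/
noncomputable def linearSeries (φ : Series) : Series :=
  coeff (Finsupp.single 0 1) φ • X 0 + coeff (Finsupp.single 1 1) φ • X 1

lemma form_one_linearSeries (φ : Series) (v : Plane) : form 1 (linearSeries φ) v = form 1 φ v := by
  have h : ∀ f g : Series, form 1 (f + g) v = form 1 f v + form 1 g v := fun f g => by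
    simp only [form_one, map_add]
    ring
  rw [linearSeries, h, form_one_smul_X, form_one_smul_X, form_one]

lemma constantCoeff_linearSeries (φ : Series) : constantCoeff (linearSeries φ) = 0 := by
  simp [linearSeries]

lemma convergent_linearSeries (φ : Series) : Convergent (linearSeries φ) :=
  (convergent_smul_X 0).add (convergent_smul_X 1)

lemma ev_linearSeries (φ : Series) (z : Plane) : ev (linearSeries φ) z = form 1 φ z := by
  have hz : ∀ i, ‖z i‖ₑ ≤ ‖z 0‖ₑ + ‖z 1‖ₑ := Fin.forall_fin_two.2 ⟨le_self_add, le_add_self⟩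
  rw [linearSeries, ev_add hz, ev_smul, ev_smul, ev_X, ev_X, form_one] <;>
  · rw [majorant_smul, majorant_X]
    finiteness

lemma two_le_order_sub_linearSeries {φ : Series} (h0 : constantCoeff φ = 0) :
    2 ≤ (φ - linearSeries φ).order := by
  refine le_order_succ_of_form (k := 1) ?_ fun v => ?_
  · refine one_le_order_iff_constCoeff_eq_zero.2 ?_
    rw [map_sub, h0, constantCoeff_linearSeries, sub_zero]
  · rw [form_sub, form_one_linearSeries, sub_self]

lemma Convergent.exists_norm_ev_sub_form_le {φ : Series} (hφ : Convergent φ)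
    (h0 : constantCoeff φ = 0) :
    ∃ C > 0, ∀ᶠ z in 𝓝 (0 : Plane), ‖ev φ z - form 1 φ z‖ ≤ C * ‖z‖ ^ 2 := by
  have hl := convergent_linearSeries φ
  obtain ⟨C, hC, h⟩ := (hφ.sub hl).exists_norm_ev_le (two_le_order_sub_linearSeries h0)
  refine ⟨C, hC, ?_⟩
  filter_upwards [h, (hφ.sub hl).eventually_ev_add hl] with z hz hz'
  rw [sub_add_cancel, ev_linearSeries] at hz'
  rwa [hz', add_sub_cancel_right]

lemma eventually_mul_norm_le (C : ℝ) {ε : ℝ} (hε : 0 < ε) :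
    ∀ᶠ z in 𝓝 (0 : Plane), C * ‖z‖ ≤ ε := by
  have h : Tendsto (fun z : Plane => C * ‖z‖) (𝓝 0) (𝓝 (C * ‖(0 : Plane)‖)) :=
    (continuous_const.mul continuous_norm).tendsto 0
  rw [norm_zero, mul_zero] at h
  exact h.eventually_le_const hε

end Linearization

/-- `g = 0` is an analytic invariant curve of the map with Taylor series `Φ`, along which this
map is a contraction. -/
structure IsContractedCurve (Φ : Fin 2 → Series) (g : Series) : Prop where
  convergent : Convergent g
  constantCoeff_eq : constantCoeff g = 0
  semiinvariant : ∃ w, Convergent w ∧ constantCoeff w ≠ 0 ∧ subst Φ g = w * g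
  contracted : ∃ κ C : ℝ, 0 ≤ κ ∧ κ < 1 ∧ 0 ≤ C ∧
    ∀ᶠ z in 𝓝 (0 : Plane), ‖fun i => ev (Φ i) z‖ ≤ κ * ‖z‖ + C * ‖ev g z‖

/-! ### The contracted curve in the two normal forms -/

section Models

variable {Φ : Fin 2 → Series} {f u : Series}

lemma exists_isContractedCurve_of_diagonal {d : Fin 2 → ℂ} (hΦ : ∀ i, constantCoeff (Φ i) = 0)
    (hΦc : ∀ i, Convergent (Φ i)) (hA : ∀ v i, linearPart Φ v i = d i * v i) (h00 : d 0 ≠ 0)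
    (h0 : ‖d 0‖ < 1) (h1 : 1 ≤ ‖d 1‖) (hf : f ≠ 0) (hu : subst Φ f = u * f)
    (hT : form f.order.toNat f ![1, 0] = 0) : ∃ g, g ∣ f ∧ IsContractedCurve Φ g := by
  have hN := two_le_order_sub_of_diagonal hΦ hA
  obtain ⟨s, hs, h⟩ := exists_graphDefect_eq_zero hΦ hN fun k hk h => by
    have h2 : ‖d 0‖ ^ k < 1 := pow_lt_one₀ (norm_nonneg _) h0 (by omega)
    rw [← norm_pow, ← h] at h2
    exact absurd h1 (not_le.2 h2)
  have hsc := convergent_of_graphDefect_eq_zero hΦ hΦc hN h0 h1 hs h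
  have hs0 := constantCoeff_of_two_le hs
  obtain ⟨q, hq, -⟩ := exists_eq_graphSeries_mul hs0
    (subst_graphArc_eq_zero hΦ hA h00 h0 h1 hs0 h hf hu hT)
  obtain ⟨w, hw, hw0, hwc⟩ := exists_subst_graphSeries_eq hΦ hA hs h
  have hgc : Convergent (graphSeries s) := (convergent_X 1).sub (convergent_subst_X_zero hsc)
  have hg0 := constantCoeff_graphSeries hs0
  refine ⟨graphSeries s, ⟨q, hq⟩, hgc, hg0, ⟨w, hwc hΦc hsc, ?_, hw⟩, ?_⟩
  · rw [hw0]
    exact norm_pos_iff.1 (one_pos.trans_le h1)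
  obtain ⟨C₀, hC₀, hE₀⟩ := (hΦc 0).exists_norm_ev_sub_form_le (hΦ 0)
  obtain ⟨C₁, hC₁, hE₁⟩ := (hΦc 1).exists_norm_ev_sub_form_le (hΦ 1)
  obtain ⟨C₂, hC₂, hE₂⟩ := hgc.exists_norm_ev_sub_form_le hg0
  set C := C₀ + (C₁ + ‖d 1‖ * C₂)
  -- The second coordinate of `z` equals the equation of the graph up to `O(‖z‖ ^ 2)`, so possible
  -- expansion by `d 1` is charged to the term in `g`. Half of the gap `1 - ‖d 0‖` absorbs all
  -- quadratic errors.
  refine ⟨(1 + ‖d 0‖) / 2, ‖d 1‖, by positivity, by linarith, norm_nonneg _, ?_⟩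
  filter_upwards [hE₀, hE₁, hE₂, eventually_mul_norm_le C (ε := (1 - ‖d 0‖) / 2) (by linarith)]
    with z h₀ h₁ h₂ h₃
  have hz0 := norm_le_pi_norm z 0
  have hz := norm_nonneg z
  have e0 : form 1 (Φ 0) z = d 0 * z 0 := hA z 0
  have e1 : form 1 (Φ 1) z = d 1 * z 1 := hA z 1
  have h4 := norm_le_norm_add_norm_sub' (ev (Φ 0) z) (form 1 (Φ 0) z)
  have h5 := norm_le_norm_add_norm_sub' (ev (Φ 1) z) (form 1 (Φ 1) z)
  have h6 := norm_le_norm_add_norm_sub (ev (graphSeries s) z) (form 1 (graphSeries s) z)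
  rw [form_one_graphSeries hs] at h₂ h6
  rw [e0] at h₀ h4
  rw [e1] at h₁ h5
  rw [norm_mul] at h4 h5
  have h7 : C * ‖z‖ * ‖z‖ ≤ (1 - ‖d 0‖) / 2 * ‖z‖ := by gcongr
  have h8 : ‖d 0‖ * ‖z 0‖ ≤ ‖d 0‖ * ‖z‖ := by gcongr
  have h9 : ‖d 1‖ * ‖z 1‖ ≤ ‖d 1‖ * (‖ev (graphSeries s) z‖ + C₂ * ‖z‖ ^ 2) := by
    gcongr
    linarith
  have h10 : 0 ≤ ‖d 1‖ * ‖ev (graphSeries s) z‖ := by positivity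
  have h11 : 0 ≤ ‖d 1‖ * C₂ * ‖z‖ ^ 2 := by positivity
  have h12 : 0 ≤ C₀ * ‖z‖ ^ 2 := by positivity
  have h13 : 0 ≤ C₁ * ‖z‖ ^ 2 := by positivity
  have h14 : C * ‖z‖ * ‖z‖ = C₀ * ‖z‖ ^ 2 + (C₁ * ‖z‖ ^ 2 + ‖d 1‖ * C₂ * ‖z‖ ^ 2) := by
    simp only [C]
    ring
  have h15 : 0 ≤ ‖d 0‖ * ‖z‖ := by positivity
  refine (pi_norm_le_iff_of_nonneg (by positivity)).2 (Fin.forall_fin_two.2 ⟨?_, ?_⟩)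
  · linarith
  · linarith

/-- A unit `v` with `v = (u / u(0)) (v ∘ Φ)` turns `f` into the eigenvector `v f` with eigenvalue
`u(0)`, which converges. The map contracts a full neighbourhood in the sup norm, so `C = 0`
suffices. -/
lemma exists_isContractedCurve_of_contraction {κ : ℝ} (hΦ : ∀ i, constantCoeff (Φ i) = 0)
    (hΦc : ∀ i, Convergent (Φ i)) (hκ : κ < 1)
    (hA : ∀ i, ‖coeff (Finsupp.single 0 1) (Φ i)‖ + ‖coeff (Finsupp.single 1 1) (Φ i)‖ ≤ κ)
    (hA' : Function.Surjective (linearPart Φ)) (hf : f ≠ 0) (hf0 : constantCoeff f = 0)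
    (hu : subst Φ f = u * f) : ∃ g, g ∣ f ∧ IsContractedCurve Φ g := by
  have hs := hasSubst_of_constantCoeff_zero hΦ
  have hκ0 : 0 ≤ κ := le_trans (by positivity) (hA 0)
  have hform : ∀ v i, ‖form 1 (Φ i) v‖ ≤ κ * ‖v‖ := fun v i => by
    rw [form_one]
    refine (norm_add_le _ _).trans ?_
    rw [norm_mul, norm_mul]
    refine le_trans ?_ (mul_le_mul_of_nonneg_right (hA i) (norm_nonneg v))
    rw [add_mul]
    gcongr <;> exact norm_le_pi_norm v _
  have hu0 : constantCoeff u ≠ 0 := by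
    intro h
    obtain ⟨v, hv⟩ := exists_form_ne_zero hf
    obtain ⟨v', rfl⟩ := hA' v
    rw [form_linearPart hΦ hu (order_eq_toNat hf).le, h, zero_mul] at hv
    exact hv rfl
  obtain ⟨v, hv, hv'⟩ := exists_eq_mul_subst hΦ hκ0 hκ
    (fun v => (pi_norm_le_iff_of_nonneg (by positivity)).2 (hform v))
    (u := C (constantCoeff u)⁻¹ * u) (by simp [hu0])
  have hg : subst Φ (v * f) = constantCoeff u • (v * f) := by
    rw [subst_mul hs, hu]
    conv_rhs => rw [hv']
    rw [smul_eq_C_mul]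
    have : (C (constantCoeff u) * C (constantCoeff u)⁻¹ : Series) = 1 := by
      rw [← map_mul, mul_inv_cancel₀ hu0, map_one]
    linear_combination (-(subst Φ v * u * f)) * this
  obtain ⟨r₀, hr0, hr1, hr⟩ := exists_radius
    (fun i => (hΦc i).sub (convergent_linearSeries (Φ i)))
    -- With the row bound `κ` for the linear part, this gives the rate `κ + (1 - κ) / 2 = (1 + κ) /
    -- 2 < 1`.
    (fun i => two_le_order_sub_linearSeries (hΦ i)) (ε := ENNReal.ofReal ((1 - κ) / 2))
    (by simpa using hκ)
  have hmaj : ∀ i, ∀ r ≤ r₀, majorant r (Φ i) ≤ ENNReal.ofReal ((1 + κ) / 2) * r := by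
    intro i r hr'
    rw [← add_sub_cancel (linearSeries (Φ i)) (Φ i)]
    refine (majorant_add_le _ _ _).trans ((add_le_add_right (hr r hr' i) _).trans ?_)
    have h1 : majorant r (linearSeries (Φ i)) ≤ ENNReal.ofReal κ * r := by
      refine (majorant_add_le _ _ _).trans ?_
      rw [majorant_smul, majorant_smul, majorant_X, majorant_X, ← add_mul, ← ofReal_norm,
        ← ofReal_norm, ← ENNReal.ofReal_add (norm_nonneg _) (norm_nonneg _)]
      gcongr
      exact hA i
    refine (add_le_add_left h1 _).trans ?_
    rw [← add_mul, ← ENNReal.ofReal_add hκ0 (by linarith)]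
    gcongr
    linarith
  have hv1 : IsUnit v := by
    rw [MvPowerSeries.isUnit_iff_constantCoeff, hv]
    exact isUnit_one
  refine ⟨v * f, (hv1.mul_left_dvd).2 dvd_rfl, ?_, by rw [map_mul, hf0, mul_zero],
    ⟨C (constantCoeff u), convergent_C _, by simpa using hu0, by rw [hg, smul_eq_C_mul]⟩,
    (1 + κ) / 2, 0, by linarith, by linarith, le_rfl, ?_⟩
  · refine ⟨r₀, hr0, majorant_ne_top_of_subst_eq_smul hΦ hr1 ?_ (fun i => hmaj i r₀ le_rfl)
      hu0 hg⟩
    rw [ENNReal.ofReal_lt_one]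
    linarith
  · filter_upwards [eventually_enorm_le hr0] with z hz
    rw [zero_mul, add_zero]
    have hz' : ‖z‖ₑ ≤ r₀ := by
      rw [← ofReal_norm, ENNReal.ofReal_le_iff_le_toReal hr1,
        pi_norm_le_iff_of_nonneg ENNReal.toReal_nonneg]
      intro i
      rw [← ENNReal.ofReal_le_iff_le_toReal hr1, ofReal_norm]
      exact hz i
    refine (pi_norm_le_iff_of_nonneg (by have := norm_nonneg z; nlinarith)).2 fun i => ?_
    have h1 : ‖ev (Φ i) z‖ₑ ≤ ENNReal.ofReal ((1 + κ) / 2) * ‖z‖ₑ :=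
      (enorm_ev_le (fun j => by
        rw [← ofReal_norm, ← ofReal_norm]
        exact ENNReal.ofReal_le_ofReal (norm_le_pi_norm z j)) _).trans (hmaj i _ hz')
    rw [← ofReal_norm, ← ofReal_norm, ← ENNReal.ofReal_mul (by linarith)] at h1
    exact (ENNReal.ofReal_le_ofReal_iff (by have := norm_nonneg z; nlinarith)).1 h1

end Models

/-! ### Normal forms of the linear part -/

section LinearAlgebra

variable {L : Plane →ₗ[ℂ] Plane} {c μ ε : ℂ} {v w : Plane}

lemma smul_add_smul_eq_mulVec (v w y : Plane) :
    y 0 • v + y 1 • w = !![v 0, w 0; v 1, w 1].mulVec y := by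
  ext i
  fin_cases i <;> simp [Matrix.mulVec, dotProduct, Fin.sum_univ_two] <;> ring

lemma exists_matrix_of_basis (hdet : v 0 * w 1 - w 0 * v 1 ≠ 0) (hv : L v = c • v)
    (hw : L w = ε • v + μ • w) : ∃ P Q : Matrix (Fin 2) (Fin 2) ℂ, Q * P = 1 ∧
      P.mulVec ![1, 0] = v ∧ ∀ y, Q.mulVec (L (P.mulVec y)) = ![c * y 0 + ε * y 1, μ * y 1] := by
  set P : Matrix (Fin 2) (Fin 2) ℂ := !![v 0, w 0; v 1, w 1] with hP
  have hP' : IsUnit P.det := by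
    rw [hP, Matrix.det_fin_two_of]
    exact isUnit_iff_ne_zero.2 hdet
  refine ⟨P, P⁻¹, Matrix.nonsing_inv_mul _ hP', ?_, fun y => ?_⟩
  · rw [hP, ← smul_add_smul_eq_mulVec]
    simp
  · have h1 : L (P.mulVec y) = P.mulVec ![c * y 0 + ε * y 1, μ * y 1] := by
      rw [hP, ← smul_add_smul_eq_mulVec, ← smul_add_smul_eq_mulVec, map_add, map_smul, map_smul,
        hv, hw]
      simp only [Matrix.cons_val_zero, Matrix.cons_val_one]
      module
    rw [h1, Matrix.mulVec_mulVec, Matrix.nonsing_inv_mul _ hP', Matrix.one_mulVec]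

/-- A normal form for linear maps with an eigenvalue in the unit disc. -/
lemma exists_matrix_triangular (hv0 : v ≠ 0) (hv : L v = c • v)
    (hc : ‖c‖ < 1) : ∃ P Q : Matrix (Fin 2) (Fin 2) ℂ, Q * P = 1 ∧ P.mulVec ![1, 0] = v ∧
      ∃ ε μ : ℂ, (∀ y, Q.mulVec (L (P.mulVec y)) = ![c * y 0 + ε * y 1, μ * y 1]) ∧
        ((‖μ‖ < 1 ∧ ‖c‖ + ‖ε‖ < 1) ∨ (1 ≤ ‖μ‖ ∧ ε = 0)) := by
  obtain ⟨w, hdet⟩ : ∃ w : Plane, v 0 * w 1 - w 0 * v 1 ≠ 0 := by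
    by_cases h : v 0 = 0
    · refine ⟨![1, 0], fun h1 => hv0 ?_⟩
      ext i
      fin_cases i
      · exact h
      · simpa using h1
    · exact ⟨![0, 1], by simpa using h⟩
  obtain ⟨ε, μ, hw⟩ : ∃ ε μ : ℂ, L w = ε • v + μ • w := by
    have hP' : IsUnit (!![v 0, w 0; v 1, w 1] : Matrix (Fin 2) (Fin 2) ℂ).det := by
      rw [Matrix.det_fin_two_of]
      exact isUnit_iff_ne_zero.2 hdet
    set y := (!![v 0, w 0; v 1, w 1]⁻¹).mulVec (L w) with hy
    refine ⟨y 0, y 1, ?_⟩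
    rw [smul_add_smul_eq_mulVec, hy, Matrix.mulVec_mulVec, Matrix.mul_nonsing_inv _ hP',
      Matrix.one_mulVec]
  rcases lt_or_ge ‖μ‖ 1 with hμ | hμ
  -- Scaling the second basis vector by `t` scales the off-diagonal entry by `t`, which makes the
  -- row sums smaller than one.
  · obtain ⟨t, ht0, ht⟩ : ∃ t : ℝ, 0 < t ∧ t * ‖ε‖ < 1 - ‖c‖ := by
      refine ⟨(1 - ‖c‖) / (‖ε‖ + 1), div_pos (by linarith) (by positivity), ?_⟩
      rw [div_mul_eq_mul_div, div_lt_iff₀ (by positivity)]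
      have := norm_nonneg ε
      nlinarith
    have ht0' : (t : ℂ) ≠ 0 := by exact_mod_cast ht0.ne'
    obtain ⟨P, Q, hQP, hPv, h⟩ := exists_matrix_of_basis (L := L) (w := (t : ℂ) • w) (μ := μ)
      (ε := t * ε) (c := c) (v := v) (fun h => hdet (mul_left_cancel₀ ht0' (by
        simp only [Pi.smul_apply, smul_eq_mul] at h
        linear_combination h))) hv (by
        rw [map_smul, hw]
        module)
    refine ⟨P, Q, hQP, hPv, _, _, h, Or.inl ⟨hμ, ?_⟩⟩
    rw [norm_mul, Complex.norm_real, Real.norm_of_nonneg ht0.le]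
    linarith
  -- Here `|c| < 1 ≤ |μ|`: the eigenvalues differ, and adding a multiple of `v` turns `w` into an
  -- eigenvector.
  · have hne : μ - c ≠ 0 := by
      rw [sub_ne_zero]
      rintro rfl
      linarith
    obtain ⟨P, Q, hQP, hPv, h⟩ := exists_matrix_of_basis (L := L) (w := w + (ε / (μ - c)) • v)
      (μ := μ) (ε := 0) (c := c) (v := v) (fun h => hdet (by
        simp only [Pi.smul_apply, Pi.add_apply, smul_eq_mul] at h
        linear_combination h)) hv (by
        rw [map_add, map_smul, hw, hv]
        have h1 : ε = (ε / (μ - c)) * (μ - c) := (div_mul_cancel₀ _ hne).symm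
        ext i
        simp only [Pi.add_apply, Pi.smul_apply, smul_eq_mul]
        linear_combination (v i) * h1)
    exact ⟨P, Q, hQP, hPv, _, _, h, Or.inr ⟨hμ, rfl⟩⟩

end LinearAlgebra

/-! ### Linear changes of coordinates -/

section ChangeOfCoordinates

/-- The Taylor series of a linear map. -/
noncomputable def matrixSeries (M : Matrix (Fin 2) (Fin 2) ℂ) (i : Fin 2) : Series :=
  M i 0 • X 0 + M i 1 • X 1

variable {M P Q : Matrix (Fin 2) (Fin 2) ℂ}

lemma constantCoeff_matrixSeries (i : Fin 2) : constantCoeff (matrixSeries M i) = 0 := by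
  simp [matrixSeries]

lemma hasSubst_matrixSeries : HasSubst (matrixSeries M) :=
  hasSubst_of_constantCoeff_zero constantCoeff_matrixSeries

lemma convergent_matrixSeries (i : Fin 2) : Convergent (matrixSeries M i) :=
  (convergent_smul_X 0).add (convergent_smul_X 1)

lemma form_matrixSeries (i : Fin 2) (v : Plane) :
    form 1 (matrixSeries M i) v = M.mulVec v i := by
  have h : ∀ f g : Series, form 1 (f + g) v = form 1 f v + form 1 g v := fun f g => by
    simp only [form_one, map_add]
    ring
  rw [matrixSeries, h, form_one_smul_X, form_one_smul_X, Matrix.mulVec, dotProduct,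
    Fin.sum_univ_two]

lemma ev_matrixSeries (i : Fin 2) (z : Plane) : ev (matrixSeries M i) z = M.mulVec z i := by
  have hz : ∀ i, ‖z i‖ₑ ≤ ‖z 0‖ₑ + ‖z 1‖ₑ := Fin.forall_fin_two.2 ⟨le_self_add, le_add_self⟩
  rw [matrixSeries, ev_add hz, ev_smul, ev_smul, ev_X, ev_X, Matrix.mulVec, dotProduct,
    Fin.sum_univ_two] <;>
  · rw [majorant_smul, majorant_X]
    finiteness

lemma subst_matrixSeries {a : Fin 2 → Series} (ha : HasSubst a) (i : Fin 2) :
    subst a (matrixSeries M i) = M i 0 • a 0 + M i 1 • a 1 := by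
  rw [matrixSeries, subst_add ha, subst_smul ha, subst_smul ha, subst_X ha, subst_X ha]

lemma subst_matrixSeries_matrixSeries (hQP : Q * P = 1) (i : Fin 2) :
    subst (matrixSeries P) (matrixSeries Q i) = X i := by
  have h : ∀ j, Q i 0 * P 0 j + Q i 1 * P 1 j = (1 : Matrix (Fin 2) (Fin 2) ℂ) i j := fun j => by
    rw [← hQP, Matrix.mul_apply, Fin.sum_univ_two]
  have h' : (Q i 0 * P 0 0 + Q i 1 * P 1 0) • (X 0 : Series) +
      (Q i 0 * P 0 1 + Q i 1 * P 1 1) • X 1 = X i := by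
    rw [h, h]
    obtain rfl | rfl : i = 0 ∨ i = 1 := by omega
    all_goals simp
  rw [subst_matrixSeries hasSubst_matrixSeries, ← h', matrixSeries, matrixSeries]
  module

lemma subst_subst_matrixSeries (hQP : Q * P = 1) (f : Series) :
    subst (matrixSeries P) (subst (matrixSeries Q) f) = f := by
  rw [subst_comp_subst_apply hasSubst_matrixSeries hasSubst_matrixSeries]
  simp only [subst_matrixSeries_matrixSeries hQP]
  exact congrFun subst_self f

/-- The Taylor series of `Q ∘ F ∘ P`, for linear maps `P` and `Q`. -/
noncomputable def conjSeries (P Q : Matrix (Fin 2) (Fin 2) ℂ) (Φ : Fin 2 → Series) (i : Fin 2) :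
    Series := subst (fun j => subst (matrixSeries P) (Φ j)) (matrixSeries Q i)

variable {Φ : Fin 2 → Series}

lemma constantCoeff_subst_matrixSeries (hΦ : ∀ i, constantCoeff (Φ i) = 0) (i : Fin 2) :
    constantCoeff (subst (matrixSeries P) (Φ i)) = 0 := by
  rw [constantCoeff_subst_of_zero constantCoeff_matrixSeries, hΦ]

lemma constantCoeff_conjSeries (hΦ : ∀ i, constantCoeff (Φ i) = 0) (i : Fin 2) :
    constantCoeff (conjSeries P Q Φ i) = 0 := by
  rw [conjSeries, constantCoeff_subst_of_zero (constantCoeff_subst_matrixSeries hΦ),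
    constantCoeff_matrixSeries]

lemma convergent_subst_matrixSeries {f : Series} (hf : Convergent f) :
    Convergent (subst (matrixSeries P) f) :=
  hf.subst convergent_matrixSeries constantCoeff_matrixSeries

lemma convergent_conjSeries (hΦ : ∀ i, constantCoeff (Φ i) = 0) (hΦc : ∀ i, Convergent (Φ i))
    (i : Fin 2) : Convergent (conjSeries P Q Φ i) :=
  (convergent_matrixSeries i).subst (fun j => convergent_subst_matrixSeries (hΦc j))
    (constantCoeff_subst_matrixSeries hΦ)

lemma linearPart_conjSeries (hΦ : ∀ i, constantCoeff (Φ i) = 0) (v : Plane) :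
    linearPart (conjSeries P Q Φ) v = Q.mulVec (linearPart Φ (P.mulVec v)) := by
  have h1 : linearPart (matrixSeries P) v = P.mulVec v := by
    ext k
    exact form_matrixSeries k v
  have h2 : linearPart (fun j => subst (matrixSeries P) (Φ j)) v =
      linearPart Φ (P.mulVec v) := by
    ext j
    rw [← h1]
    exact form_subst constantCoeff_matrixSeries (one_le_order_iff_constCoeff_eq_zero.2 (hΦ j)) v
  ext i
  rw [linearPart, conjSeries, form_subst (constantCoeff_subst_matrixSeries hΦ)
    (one_le_order_iff_constCoeff_eq_zero.2 (constantCoeff_matrixSeries i)), form_matrixSeries, h2]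

lemma subst_conjSeries (hPQ : P * Q = 1) (hΦ : ∀ i, constantCoeff (Φ i) = 0) (f : Series) :
    subst (conjSeries P Q Φ) (subst (matrixSeries P) f) =
      subst (matrixSeries P) (subst Φ f) := by
  have h1 := hasSubst_of_constantCoeff_zero (constantCoeff_subst_matrixSeries (P := P) hΦ)
  rw [subst_comp_subst_apply hasSubst_matrixSeries
      (hasSubst_of_constantCoeff_zero (constantCoeff_conjSeries hΦ)),
    subst_comp_subst_apply (hasSubst_of_constantCoeff_zero hΦ) hasSubst_matrixSeries]
  congr 1
  ext1 i
  unfold conjSeries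
  rw [← subst_comp_subst_apply hasSubst_matrixSeries h1, subst_matrixSeries_matrixSeries hPQ,
    subst_X h1]

lemma subst_matrixSeries_conjSeries (hPQ : P * Q = 1) (hΦ : ∀ i, constantCoeff (Φ i) = 0)
    (f : Series) : subst (matrixSeries Q) (subst (conjSeries P Q Φ) f) =
      subst Φ (subst (matrixSeries Q) f) := by
  have h1 := hasSubst_of_constantCoeff_zero (constantCoeff_subst_matrixSeries (P := P) hΦ)
  rw [subst_comp_subst_apply hasSubst_matrixSeries (hasSubst_of_constantCoeff_zero hΦ),
    subst_comp_subst_apply (hasSubst_of_constantCoeff_zero (constantCoeff_conjSeries hΦ))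
      hasSubst_matrixSeries]
  congr 1
  ext1 i
  rw [conjSeries, subst_comp_subst_apply h1 hasSubst_matrixSeries]
  simp only [subst_subst_matrixSeries hPQ]

lemma order_subst_matrixSeries (hPQ : P * Q = 1) (f : Series) :
    (subst (matrixSeries P) f).order = f.order := by
  refine le_antisymm ?_ (order_le_order_subst constantCoeff_matrixSeries f)
  conv_rhs => rw [← subst_subst_matrixSeries hPQ f]
  exact order_le_order_subst constantCoeff_matrixSeries _

lemma eventually_ev_conjSeries (hPQ : P * Q = 1) (hΦ : ∀ i, constantCoeff (Φ i) = 0)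
    (hΦc : ∀ i, Convergent (Φ i)) : ∀ᶠ z in 𝓝 (0 : Plane),
      (fun i => ev (conjSeries P Q Φ i) (Q.mulVec z)) = Q.mulVec fun i => ev (Φ i) z := by
  have hlim : Tendsto (fun z : Plane => Q.mulVec z) (𝓝 0) (𝓝 0) := by
    have : Continuous fun z : Plane => Q.mulVec z := by fun_prop
    simpa using this.tendsto 0
  have h1 : ∀ i, ∀ᶠ z in 𝓝 (0 : Plane), ev (conjSeries P Q Φ i) z =
      ev (matrixSeries Q i) fun j => ev (subst (matrixSeries P) (Φ j)) z := fun i =>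
    (convergent_matrixSeries i).eventually_ev_subst
      (fun j => convergent_subst_matrixSeries (hΦc j)) (constantCoeff_subst_matrixSeries hΦ)
  have h2 : ∀ i, ∀ᶠ z in 𝓝 (0 : Plane), ev (subst (matrixSeries P) (Φ i)) z =
      ev (Φ i) fun j => ev (matrixSeries P j) z := fun i =>
    (hΦc i).eventually_ev_subst convergent_matrixSeries constantCoeff_matrixSeries
  filter_upwards [hlim.eventually (eventually_all.2 h1), hlim.eventually (eventually_all.2 h2)]
    with z hz1 hz2
  ext i
  rw [hz1, ev_matrixSeries]
  congr 2
  ext j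
  rw [hz2]
  congr 1
  ext k
  rw [ev_matrixSeries, Matrix.mulVec_mulVec, hPQ, Matrix.one_mulVec]

end ChangeOfCoordinates

/-! ### Analyticity of the invariant curve -/

section Main

variable {Φ : Fin 2 → Series} {f u : Series}

/-- An irreducible invariant curve whose tangent eigenvalue lies in the unit disc is analytic, and
the map is a contraction along the curve in a suitable norm. -/
theorem exists_analytic_invariant_curve (hΦ : ∀ i, constantCoeff (Φ i) = 0)
    (hΦc : ∀ i, Convergent (Φ i)) {L : Plane →ₗ[ℂ] Plane} (hL : ∀ v, linearPart Φ v = L v)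
    (hL' : Function.Bijective L) {c : ℂ} (hc : ‖c‖ < 1) {v : Plane} (hv0 : v ≠ 0)
    (hv : L v = c • v) (hf : Irreducible f) (hu : subst Φ f = u * f)
    (hT : form f.order.toNat f v = 0) :
    ∃ g, Associated g f ∧ Convergent g ∧
      (∃ w, Convergent w ∧ constantCoeff w ≠ 0 ∧ subst Φ g = w * g) ∧
      ∃ P Q : Matrix (Fin 2) (Fin 2) ℂ, P * Q = 1 ∧ ∃ κ C : ℝ, 0 ≤ κ ∧ κ < 1 ∧ 0 ≤ C ∧
        ∀ᶠ z in 𝓝 (0 : Plane), ‖Q.mulVec fun i => ev (Φ i) z‖ ≤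
          κ * ‖Q.mulVec z‖ + C * ‖ev g z‖ := by
  have hf0 : constantCoeff f = 0 := constantCoeff_of_irreducible hf
  obtain ⟨P, Q, hQP, hPv, ε, μ, hA, hcase⟩ := exists_matrix_triangular hv0 hv hc
  have hPQ : P * Q = 1 := mul_eq_one_comm.1 hQP
  have hc0 : c ≠ 0 := by
    rintro rfl
    rw [zero_smul, ← map_zero L] at hv
    exact hv0 (hL'.1 hv)
  set Ψ := conjSeries P Q Φ with hΨ
  have hΨ0 : ∀ i, constantCoeff (Ψ i) = 0 := constantCoeff_conjSeries hΦ
  have hΨc : ∀ i, Convergent (Ψ i) := convergent_conjSeries hΦ hΦc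
  have hΨA : ∀ y, linearPart Ψ y = ![c * y 0 + ε * y 1, μ * y 1] := fun y => by
    rw [hΨ, linearPart_conjSeries hΦ, hL, hA]
  have hfP : subst (matrixSeries P) f ≠ 0 := by
    intro h
    have h1 := subst_subst_matrixSeries hPQ f
    rw [h, ← coe_substAlgHom hasSubst_matrixSeries, map_zero] at h1
    exact hf.ne_zero h1.symm
  have huP : subst Ψ (subst (matrixSeries P) f) =
      subst (matrixSeries P) u * subst (matrixSeries P) f := by
    rw [hΨ, subst_conjSeries hPQ hΦ, hu, subst_mul hasSubst_matrixSeries]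
  obtain ⟨g, hgf, hg⟩ : ∃ g, g ∣ subst (matrixSeries P) f ∧ IsContractedCurve Ψ g := by
    rcases hcase with ⟨hμ, hε⟩ | ⟨hμ, rfl⟩
    · refine exists_isContractedCurve_of_contraction (κ := max (‖c‖ + ‖ε‖) ‖μ‖) hΨ0 hΨc
        (max_lt hε hμ) ?_ ?_ hfP ?_ huP
      · have h0 : ∀ i, coeff (Finsupp.single 0 1) (Ψ i) = ![c, 0] i := fun i => by
          have h1 := congrFun (hΨA ![1, 0]) i
          rw [linearPart, form_one] at h1
          fin_cases i <;> simpa using h1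
        have h1 : ∀ i, coeff (Finsupp.single 1 1) (Ψ i) = ![ε, μ] i := fun i => by
          have h1 := congrFun (hΨA ![0, 1]) i
          rw [linearPart, form_one] at h1
          fin_cases i <;> simpa using h1
        intro i
        rw [h0, h1]
        fin_cases i <;> simp
      · intro y
        obtain ⟨x, hx⟩ := hL'.2 (P.mulVec y)
        refine ⟨Q.mulVec x, ?_⟩
        rw [hΨ, linearPart_conjSeries hΦ, Matrix.mulVec_mulVec, hPQ, Matrix.one_mulVec, hL, hx,
          Matrix.mulVec_mulVec, hQP, Matrix.one_mulVec]
      · rw [constantCoeff_subst_of_zero constantCoeff_matrixSeries, hf0]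
    · refine exists_isContractedCurve_of_diagonal (d := ![c, μ]) hΨ0 hΨc ?_ hc0 hc hμ hfP huP ?_
      · intro y i
        rw [hΨA]
        fin_cases i <;> simp
      · rw [order_subst_matrixSeries hPQ, form_subst constantCoeff_matrixSeries
          (order_eq_toNat hf.ne_zero).le]
        convert hT
        ext i
        rw [linearPart, form_matrixSeries, hPv]
  obtain ⟨w, hwc, hw0, hw⟩ := hg.semiinvariant
  obtain ⟨κ, C, hκ0, hκ1, hC, hest⟩ := hg.contracted
  have hg0 : constantCoeff (subst (matrixSeries Q) g) = 0 := by
    rw [constantCoeff_subst_of_zero constantCoeff_matrixSeries, hg.constantCoeff_eq]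
  have hdvd : subst (matrixSeries Q) g ∣ f := by
    rw [← subst_subst_matrixSeries hPQ f]
    obtain ⟨q, hq⟩ := hgf
    rw [hq, subst_mul hasSubst_matrixSeries]
    exact dvd_mul_right _ _
  refine ⟨subst (matrixSeries Q) g, ?_, convergent_subst_matrixSeries hg.convergent,
    ⟨subst (matrixSeries Q) w, convergent_subst_matrixSeries hwc, ?_, ?_⟩,
    P, Q, hPQ, κ, C, hκ0, hκ1, hC, ?_⟩
  -- A divisor of the irreducible `f` that vanishes at the origin is not a unit, hence an associate
  -- of `f`.
  · refine (hf.dvd_iff.1 hdvd).resolve_left ?_ |>.symm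
    rw [MvPowerSeries.isUnit_iff_constantCoeff, hg0]
    exact not_isUnit_zero
  · rwa [constantCoeff_subst_of_zero constantCoeff_matrixSeries]
  · rw [← subst_matrixSeries_conjSeries hPQ hΦ, ← hΨ, hw, subst_mul hasSubst_matrixSeries]
  · have hlim : Tendsto (fun z : Plane => Q.mulVec z) (𝓝 0) (𝓝 0) := by
      have : Continuous fun z : Plane => Q.mulVec z := by fun_prop
      simpa using this.tendsto 0
    filter_upwards [hlim.eventually hest, eventually_ev_conjSeries hPQ hΦ hΦc,
      hg.convergent.eventually_ev_subst (convergent_matrixSeries (M := Q))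
        constantCoeff_matrixSeries] with z h1 h2 h3
    rw [h2] at h1
    rw [h3]
    simp only [ev_matrixSeries]
    exact h1

end Main

/-! ### Derivative and local injectivity of the germ -/

section Taylor

lemma ev_zero (φ : Series) : ev φ 0 = constantCoeff φ := by
  rw [ev, tsum_eq_single 0]
  · simp
  · intro e he
    obtain ⟨i, hi⟩ : ∃ i, e i ≠ 0 := by
      by_contra! h
      exact he (Finsupp.ext h)
    rw [Finset.prod_eq_zero (Finset.mem_univ i) (by simp [hi]), mul_zero]

/-- The homogeneous part of degree one as a linear form. -/
noncomputable def linearForm (φ : Series) : Plane →L[ℂ] ℂ :=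
  coeff (Finsupp.single 0 1) φ • ContinuousLinearMap.proj 0 +
    coeff (Finsupp.single 1 1) φ • ContinuousLinearMap.proj 1

lemma linearForm_apply (φ : Series) (v : Plane) : linearForm φ v = form 1 φ v := by
  simp [linearForm, form_one]

lemma Convergent.hasFDerivAt {φ : Series} (hφ : Convergent φ) (h0 : constantCoeff φ = 0) :
    HasFDerivAt (ev φ) (linearForm φ) 0 := by
  obtain ⟨C, hC, h⟩ := hφ.exists_norm_ev_sub_form_le h0
  refine HasFDerivAt.of_isLittleO ?_
  have h1 : (fun z : Plane => ev φ z - ev φ 0 - linearForm φ (z - 0)) =O[𝓝 0]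
      fun z : Plane => ‖z - 0‖ ^ 2 := by
    refine Asymptotics.IsBigO.of_bound C ?_
    filter_upwards [h] with z hz
    rw [ev_zero, h0, sub_zero, sub_zero, linearForm_apply, norm_pow, norm_norm]
    exact hz
  exact h1.trans_isLittleO (Asymptotics.isLittleO_pow_sub_sub 0 one_lt_two)

lemma fderiv_apply_eq_linearPart {F : Plane → Plane} {Φ : Fin 2 → Series}
    (h : ∀ i, HasExpansion (fun z => F z i) (Φ i)) (h0 : ∀ i, constantCoeff (Φ i) = 0)
    (v : Plane) : linearPart Φ v = fderiv ℂ F 0 v := by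
  have h1 : HasFDerivAt F (ContinuousLinearMap.pi fun i => linearForm (Φ i)) 0 :=
    hasFDerivAt_pi.2 fun i =>
      ((h i).convergent.hasFDerivAt (h0 i)).congr_of_eventuallyEq (h i).eventually_eq
  rw [h1.fderiv]
  ext i
  exact (linearForm_apply _ _).symm

lemma eventually_apply_eq {F : Plane → Plane} {Φ : Fin 2 → Series}
    (h : ∀ i, HasExpansion (fun z => F z i) (Φ i)) :
    ∀ᶠ z in 𝓝 (0 : Plane), F z = fun i => ev (Φ i) z := by
  filter_upwards [eventually_all.2 fun i => (h i).eventually_eq] with z hz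
  exact funext hz

lemma exists_isOpen_injOn {F : Plane → Plane} (hF : IsDiffGerm F) :
    ∃ V : Set Plane, IsOpen V ∧ (0 : Plane) ∈ V ∧ Set.InjOn F V := by
  have h1 : HasStrictFDerivAt F ((ContinuousLinearEquiv.ofBijective (fderiv ℂ F 0)
      (LinearMap.ker_eq_bot.2 hF.bijective_fderiv.1)
      (LinearMap.range_eq_top.2 hF.bijective_fderiv.2) : Plane ≃L[ℂ] Plane) :
        Plane →L[ℂ] Plane) 0 := by
    rw [ContinuousLinearEquiv.coe_ofBijective]
    exact hF.analyticAt.hasStrictFDerivAt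
  exact ⟨_, (h1.toOpenPartialHomeomorph F).open_source, h1.mem_toOpenPartialHomeomorph_source,
    (h1.toOpenPartialHomeomorph F).injOn⟩

end Taylor

/-! ### Orbits with infinite contact lie on the curve -/

section Dynamics

/-- A quantity that decays at most geometrically along an orbit vanishes if it is bounded by
all powers of a geometrically decaying quantity. -/
lemma forall_eq_zero_of_decay {x y : ℕ → ℝ} {δ κ : ℝ} {n₀ : ℕ} (hδ : 0 < δ) (hκ0 : 0 ≤ κ)
    (hκ : κ < 1) (hx0 : ∀ n, 0 ≤ x n) (hy0 : ∀ n, 0 ≤ y n)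
    (hx : ∀ n ≥ n₀, δ * x n ≤ x (n + 1)) (hy : ∀ᶠ n in atTop, y (n + 1) ≤ κ * y n)
    (hxy : ∀ k : ℕ, ∃ C > 0, ∀ᶠ n in atTop, x n ≤ C * y n ^ k) : ∀ n ≥ n₀, x n = 0 := by
  intro n hn
  by_contra hne
  have hpow : ∀ m ≥ n₀, ∀ j, δ ^ j * x m ≤ x (m + j) := by
    intro m hm j
    induction j with
    | zero => simp
    | succ j ih =>
      calc δ ^ (j + 1) * x m = δ * (δ ^ j * x m) := by ring
        _ ≤ δ * x (m + j) := by gcongr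
        _ ≤ x (m + j + 1) := hx _ (by omega)
  -- With `κ ^ k < δ`, the `k`-th power of `y` decays faster than a non-zero `x` can: comparing the
  -- two rates after `j` steps bounds `x p` by a multiple of `(κ ^ k / δ) ^ j`.
  obtain ⟨k, hk⟩ := exists_pow_lt_of_lt_one hδ hκ
  obtain ⟨C, hC, hCk⟩ := hxy k
  obtain ⟨m, hm⟩ := eventually_atTop.1 (hy.and hCk)
  set p := n + m with hp
  have hxp : 0 < x p :=
    (mul_pos (pow_pos hδ m) (lt_of_le_of_ne (hx0 n) (Ne.symm hne))).trans_le (hpow n hn m)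
  have hyp : ∀ j, y (p + j) ≤ κ ^ j * y p := by
    intro j
    induction j with
    | zero => simp
    | succ j ih =>
      calc y (p + j + 1) ≤ κ * y (p + j) := (hm _ (by omega)).1
        _ ≤ κ * (κ ^ j * y p) := by gcongr
        _ = κ ^ (j + 1) * y p := by ring
  have hle : ∀ j : ℕ, x p ≤ C * y p ^ k * (κ ^ k / δ) ^ j := by
    intro j
    have h1 : δ ^ j * x p ≤ C * (κ ^ j * y p) ^ k := by
      refine (hpow p (by omega) j).trans (((hm _ (by omega)).2).trans ?_)
      gcongr
      · exact hy0 _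
      · exact hyp j
    rw [div_pow, mul_div_assoc', le_div_iff₀ (pow_pos hδ j)]
    calc x p * δ ^ j = δ ^ j * x p := mul_comm _ _
      _ ≤ C * (κ ^ j * y p) ^ k := h1
      _ = C * y p ^ k * (κ ^ k) ^ j := by ring
  have hlim : Tendsto (fun j : ℕ => C * y p ^ k * (κ ^ k / δ) ^ j) atTop (𝓝 0) := by
    have := (tendsto_pow_atTop_nhds_zero_of_lt_one (r := κ ^ k / δ) (by positivity)
      ((div_lt_one hδ).2 hk)).const_mul (C * y p ^ k)
    rwa [mul_zero] at this
  exact absurd (ge_of_tendsto' hlim hle) (not_le.2 hxp)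

lemma exists_norm_le_mul_norm_mulVec {P Q : Matrix (Fin 2) (Fin 2) ℂ} (hPQ : P * Q = 1) :
    ∃ B > 0, ∀ z : Plane, ‖z‖ ≤ B * ‖Q.mulVec z‖ := by
  obtain ⟨B, hB, h⟩ := (LinearMap.toContinuousLinearMap P.mulVecLin).isBoundedLinearMap.bound
  refine ⟨B, hB, fun z => ?_⟩
  have h1 : P.mulVec (Q.mulVec z) = z := by rw [Matrix.mulVec_mulVec, hPQ, Matrix.one_mulVec]
  conv_lhs => rw [← h1]
  exact h (Q.mulVec z)

variable {F : Plane → Plane} {Γ : Ideal Series} {a : ℕ → Plane} {g w : Series}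
  {P Q : Matrix (Fin 2) (Fin 2) ℂ} {κ C δ : ℝ} {n₀ : ℕ}

/-- Contact of order two makes the term in `g` at most `(1 - κ) / 2` times the adapted norm, so the
orbit eventually decays at rate `(1 + κ) / 2`. Contraction and contact are needed only eventually;
only the lower bound along `g` has to hold from `n₀` on, and it carries the vanishing back to `n₀`.
-/
lemma ev_eq_zero_of_isStableOrbit (hΓ : IsFormalCurve Γ) (ha : IsStableOrbit F a)
    (haΓ : IsAsymptoticTo (Set.range a) Γ) (hg : Convergent g) (hgΓ : g ∈ Γ) (hPQ : P * Q = 1)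
    (hκ0 : 0 ≤ κ) (hκ : κ < 1) (hC : 0 ≤ C)
    (hF : ∀ᶠ z in 𝓝 (0 : Plane), ‖Q.mulVec (F z)‖ ≤ κ * ‖Q.mulVec z‖ + C * ‖ev g z‖)
    (hδ : 0 < δ) (hinv : ∀ n ≥ n₀, δ * ‖ev g (a n)‖ ≤ ‖ev g (F (a n))‖) :
    ∀ n ≥ n₀, ev g (a n) = 0 := by
  obtain ⟨B, hB, hBz⟩ := exists_norm_le_mul_norm_mulVec hPQ
  have hcontact := norm_ev_le_of_isAsymptoticTo hΓ ha.tendsto_zero haΓ hg hgΓ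
  obtain ⟨D, hD, hD2⟩ := hcontact 2
  have key := forall_eq_zero_of_decay (x := fun n => ‖ev g (a n)‖)
    (y := fun n => ‖Q.mulVec (a n)‖) (n₀ := n₀) hδ (κ := (1 + κ) / 2) (by linarith) (by linarith)
    (fun _ => norm_nonneg _) (fun _ => norm_nonneg _) (fun n hn => by
      rw [ha.step]
      exact hinv n hn) ?_ fun k => ?_
  · exact fun n hn => norm_eq_zero.1 (key n hn)
  · filter_upwards [hD2, ha.tendsto_zero.eventually hF, ha.tendsto_zero.eventually
      (eventually_mul_norm_le (C * D * B) (ε := (1 - κ) / 2) (by linarith))] with n h1 h2 h3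
    rw [ha.step]
    have h4 : C * ‖ev g (a n)‖ ≤ (1 - κ) / 2 * ‖Q.mulVec (a n)‖ :=
      calc C * ‖ev g (a n)‖ ≤ C * (D * ‖a n‖ ^ 2) := by gcongr
        _ = C * D * ‖a n‖ * ‖a n‖ := by ring
        _ ≤ C * D * ‖a n‖ * (B * ‖Q.mulVec (a n)‖) := by gcongr; exact hBz _
        _ = C * D * B * ‖a n‖ * ‖Q.mulVec (a n)‖ := by ring
        _ ≤ _ := by gcongr
    linarith
  · obtain ⟨E, hE, hEk⟩ := hcontact k
    refine ⟨E * B ^ k, by positivity, ?_⟩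
    filter_upwards [hEk] with n hn
    rw [mul_assoc, ← mul_pow]
    refine hn.trans ?_
    gcongr
    exact hBz _

end Dynamics

end FormalCurves

theorem mainTheorem10 (F : Plane → Plane) (hF : IsDiffGerm F)
    (Γ : Ideal Series) (hΓ : IsInvariantCurve F Γ)
    (c : ℂ) (hc : IsTangentEigenvalue F Γ c) (hc1 : ‖c‖ < 1) :
    ∃ U Z : Set Plane, IsAnalyticRepresentative Γ U Z ∧
      AnalyticOnNhd ℂ F U ∧ Set.InjOn F U ∧
      ∀ a : ℕ → Plane, IsStableOrbit F a → IsAsymptoticTo (Set.range a) Γ →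
        (∀ᶠ n in atTop, a n ∈ Z) ∧ ((∀ n, a n ∈ U) → ∀ n, a n ∈ Z) := by
  obtain ⟨hΓf, Φ, hexp, hinv⟩ := hΓ
  obtain ⟨v, ⟨hv0, f, hf, hfT⟩, hv⟩ := hc
  have hFΦ := eventually_apply_eq hexp
  have hΦc := fun i => (hexp i).convergent
  have hΦ : ∀ i, MvPowerSeries.constantCoeff (Φ i) = 0 := fun i => by
    have := congrFun hFΦ.self_of_nhds i
    rw [hF.map_zero, ev_zero] at this
    exact this.symm
  have hfirr : Irreducible f := hΓf.irreducible hf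
  obtain ⟨u, hu⟩ : ∃ u, MvPowerSeries.subst Φ f = u * f := by
    have h1 := hinv f (hf ▸ Ideal.mem_span_singleton_self f)
    rw [hf] at h1
    obtain ⟨u, hu⟩ := Ideal.mem_span_singleton'.1 h1
    exact ⟨u, hu.symm⟩
  obtain ⟨g, hgf, hg, ⟨w, hwc, hw0, hw⟩, P, Q, hPQ, κ, C, hκ0, hκ, hC, hest⟩ :=
    exists_analytic_invariant_curve hΦ hΦc (L := (fderiv ℂ F 0 : Plane →ₗ[ℂ] Plane))
      (fderiv_apply_eq_linearPart hexp hΦ) hF.bijective_fderiv hc1 hv0 hv hfirr hu hfT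
  have hgΓ : Γ = Ideal.span {g} := hf.trans (Ideal.span_singleton_eq_span_singleton.2 hgf).symm
  have hmult : ∀ᶠ z in 𝓝 (0 : Plane), ev g (F z) = ev w z * ev g z := by
    filter_upwards [hFΦ, hg.eventually_ev_subst hΦc hΦ, hwc.eventually_ev_mul hg]
      with z h1 h2 h3
    rw [h1, ← h2, hw, h3]
  -- The lower bound for the decay of `g` along orbits, available because `w` does not vanish at the
  -- origin.
  have hδ : ∀ᶠ z in 𝓝 (0 : Plane), ‖MvPowerSeries.constantCoeff w‖ / 2 < ‖ev w z‖ := by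
    refine hwc.analyticAt.continuousAt.norm.eventually_const_lt ?_
    beta_reduce
    rw [ev_zero]
    exact half_lt_self (norm_pos_iff.2 hw0)
  obtain ⟨V, hVo, hV0, hVinj⟩ := exists_isOpen_injOn hF
  -- On `U` the relation `g ∘ F = w g` and the lower bound for `w` must hold at every point, as they
  -- are used along the whole orbit; the contraction estimate is left out, being needed only near
  -- `0`.
  obtain ⟨U, hU, hUo, hU0⟩ := eventually_nhds_iff.1 (hF.analyticAt.eventually_analyticAt.and
    (hg.analyticAt.eventually_analyticAt.and (hmult.and (hδ.and (hVo.mem_nhds hV0)))))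
  refine ⟨U, {z ∈ U | ev g z = 0}, ⟨hUo, hU0, ev g, g, fun z hz => (hU z hz).2.1,
    hg.hasExpansion, hgΓ, rfl⟩, fun z hz => (hU z hz).1,
    hVinj.mono fun z hz => (hU z hz).2.2.2.2, fun a ha haΓ => ?_⟩
  -- The case `n₀ = 0` gives the statement for orbits contained in `U`; a large `n₀` gives the
  -- eventual one.
  have key : ∀ n₀, (∀ n ≥ n₀, a n ∈ U) → ∀ n ≥ n₀, ev g (a n) = 0 := by
    intro n₀ hn₀
    refine ev_eq_zero_of_isStableOrbit hΓf ha haΓ hg (hgΓ ▸ Ideal.mem_span_singleton_self g)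
      hPQ hκ0 hκ hC ?_ (half_pos (norm_pos_iff.2 hw0)) fun n hn => ?_
    · filter_upwards [hFΦ, hest] with z h1 h2
      rwa [h1]
    · rw [(hU _ (hn₀ n hn)).2.2.1, norm_mul]
      gcongr
      exact (hU _ (hn₀ n hn)).2.2.2.1.le
  refine ⟨?_, fun h n => ⟨h n, key 0 (fun n _ => h n) n (Nat.zero_le n)⟩⟩
  obtain ⟨n₀, hn₀⟩ := eventually_atTop.1 (ha.tendsto_zero.eventually (hUo.mem_nhds hU0))
  filter_upwards [eventually_ge_atTop n₀] with n hn
  exact ⟨hn₀ n hn, key n₀ hn₀ n hn⟩
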